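/- A bicoloured plane tree with $n$ edges is encoded, after labelling its edges by $1,\dots,n$, by a pair $(\sigma_0,\sigma_1)$ of permutations in $S_n$: the cycles of $\sigma_0$ (resp. $\sigma_1$), fixed points included, are the cyclic orders of the edges around the black (resp. white) vertices. Two such trees are isomorphic if their pairs are simultaneously conjugate in $S_n$. The monodromy (cartographic) group of the tree is $\langle\sigma_0,\sigma_1\rangle\le S_n$, and its passport is $[\alpha;\beta;n]$, where $\alpha,\beta\vdash n$ are the multisets of degrees of the black and of the white vertices, i.e. the cycle types of $\sigma_0$ and $\sigma_1$. Each of the six passports $$F_7=[3^2,1;\,2^2,1^3;\,7],\quad F_8=[3,2^2;\,2^2,1^3;\,7],\quad F_9=[3^2,1^3;\,2^4,1;\,9],$$ $$F_{10}=[3,2^2,1^3;\,2^5;\,10],\quad F_{11}=[4^3,1^8;\,2^{10};\,20],\quad F_{12}=[5^3,1^{11};\,2^{13};\,26]$$ is the passport of exactly two bicoloured plane trees up to isomorphism. Their monodromy groups are, up to isomorphism, as follows. - $F_7$: $\mathrm{PSL}(3,2)$ for both trees. - $F_8$: $A_7$ for both trees. - $F_9$: $\mathrm{PSL}(2,8)\rtimes\mathbb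 Z_3$ for both trees. - $F_{10}$: $(A_5\times A_5)\rtimes(\mathbb Z_2\times\mathbb Z_2)$ for one tree and $(A_5\times A_5)\rtimes\mathbb Z_2$ for the other. - $F_{11}$: $\mathbb Z_2^8\rtimes\bigl((A_5\times A_5)\rtimes D_8\bigr)$ for one tree and $(A_{10}\times A_{10})\rtimes D_8$ for the other, where $D_8$ is the dihedral group of order $8$. - $F_{12}$: $(A_{13}\times A_{13})\rtimes\mathbb Z_2$ for both trees. Here $N\rtimes K$ stands for a semidirect product with respect to some non-trivial action of $K$ on $N$. -/

import Mathlib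

/-- A bicoloured plane tree whose `n` edges carry the labels `Fin n`. The cycles of `σ₀` (fixed
points included) are the black vertices, those of `σ₁` the white vertices; each cycle is the cyclic
order, around its vertex, of the edges at that vertex. Edge `e` joins the black vertex containing `e`
to the white vertex containing `e`. The graph is connected and has one vertex more than edges, so it
is a tree. -/
structure PlaneTree (n : ℕ) where
  σ₀ : Equiv.Perm (Fin n)
  σ₁ : Equiv.Perm (Fin n)
  connected : MulAction.IsPretransitive (Subgroup.closure {σ₀, σ₁}) (Fin n)
  card_vertices : σ₀.partition.parts.card + σ₁.partition.parts.card = n + 1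

namespace PlaneTree

/-- The tree has passport `[α; β; n]`: the black vertices have degrees `α` and the white vertices
have degrees `β`. -/
def HasPassport {n : ℕ} (T : PlaneTree n) (α β : Multiset ℕ) : Prop :=
  T.σ₀.partition.parts = α ∧ T.σ₁.partition.parts = β

/-- Two labelled trees are the same bicoloured plane tree up to relabelling of the edges. -/
def Iso {n : ℕ} (T T' : PlaneTree n) : Prop :=
  ∃ τ : Equiv.Perm (Fin n), τ * T.σ₀ * τ⁻¹ = T'.σ₀ ∧ τ * T.σ₁ * τ⁻¹ = T'.σ₁

/-- The monodromy (cartographic) group of the tree. -/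
def monodromyGroup {n : ℕ} (T : PlaneTree n) : Subgroup (Equiv.Perm (Fin n)) :=
  Subgroup.closure {T.σ₀, T.σ₁}

/-- Up to isomorphism, `T₁` and `T₂` are precisely the two trees with passport `[α; β; n]`. -/
def IsPair {n : ℕ} (T₁ T₂ : PlaneTree n) (α β : Multiset ℕ) : Prop :=
  T₁.HasPassport α β ∧ T₂.HasPassport α β ∧ ¬ T₁.Iso T₂ ∧
    ∀ T : PlaneTree n, T.HasPassport α β → T.Iso T₁ ∨ T.Iso T₂

end PlaneTree

/-- `G` is a semidirect product `N ⋊ K`, for some non-trivial action of `K` on `N`. -/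
def IsSemidirect (G N K : Type*) [Group G] [Group N] [Group K] : Prop :=
  ∃ φ : K →* MulAut N, φ ≠ 1 ∧ Nonempty (G ≃* N ⋊[φ] K)

/-- `A_m × A_m`. -/
abbrev AltSq (m : ℕ) : Type := alternatingGroup (Fin m) × alternatingGroup (Fin m)

/-- The cyclic group of order `m`, written multiplicatively. -/
abbrev Cyc (m : ℕ) : Type := Multiplicative (ZMod m)

open Equiv

/-! Counting trees. In every passport but F₉ three black vertices matter: all of them in F₇ and F₈,
those of degree greater than one in F₁₀, F₁₁ and F₁₂. Counting edges leaves just two white vertices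
that join them, connectedness makes one of the three a centre joined to both others, and all the
rest are leaves. Such a tree is determined by the degrees along this path and by the angle `k`
between the two joining edges at the centre (`exists_centre_form`). In F₉ there are two big black
vertices, and the position of the only white leaf plays the role of the angle. The combinatorial
description becomes an isomorphism by way of a map of edge labels commuting with both rotations
(`exists_equivariant_of_isTable`); connectedness and finiteness make such a map bijective
(`iso_of_equivariant`). Reading the path backwards identifies the remaining cases down to two trees,
which relations between words in the rotations tell apart.

Groups of F₇, F₈ and F₉. For F₇ the edges are the nonzero vectors of a three-dimensional space over
the field with two elements, both rotations are linear, and words in them give all transvections.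
For F₈ the generators are even, their product is a long cycle, and a word gives a 3-cycle of
consecutive letters. For F₉ the edges are the points of the projective line over the field with
eight elements: the black rotation is the Frobenius map or its square, the white one an involution
of `PSL(2, 8)` whose Frobenius conjugates generate that group.

Groups of F₁₀, F₁₁ and F₁₂. All white vertices have degree two, so the labels are half-edges of a
plain tree and split into two copies of its edges. The white rotation exchanges the copies and the
black one acts as a pair `(a, b)`, with `a * b` a long cycle. One word giving `(3-cycle, 1)` forces
`A × A` into the group (`altSq_le_doublePairs`), and the signs of `a` and `b` then decide the
complement: exchange alone, Klein four-group, or dihedral group. The exception is the tree of F₁₁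
with a half turn: its letters fall into pairs, and the group is built from even flips of the pairs,
from `A₅ × A₅` permuting them, and from a dihedral group (`FivePairs.isSemidirect_doubleGroup`). -/

/-! ### Internal semidirect products and generation of alternating groups -/

theorem IsSemidirect.of_mulEquiv {G G' N K : Type*} [Group G] [Group G'] [Group N] [Group K]
    (e : G ≃* G') (h : IsSemidirect G' N K) : IsSemidirect G N K := by
  obtain ⟨φ, hφ, ⟨f⟩⟩ := h
  exact ⟨φ, hφ, ⟨e.trans f⟩⟩

/-- An internal semidirect product, given by embeddings of the two factors. -/
theorem exists_semidirectProduct_embedding {P N K : Type*} [Group P] [Group N] [Group K]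
    (i : N →* P) (j : K →* P) (hi : Function.Injective i)
    (norm : ∀ k n, ∃ n', i n' = j k * i n * (j k)⁻¹) (disj : ∀ n k, i n = j k → k = 1)
    (nontriv : ∃ k n, j k * i n * (j k)⁻¹ ≠ i n) :
    ∃ φ : K →* MulAut N, φ ≠ 1 ∧ ∃ L : N ⋊[φ] K →* P, Function.Injective L ∧
      L.range = i.range ⊔ j.range ∧ ∀ x, L x = i x.left * j x.right := by
  choose f hf using norm
  let φ : K →* MulAut N :=
    { toFun := fun k =>
        { toFun := f k
          invFun := f k⁻¹
          left_inv := fun n => hi (by rw [hf, hf, map_inv]; group)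
          right_inv := fun n => hi (by rw [hf, hf, map_inv]; group)
          map_mul' := fun a b => hi (by rw [map_mul, hf, hf, hf, map_mul]; group) }
      map_one' := MulEquiv.ext fun n => hi (by change i (f 1 n) = i n; rw [hf, map_one]; group)
      map_mul' := fun k l => MulEquiv.ext fun n => hi (by
        change i (f (k * l) n) = i (f k (f l n)); rw [hf, hf, hf, map_mul]; group) }
  have hφ : ∀ k n, i (φ k n) = j k * i n * (j k)⁻¹ := hf
  let L : N ⋊[φ] K →* P := SemidirectProduct.lift i j fun k =>
    MonoidHom.ext fun n => by simp [hφ]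
  have hL : ∀ x, L x = i x.left * j x.right := fun x => rfl
  have hinj : Function.Injective L := by
    rw [injective_iff_map_eq_one]
    intro x hx
    -- A kernel element puts `i x.left` in the image of `j`, which `disj` forbids unless `x.right`
    -- is trivial. The case `n = 1` of `disj` already contains the injectivity of `j`.
    rw [hL, mul_eq_one_iff_eq_inv, ← map_inv] at hx
    have h1 := disj _ _ hx
    have h2 : x.right = 1 := inv_eq_one.mp h1
    rw [h1, map_one] at hx
    exact SemidirectProduct.ext (hi (by rw [hx]; simp)) (by simpa using h2)
  have hrange : L.range = i.range ⊔ j.range := by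
    apply le_antisymm
    · rintro _ ⟨x, rfl⟩
      rw [hL]
      exact mul_mem (Subgroup.mem_sup_left ⟨_, rfl⟩) (Subgroup.mem_sup_right ⟨_, rfl⟩)
    · refine sup_le ?_ ?_
      · rintro _ ⟨n, rfl⟩
        exact ⟨SemidirectProduct.inl n, by simp [hL]⟩
      · rintro _ ⟨k, rfl⟩
        exact ⟨SemidirectProduct.inr k, by simp [hL]⟩
  refine ⟨φ, ?_, L, hinj, hrange, hL⟩
  rintro h
  obtain ⟨k, n, hkn⟩ := nontriv
  apply hkn
  rw [← hφ, h]
  rfl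

theorem isSemidirect_of_embeddings {P N K : Type*} [Group P] [Group N] [Group K] (i : N →* P)
    (j : K →* P) (hi : Function.Injective i)
    (norm : ∀ k n, ∃ n', i n' = j k * i n * (j k)⁻¹) (disj : ∀ n k, i n = j k → k = 1)
    (nontriv : ∃ k n, j k * i n * (j k)⁻¹ ≠ i n) (H : Subgroup P) (hH : i.range ⊔ j.range = H) :
    IsSemidirect H N K := by
  obtain ⟨φ, hφ, L, hL, hr, -⟩ := exists_semidirectProduct_embedding i j hi norm disj nontriv
  exact ⟨φ, hφ, ⟨((MonoidHom.ofInjective hL).trans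
    (MulEquiv.subgroupCongr (hr.trans hH))).symm⟩⟩

/-- Adjacent transpositions generate, and an even word in them can be cut into factors `s i * s j`.
These telescope through `s 0`. -/
theorem alternatingGroup_le_of_swap_mul_swap {n : ℕ} (H : Subgroup (Perm (Fin (n + 2))))
    (h : ∀ i j : Fin (n + 1), (i : ℕ) + 1 = j →
      swap i.castSucc i.succ * swap j.castSucc j.succ ∈ H) :
    alternatingGroup (Fin (n + 2)) ≤ H := by
  let s : Fin (n + 1) → Perm (Fin (n + 2)) := fun i => swap i.castSucc i.succ
  have hs : ∀ i, s i * s i = 1 := fun i => swap_mul_self _ _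
  have hsi : ∀ i, (s i)⁻¹ = s i := fun i => swap_inv _ _
  have h0 : ∀ (k : ℕ) (hk : k < n + 1), s 0 * s ⟨k, hk⟩ ∈ H := by
    intro k
    induction k with
    | zero => intro hk; exact (hs 0).symm ▸ one_mem H
    | succ k ih =>
      intro hk
      have := mul_mem (ih (by omega)) (h ⟨k, by omega⟩ ⟨k + 1, hk⟩ rfl)
      change s 0 * s ⟨k, _⟩ * (s ⟨k, _⟩ * s ⟨k + 1, _⟩) ∈ H at this
      rwa [mul_assoc, ← mul_assoc (s ⟨k, _⟩), hs, one_mul] at this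
  have h1 : ∀ i, s 0 * s i ∈ H := fun i => h0 i i.2
  have h2 : ∀ i, s i * s 0 ∈ H := fun i => by
    have := inv_mem (h1 i)
    rwa [mul_inv_rev, hsi, hsi] at this
  -- Odd permutations are carried along, corrected by `s 0`, so that the induction can lengthen the
  -- word by one letter at a time.
  have key : ∀ σ : Perm (Fin (n + 2)),
      (Perm.sign σ = 1 ∧ σ ∈ H) ∨ (Perm.sign σ = -1 ∧ s 0 * σ ∈ H) := by
    intro σ
    have hσ : σ ∈ Submonoid.closure (Set.range s) := by
      rw [Perm.mclosure_swap_castSucc_succ]; trivial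
    induction hσ using Submonoid.closure_induction_left with
    | one => exact Or.inl ⟨map_one _, one_mem H⟩
    | mul_left x hx y _ ih =>
      obtain ⟨i, rfl⟩ := hx
      have hsg : Perm.sign (s i) = -1 := Perm.sign_swap (Fin.castSucc_lt_succ).ne
      rcases ih with ⟨hy, hyH⟩ | ⟨hy, hyH⟩
      · exact Or.inr ⟨by rw [map_mul, hsg, hy, mul_one],
          by rw [← mul_assoc]; exact mul_mem (h1 i) hyH⟩
      · refine Or.inl ⟨by rw [map_mul, hsg, hy]; rfl, ?_⟩
        have := mul_mem (h2 i) hyH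
        rwa [mul_assoc, ← mul_assoc (s 0), hs, one_mul] at this
  intro σ hσ
  rw [Perm.mem_alternatingGroup] at hσ
  rcases key σ with ⟨-, h⟩ | ⟨h, -⟩
  · exact h
  · rw [hσ] at h; exact absurd h (by decide)

/-- A subgroup normalised by the long cycle and containing a 3-cycle of consecutive letters contains
the alternating group. -/
theorem alternatingGroup_le_of_finRotate {n : ℕ} (H : Subgroup (Perm (Fin (n + 2))))
    (hn : ∀ σ, σ ∈ H ↔ finRotate (n + 2) * σ * (finRotate (n + 2))⁻¹ ∈ H)
    (i j : Fin (n + 1)) (hij : (i : ℕ) + 1 = j)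
    (h : swap i.castSucc i.succ * swap j.castSucc j.succ ∈ H) :
    alternatingGroup (Fin (n + 2)) ≤ H := by
  have hrot : ∀ k l : Fin (n + 1), (k : ℕ) + 1 = l →
      finRotate (n + 2) * swap k.castSucc k.succ * (finRotate (n + 2))⁻¹
        = swap l.castSucc l.succ := by
    intro k l hkl
    have e : ∀ x : Fin (n + 1), finRotate (n + 2) x.castSucc = x.succ := fun x => by simp
    have e' : k.succ = l.castSucc := Fin.ext (by simpa using hkl)
    rw [← swap_apply_apply, e, e', e]
  have step : ∀ k l p : Fin (n + 1), (k : ℕ) + 1 = l → (l : ℕ) + 1 = p →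
      (swap k.castSucc k.succ * swap l.castSucc l.succ ∈ H ↔
        swap l.castSucc l.succ * swap p.castSucc p.succ ∈ H) := by
    intro k l p hkl hlp
    rw [hn, ← hrot k l hkl, ← hrot l p hlp, ← hrot k l hkl]
    simp only [mul_assoc, inv_mul_cancel_left]
  -- Induction on the distance `d` from the given 3-cycle, on either side of it; `step` is an
  -- equivalence, so it can be used in both directions.
  have all : ∀ (d : ℕ) (k l : Fin (n + 1)), (k : ℕ) + 1 = l →
      ((k : ℕ) + d = i ∨ (i : ℕ) + d = k) →
        swap k.castSucc k.succ * swap l.castSucc l.succ ∈ H := by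
    intro d
    induction d with
    | zero =>
      intro k l hkl hd
      obtain rfl : k = i := Fin.ext (by omega)
      obtain rfl : l = j := Fin.ext (by omega)
      exact h
    | succ d ih =>
      intro k l hkl hd
      rcases hd with hd | hd
      · exact (step k l ⟨l + 1, by omega⟩ hkl rfl).2 (ih l ⟨l + 1, by omega⟩ rfl (by omega))
      -- Here `k = i + d + 1` is positive, so the truncated `k - 1` is a genuine predecessor.
      · have hk : (k : ℕ) - 1 + 1 = k := by omega
        exact (step ⟨k - 1, by omega⟩ k l hk hkl).1 (ih ⟨k - 1, by omega⟩ k hk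
          (by right; simp only; omega))
  refine alternatingGroup_le_of_swap_mul_swap H fun k l hkl => ?_
  rcases le_total (k : ℕ) i with h' | h'
  · exact all (i - k) k l hkl (by omega)
  · exact all (k - i) k l hkl (by omega)

theorem exists_hom_cyc {P : Type*} [Group P] (n : ℕ) (g : P) (hg : g ^ n = 1) :
    ∃ j : Cyc n →* P, ∀ k : ℕ, j (Multiplicative.ofAdd (k : ZMod n)) = g ^ k := by
  let f : ℤ →+ Additive P := zmultiplesHom _ (Additive.ofMul g)
  have hf : f n = 0 := by
    change (n : ℤ) • Additive.ofMul g = 0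
    rw [natCast_zsmul, ← ofMul_pow, hg]; rfl
  refine ⟨AddMonoidHom.toMultiplicativeLeft (ZMod.lift n ⟨f, hf⟩), fun k => ?_⟩
  change Additive.toMul (ZMod.lift n ⟨f, hf⟩ (k : ZMod n)) = g ^ k
  have := ZMod.lift_coe n ⟨f, hf⟩ (k : ℤ)
  rw [Int.cast_natCast] at this
  rw [this]
  change Additive.toMul ((k : ℤ) • Additive.ofMul g) = g ^ k
  rw [natCast_zsmul, ← ofMul_pow]; rfl

theorem exists_hom_dihedral {P : Type*} [Group P] (n : ℕ) (R S : P) (hR : R ^ n = 1)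
    (hS : S * S = 1) (hSR : S * R * S = R⁻¹) :
    ∃ j : DihedralGroup n →* P, ∀ k : ℕ, j (DihedralGroup.r k) = R ^ k ∧
      j (DihedralGroup.sr k) = S * R ^ k := by
  obtain ⟨f, hf⟩ := exists_hom_cyc n R hR
  have hSi : S⁻¹ = S := inv_eq_of_mul_eq_one_left hS
  have hf' : ∀ i : ZMod n, f (Multiplicative.ofAdd i) * S = S * f (Multiplicative.ofAdd (-i)) := by
    intro i
    obtain ⟨k, rfl⟩ := ZMod.intCast_surjective i
    have h1 : f (Multiplicative.ofAdd (1 : ZMod n)) = R := by simpa using hf 1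
    have : Multiplicative.ofAdd (k : ZMod n) = Multiplicative.ofAdd (1 : ZMod n) ^ k := by
      rw [← ofAdd_zsmul]; simp
    rw [ofAdd_neg, map_inv, this, map_zpow, h1, ← inv_zpow, ← hSR]
    nth_rw 2 [← hSi]
    have : (S * R * S) ^ k = S * R ^ k * S⁻¹ := by rw [← conj_zpow, hSi]
    rw [hSi, this, hSi, ← mul_assoc, ← mul_assoc, hS, one_mul]
  refine ⟨{ toFun := fun x => match x with
              | .r i => f (Multiplicative.ofAdd i)
              | .sr i => S * f (Multiplicative.ofAdd i)
            map_one' := f.map_one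
            map_mul' := ?_ }, fun k => ⟨hf k, congrArg (S * ·) (hf k)⟩⟩
  rintro (x | x) (y | y)
  · simp
  · simp only [DihedralGroup.r_mul_sr]
    rw [← mul_assoc, hf', mul_assoc, ← map_mul, ← ofAdd_add, neg_add_eq_sub]
  · simp [mul_assoc]
  · simp only [DihedralGroup.sr_mul_sr]
    rw [mul_assoc, ← mul_assoc _ S, hf', ← mul_assoc, ← mul_assoc, hS, one_mul, ← map_mul,
      ← ofAdd_add, neg_add_eq_sub]

/-! ### Doubled trees: subgroups of `(Sym × Sym) ⋊ 2` containing `A × A` -/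

section Double

variable {α : Type*}

/-- The monodromy group of a bipartite tree whose white vertices all have degree two: the labels
are doubled, `a` and `b` act on the two copies, and the two copies are exchanged. -/
def doubleGroup (a b : Perm α) : Subgroup (Perm (α ⊕ α)) :=
  Subgroup.closure {Perm.sumCongrHom α α (a, b), Equiv.sumComm α α}

/-- The pairs of permutations that act inside `doubleGroup a b`. -/
def doublePairs (a b : Perm α) : Subgroup (Perm α × Perm α) :=
  (doubleGroup a b).comap (Perm.sumCongrHom α α)

theorem sumComm_mul_self : (Equiv.sumComm α α : Perm (α ⊕ α)) * Equiv.sumComm α α = 1 := by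
  ext x; rcases x with x | x <;> rfl

theorem sumComm_mul_sumCongrHom (p : Perm α × Perm α) :
    (Equiv.sumComm α α : Perm (α ⊕ α)) * Perm.sumCongrHom α α p =
      Perm.sumCongrHom α α p.swap * Equiv.sumComm α α := by
  ext x; rcases x with x | x <;> rfl

theorem sumComm_conj_sumCongrHom (p : Perm α × Perm α) :
    (Equiv.sumComm α α : Perm (α ⊕ α)) * Perm.sumCongrHom α α p * (Equiv.sumComm α α : Perm (α ⊕ α))⁻¹
      = Perm.sumCongrHom α α p.swap := by
  rw [sumComm_mul_sumCongrHom, mul_inv_cancel_right]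

theorem sumComm_mem_doubleGroup (a b : Perm α) : (Equiv.sumComm α α : Perm _) ∈ doubleGroup a b :=
  Subgroup.subset_closure (by simp)

theorem mem_doublePairs (a b : Perm α) : (a, b) ∈ doublePairs a b :=
  Subgroup.subset_closure (by simp)

theorem swap_mem_doublePairs {a b : Perm α} {p : Perm α × Perm α} (hp : p ∈ doublePairs a b) :
    p.swap ∈ doublePairs a b := by
  change Perm.sumCongrHom α α _ ∈ doubleGroup a b
  rw [← sumComm_conj_sumCongrHom]
  exact mul_mem (mul_mem (sumComm_mem_doubleGroup a b) hp)
    (inv_mem (sumComm_mem_doubleGroup a b))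

theorem mem_doublePairs' (a b : Perm α) : (b, a) ∈ doublePairs a b :=
  swap_mem_doublePairs (mem_doublePairs a b)

/-- Conjugation by `(a, b) * (b, a) = (a * b, b * a)` rotates the first coordinate by the long cycle
and keeps a trivial second coordinate trivial. The elements `(x, 1)` are therefore a subgroup
normalised by the rotation, where a single 3-cycle is enough; the exchange turns them into the
elements `(1, y)`. -/
theorem altSq_le_doublePairs {n : ℕ} {a b : Perm (Fin (n + 2))} (hab : a * b = finRotate (n + 2))
    (i j : Fin (n + 1)) (hij : (i : ℕ) + 1 = j)
    (h : (swap i.castSucc i.succ * swap j.castSucc j.succ, 1) ∈ doublePairs a b)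
    {x y : Perm (Fin (n + 2))} (hx : x ∈ alternatingGroup _) (hy : y ∈ alternatingGroup _) :
    (x, y) ∈ doublePairs a b := by
  have hg : (finRotate (n + 2), b * a) ∈ doublePairs a b := by
    rw [← hab]
    exact mul_mem (mem_doublePairs a b) (mem_doublePairs' a b)
  have key : alternatingGroup (Fin (n + 2)) ≤
      (doublePairs a b).comap (MonoidHom.inl (Perm (Fin (n + 2))) (Perm (Fin (n + 2)))) := by
    refine alternatingGroup_le_of_finRotate _ (fun σ => ?_) i j hij h
    change (σ, (1 : Perm (Fin (n + 2)))) ∈ doublePairs a b ↔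
      (_, (1 : Perm (Fin (n + 2)))) ∈ doublePairs a b
    have e : ((finRotate (n + 2) * σ * (finRotate (n + 2))⁻¹, (1 : Perm (Fin (n + 2)))) :
        Perm (Fin (n + 2)) × Perm (Fin (n + 2))) =
        (finRotate (n + 2), b * a) * (σ, 1) * (finRotate (n + 2), b * a)⁻¹ := by simp
    rw [e]
    constructor
    · exact fun hσ => mul_mem (mul_mem hg hσ) (inv_mem hg)
    · intro hσ
      have := mul_mem (mul_mem (inv_mem hg) hσ) hg
      simpa only [mul_assoc, inv_mul_cancel_left, inv_mul_cancel, mul_one] using this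
  have hx' : (x, (1 : Perm (Fin (n + 2)))) ∈ doublePairs a b := key hx
  have hy' : (y, (1 : Perm (Fin (n + 2)))) ∈ doublePairs a b := key hy
  simpa using mul_mem hx' (swap_mem_doublePairs hy')

theorem sumCongrHom_mul_sumComm_notMem [Nonempty α] (p : Perm α × Perm α) :
    Perm.sumCongrHom α α p * (Equiv.sumComm α α : Perm _) ∉ (Perm.sumCongrHom α α).range := by
  rintro ⟨q, hq⟩
  have := congrArg (fun f : Perm (α ⊕ α) => f (Sum.inl (Classical.arbitrary α))) hq
  simp at this

theorem doubleGroup_le {a b : Perm α} {H : Subgroup (Perm (α ⊕ α))}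
    (h1 : Perm.sumCongrHom α α (a, b) ∈ H) (h2 : (Equiv.sumComm α α : Perm _) ∈ H) :
    doubleGroup a b ≤ H := by
  rw [doubleGroup, Subgroup.closure_le]
  rintro _ (rfl | rfl)
  exacts [h1, h2]

variable [Fintype α] [DecidableEq α]

variable (α) in
/-- `A × A`, `A` the alternating group, acting on two copies of the letters. -/
def altSqHom : alternatingGroup α × alternatingGroup α →* Perm (α ⊕ α) :=
  (Perm.sumCongrHom α α).comp
    (MonoidHom.prodMap (alternatingGroup α).subtype (alternatingGroup α).subtype)

theorem altSqHom_apply (x : alternatingGroup α × alternatingGroup α) :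
    altSqHom α x = Perm.sumCongrHom α α (x.1, x.2) := rfl

theorem altSqHom_injective : Function.Injective (altSqHom α) :=
  Perm.sumCongrHom_injective.comp
    (Function.Injective.prodMap Subtype.val_injective Subtype.val_injective)

theorem sumCongrHom_mem_altSqHom_range {a b : Perm α} :
    Perm.sumCongrHom α α (a, b) ∈ (altSqHom α).range ↔
      a ∈ alternatingGroup α ∧ b ∈ alternatingGroup α := by
  constructor
  · rintro ⟨x, hx⟩
    have := Perm.sumCongrHom_injective hx
    simp only [MonoidHom.prodMap, Prod.ext_iff] at this
    exact ⟨this.1 ▸ x.1.2, this.2 ▸ x.2.2⟩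
  · rintro ⟨ha, hb⟩
    exact ⟨(⟨a, ha⟩, ⟨b, hb⟩), rfl⟩

theorem altSqHom_range_le : (altSqHom α).range ≤ (Perm.sumCongrHom α α).range := by
  rintro _ ⟨x, rfl⟩
  exact ⟨_, rfl⟩

theorem exists_altSqHom_sumCongrHom_conj (p : Perm α × Perm α) (x) :
    ∃ y, altSqHom α y = Perm.sumCongrHom α α p * altSqHom α x * (Perm.sumCongrHom α α p)⁻¹ := by
  change _ ∈ (altSqHom α).range
  rw [altSqHom_apply, ← map_inv, ← map_mul, ← map_mul]
  exact sumCongrHom_mem_altSqHom_range.2 ⟨Subgroup.Normal.conj_mem inferInstance _ x.1.2 p.1,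
    Subgroup.Normal.conj_mem inferInstance _ x.2.2 p.2⟩

theorem exists_altSqHom_mul_sumComm_conj (p : Perm α × Perm α) (x) :
    ∃ y, altSqHom α y = Perm.sumCongrHom α α p * (Equiv.sumComm α α : Perm _) * altSqHom α x *
      (Perm.sumCongrHom α α p * (Equiv.sumComm α α : Perm _))⁻¹ := by
  obtain ⟨y, hy⟩ := exists_altSqHom_sumCongrHom_conj p (x.2, x.1)
  refine ⟨y, hy.trans ?_⟩
  have := sumComm_conj_sumCongrHom (α := α) (x.1, x.2)
  rw [altSqHom_apply, altSqHom_apply, mul_inv_rev, ← mul_assoc]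
  rw [mul_assoc _ _ (Perm.sumCongrHom α α (x.1, x.2)), mul_assoc _ (_ * _) (_⁻¹), this]
  rfl

theorem sumComm_conj_altSqHom_ne (hα : 3 ≤ Fintype.card α) : ∃ x : alternatingGroup α × _,
    (Equiv.sumComm α α : Perm _) * altSqHom α x * (Equiv.sumComm α α : Perm _)⁻¹ ≠
      altSqHom α x := by
  have : Nontrivial (alternatingGroup α) := alternatingGroup.nontrivial_of_three_le_card
    (by simpa using hα)
  obtain ⟨x, hx⟩ := exists_ne (1 : alternatingGroup α)
  refine ⟨(x, 1), fun h => hx ?_⟩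
  rw [altSqHom_apply, sumComm_conj_sumCongrHom] at h
  have := Perm.sumCongrHom_injective h
  simp only [Prod.swap, Prod.ext_iff] at this
  exact Subtype.ext this.1.symm

theorem altSqHom_range_le_doubleGroup {a b : Perm α}
    (h : ∀ x ∈ alternatingGroup α, ∀ y ∈ alternatingGroup α, (x, y) ∈ doublePairs a b) :
    (altSqHom α).range ≤ doubleGroup a b := by
  rintro _ ⟨x, rfl⟩
  exact h _ x.1.2 _ x.2.2

end Double

theorem cyc_two_cases (k : Cyc 2) : k = 1 ∨ k = Multiplicative.ofAdd (1 : ZMod 2) := by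
  revert k; decide

theorem dihedral_four_cases {p : DihedralGroup 4 → Prop} (h0 : p 1) (h1 : p (.r 1)) (h2 : p (.r 2))
    (h3 : p (.r 3)) (h4 : p (.sr 0)) (h5 : p (.sr 1)) (h6 : p (.sr 2)) (h7 : p (.sr 3)) (x) :
    p x := by
  rcases x with x | x <;> fin_cases x <;> assumption

section Double

variable {α : Type*}

/-- The dihedral group generated by a pair of commuting involutions and the exchange. -/
theorem exists_dihedral_hom_double (p q : Perm α) (hp : p * p = 1) (hq : q * q = 1)
    (hpq : p * q = q * p) :
    ∃ j : DihedralGroup 4 →* Perm (α ⊕ α),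
      j (.r 1) = Perm.sumCongrHom α α (p, q) * Equiv.sumComm α α ∧
      j (.r 2) = Perm.sumCongrHom α α (p * q, p * q) ∧
      j (.r 3) = Perm.sumCongrHom α α (q, p) * Equiv.sumComm α α ∧
      j (.sr 0) = Perm.sumCongrHom α α 1 * Equiv.sumComm α α ∧
      j (.sr 1) = Perm.sumCongrHom α α (q, p) ∧
      j (.sr 2) = Perm.sumCongrHom α α (p * q, p * q) * Equiv.sumComm α α ∧
      j (.sr 3) = Perm.sumCongrHom α α (p, q) := by
  set S : Perm (α ⊕ α) := Equiv.sumComm α α with hSdef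
  set W := Perm.sumCongrHom α α with hW
  have hS : S * S = 1 := sumComm_mul_self
  have hSW : ∀ x, S * W x = W x.swap * S := sumComm_mul_sumCongrHom
  have hSW' : ∀ x y, S * (W x * y) = W x.swap * (S * y) := fun x y => by
    rw [← mul_assoc, hSW, mul_assoc]
  have h2 : (W (p, q) * S) * (W (p, q) * S) = W (p * q, p * q) := by
    rw [mul_assoc, hSW', hS, mul_one, ← map_mul]
    simp [hpq]
  have hc : (p * q) * (p * q) = 1 := by
    rw [mul_assoc, ← mul_assoc q, ← hpq, mul_assoc p, hq, mul_one, hp]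
  have h3 : W (p * q, p * q) * (W (p, q) * S) = W (q, p) * S := by
    rw [← mul_assoc, ← map_mul]
    simp only [Prod.mk_mul_mk]
    rw [mul_assoc p q q, hq, mul_one, hpq, mul_assoc, hp, mul_one]
  have h4 : W (p * q, p * q) * W (p * q, p * q) = 1 := by
    rw [← map_mul]
    simp only [Prod.mk_mul_mk, hc]
    exact map_one W
  -- The rotation `W (p, q) * S` has square `W (p * q, p * q)`, an involution or trivial, and the
  -- reflection is the exchange itself.
  obtain ⟨j, hj⟩ := exists_hom_dihedral 4 (W (p, q) * S) S
    (by rw [show 4 = 2 + 2 from rfl, pow_add, pow_two, h2, h4]) hS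
    (by
      rw [eq_inv_iff_mul_eq_one]
      simp only [mul_assoc, hSW', Prod.swap_prod_mk, ← map_mul, Prod.mk_mul_mk, hS,
        mul_one, hp, hq]
      exact map_one W)
  refine ⟨j, ?_, ?_, ?_, ?_, ?_, ?_, ?_⟩
  · simpa using (hj 1).1
  · have := (hj 2).1
    rw [pow_two, h2] at this
    exact this
  · have := (hj 3).1
    rw [pow_succ, pow_two, h2, h3] at this
    exact this
  · have := (hj 0).2
    rw [pow_zero, mul_one] at this
    rw [map_one, one_mul]
    exact_mod_cast this
  · have := (hj 1).2
    rw [pow_one, hSW', hS, mul_one] at this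
    exact_mod_cast this
  · have := (hj 2).2
    rw [pow_two, h2, hSW] at this
    exact this
  · have := (hj 3).2
    rw [pow_succ, pow_two, h2, h3, hSW', hS, mul_one] at this
    exact this

variable [Fintype α] [DecidableEq α]

/-- With `a` and `b` even, `(a, b)` already lies in `A × A`, and only the exchange remains. -/
theorem isSemidirect_double_even (hα : 3 ≤ Fintype.card α) {a b : Perm α}
    (ha : a ∈ alternatingGroup α) (hb : b ∈ alternatingGroup α)
    (h : ∀ x ∈ alternatingGroup α, ∀ y ∈ alternatingGroup α, (x, y) ∈ doublePairs a b) :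
    IsSemidirect (doubleGroup a b) (alternatingGroup α × alternatingGroup α) (Cyc 2) := by
  have : Nonempty α := Fintype.card_pos_iff.1 (by omega)
  obtain ⟨j, hj⟩ := exists_hom_cyc 2 (Equiv.sumComm α α : Perm (α ⊕ α))
    (by rw [pow_two, sumComm_mul_self])
  have hj1 : j (Multiplicative.ofAdd 1) = (Equiv.sumComm α α : Perm (α ⊕ α)) := by
    simpa using hj 1
  refine isSemidirect_of_embeddings (altSqHom α) j altSqHom_injective ?_ ?_ ?_ _ ?_
  · intro k n
    rcases cyc_two_cases k with rfl | rfl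
    · exact ⟨n, by simp⟩
    · simpa [hj1] using exists_altSqHom_mul_sumComm_conj 1 n
  · intro n k hk
    rcases cyc_two_cases k with rfl | rfl
    · rfl
    · rw [hj1, ← one_mul (Equiv.sumComm α α : Perm (α ⊕ α)), ← map_one (Perm.sumCongrHom α α)] at hk
      exact absurd (hk ▸ altSqHom_range_le ⟨n, rfl⟩) (sumCongrHom_mul_sumComm_notMem 1)
  · obtain ⟨n, hn⟩ := sumComm_conj_altSqHom_ne hα
    exact ⟨_, n, by rwa [hj1]⟩
  · apply le_antisymm
    · refine sup_le (altSqHom_range_le_doubleGroup h) ?_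
      rintro _ ⟨k, rfl⟩
      rcases cyc_two_cases k with rfl | rfl
      · simp [one_mem]
      · exact hj1 ▸ sumComm_mem_doubleGroup a b
    · exact doubleGroup_le
        (Subgroup.mem_sup_left (sumCongrHom_mem_altSqHom_range.2 ⟨ha, hb⟩))
        (Subgroup.mem_sup_right ⟨_, hj1⟩)

theorem mem_alternatingGroup_mul_of_sign_eq_neg_one {x y : Perm α} (hx : Perm.sign x = -1)
    (hy : Perm.sign y = -1) : x * y ∈ alternatingGroup α := by
  rw [Perm.mem_alternatingGroup, map_mul, hx, hy]; rfl

/-- Modulo `A × A` the pair `(a, b)` equals `(t, t)`, an involution commuting with the exchange: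
together they form a Klein four-group. -/
theorem isSemidirect_double_odd_odd (hα : 3 ≤ Fintype.card α) {a b t : Perm α}
    (ha : Perm.sign a = -1) (hb : Perm.sign b = -1) (ht : Perm.sign t = -1) (htt : t * t = 1)
    (h : ∀ x ∈ alternatingGroup α, ∀ y ∈ alternatingGroup α, (x, y) ∈ doublePairs a b) :
    IsSemidirect (doubleGroup a b) (alternatingGroup α × alternatingGroup α) (Cyc 2 × Cyc 2) := by
  have : Nonempty α := Fintype.card_pos_iff.1 (by omega)
  set S : Perm (α ⊕ α) := Equiv.sumComm α α with hS
  set W := Perm.sumCongrHom α α with hW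
  obtain ⟨j₁, hj₁⟩ := exists_hom_cyc 2 (W (t, t))
    (by rw [pow_two, ← map_mul, Prod.mk_mul_mk, htt]; exact map_one W)
  obtain ⟨j₂, hj₂⟩ := exists_hom_cyc 2 S (by rw [pow_two, hS, sumComm_mul_self])
  replace hj₁ : j₁ (Multiplicative.ofAdd 1) = W (t, t) := by simpa using hj₁ 1
  replace hj₂ : j₂ (Multiplicative.ofAdd 1) = S := by simpa using hj₂ 1
  have hcomm : ∀ m n, Commute (j₁ m) (j₂ n) := by
    intro m n
    rcases cyc_two_cases m with rfl | rfl
    · rw [map_one j₁]; exact Commute.one_left _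
    rcases cyc_two_cases n with rfl | rfl
    · rw [map_one j₂]; exact Commute.one_right _
    rw [hj₁, hj₂]
    exact (sumComm_mul_sumCongrHom (t, t)).symm
  let j := MonoidHom.noncommCoprod j₁ j₂ hcomm
  have hj : ∀ x y, j (x, y) = j₁ x * j₂ y := fun x y => rfl
  -- A nontrivial element of the complement stays out of `A × A` for one of two reasons: it has an
  -- odd component, or it exchanges the copies.
  have hform : ∀ k, ∃ p : Perm α × Perm α, (j k = W p ∧ (k = 1 ∨ Perm.sign p.1 = -1)) ∨
      j k = W p * S := by
    rintro ⟨x, y⟩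
    rw [hj]
    rcases cyc_two_cases x with rfl | rfl <;> rcases cyc_two_cases y with rfl | rfl
    · exact ⟨1, Or.inl ⟨by simp, Or.inl rfl⟩⟩
    · exact ⟨1, Or.inr (by simp [hj₂])⟩
    · exact ⟨(t, t), Or.inl ⟨by simp [hj₁], Or.inr ht⟩⟩
    · exact ⟨(t, t), Or.inr (by simp [hj₁, hj₂])⟩
  have hmem : (t, t) ∈ doublePairs a b := by
    have := mul_mem (h _ (mem_alternatingGroup_mul_of_sign_eq_neg_one ht
      (Perm.sign_inv a ▸ ha)) _ (mem_alternatingGroup_mul_of_sign_eq_neg_one ht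
      (Perm.sign_inv b ▸ hb))) (mem_doublePairs a b)
    simpa only [Prod.mk_mul_mk, inv_mul_cancel_right] using this
  refine isSemidirect_of_embeddings (altSqHom α) j altSqHom_injective ?_ ?_ ?_ _ ?_
  · intro k n
    obtain ⟨p, ⟨hp, -⟩ | hp⟩ := hform k <;> rw [hp]
    · exact exists_altSqHom_sumCongrHom_conj p n
    · exact exists_altSqHom_mul_sumComm_conj p n
  · intro n k hk
    obtain ⟨p, ⟨hp, hp' | hp'⟩ | hp⟩ := hform k
    · exact hp'
    · rw [hp] at hk
      have := (sumCongrHom_mem_altSqHom_range.1 ⟨n, hk⟩).1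
      rw [Perm.mem_alternatingGroup, hp'] at this
      exact absurd this (by decide)
    · rw [hp] at hk
      exact absurd (hk ▸ altSqHom_range_le ⟨n, rfl⟩) (sumCongrHom_mul_sumComm_notMem p)
  · obtain ⟨n, hn⟩ := sumComm_conj_altSqHom_ne hα
    refine ⟨(1, Multiplicative.ofAdd 1), n, ?_⟩
    rwa [hj, hj₂, map_one, one_mul]
  · apply le_antisymm
    · refine sup_le (altSqHom_range_le_doubleGroup h) ?_
      rintro _ ⟨⟨x, y⟩, rfl⟩
      rw [hj]
      refine mul_mem ?_ ?_
      · rcases cyc_two_cases x with rfl | rfl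
        · simp [one_mem]
        · exact hj₁ ▸ hmem
      · rcases cyc_two_cases y with rfl | rfl
        · simp [one_mem]
        · exact hj₂ ▸ sumComm_mem_doubleGroup a b
    · refine doubleGroup_le ?_ ?_
      · have e : W (a, b) = W (a * t, b * t) * W (t, t) := by
          rw [← map_mul, Prod.mk_mul_mk, mul_assoc, htt, mul_one, mul_assoc, htt, mul_one]
        rw [← hW, e]
        refine mul_mem (Subgroup.mem_sup_left (sumCongrHom_mem_altSqHom_range.2
          ⟨mem_alternatingGroup_mul_of_sign_eq_neg_one ha ht,
            mem_alternatingGroup_mul_of_sign_eq_neg_one hb ht⟩))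
          (Subgroup.mem_sup_right ⟨(Multiplicative.ofAdd 1, 1), ?_⟩)
        rw [hj, hj₁, map_one, mul_one]
      · refine Subgroup.mem_sup_right ⟨(1, Multiplicative.ofAdd 1), ?_⟩
        rw [hj, hj₂, map_one, one_mul]

/-- Modulo `A × A` the pair `(a, b)` equals `(t, 1)`. The exchange conjugates it to `(1, t)`, so
these two commuting involutions and the exchange form a dihedral group of order eight. -/
theorem isSemidirect_double_odd_even (hα : 3 ≤ Fintype.card α) {a b t : Perm α}
    (ha : Perm.sign a = -1) (hb : Perm.sign b = 1) (ht : Perm.sign t = -1) (htt : t * t = 1)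
    (h : ∀ x ∈ alternatingGroup α, ∀ y ∈ alternatingGroup α, (x, y) ∈ doublePairs a b) :
    IsSemidirect (doubleGroup a b) (alternatingGroup α × alternatingGroup α)
      (DihedralGroup 4) := by
  have : Nonempty α := Fintype.card_pos_iff.1 (by omega)
  obtain ⟨j, hr1, hr2, hr3, hs0, hs1, hs2, hs3⟩ :=
    exists_dihedral_hom_double t 1 htt (one_mul 1) (by simp)
  rw [mul_one] at hr2 hs2
  set S : Perm (α ⊕ α) := Equiv.sumComm α α with hS
  set W := Perm.sumCongrHom α α with hW
  have hform : ∀ k, ∃ p : Perm α × Perm α, p ∈ doublePairs a b ∧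
      ((j k = W p ∧ (k = 1 ∨ Perm.sign p.1 = -1 ∨ Perm.sign p.2 = -1)) ∨ j k = W p * S) := by
    have h1 : (t, (1 : Perm α)) ∈ doublePairs a b := by
      have := mul_mem (h _ (mem_alternatingGroup_mul_of_sign_eq_neg_one ht
        (Perm.sign_inv a ▸ ha)) _ (Perm.mem_alternatingGroup.2 (Perm.sign_inv b ▸ hb)))
        (mem_doublePairs a b)
      simpa only [Prod.mk_mul_mk, inv_mul_cancel_right, inv_mul_cancel] using this
    have h2 : ((1 : Perm α), t) ∈ doublePairs a b := swap_mem_doublePairs h1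
    have h3 : (t, t) ∈ doublePairs a b := by simpa using mul_mem h1 h2
    apply dihedral_four_cases
    · exact ⟨1, one_mem _, Or.inl ⟨by simp, Or.inl rfl⟩⟩
    · exact ⟨_, h1, Or.inr hr1⟩
    · exact ⟨_, h3, Or.inl ⟨hr2, Or.inr (Or.inl ht)⟩⟩
    · exact ⟨_, h2, Or.inr hr3⟩
    · exact ⟨_, one_mem _, Or.inr hs0⟩
    · exact ⟨_, h2, Or.inl ⟨hs1, Or.inr (Or.inr ht)⟩⟩
    · exact ⟨_, h3, Or.inr hs2⟩
    · exact ⟨_, h1, Or.inl ⟨hs3, Or.inr (Or.inl ht)⟩⟩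
  refine isSemidirect_of_embeddings (altSqHom α) j altSqHom_injective ?_ ?_ ?_ _ ?_
  · intro k n
    obtain ⟨p, -, ⟨hp, -⟩ | hp⟩ := hform k <;> rw [hp]
    · exact exists_altSqHom_sumCongrHom_conj p n
    · exact exists_altSqHom_mul_sumComm_conj p n
  · intro n k hk
    obtain ⟨p, -, ⟨hp, hp' | hp'⟩ | hp⟩ := hform k
    · exact hp'
    · rw [hp] at hk
      have := sumCongrHom_mem_altSqHom_range.1 ⟨n, hk⟩
      rw [Perm.mem_alternatingGroup, Perm.mem_alternatingGroup] at this
      rcases hp' with hp' | hp' <;> rw [hp'] at this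
      · exact absurd this.1 (by decide)
      · exact absurd this.2 (by decide)
    · rw [hp] at hk
      exact absurd (hk ▸ altSqHom_range_le ⟨n, rfl⟩) (sumCongrHom_mul_sumComm_notMem p)
  · obtain ⟨n, hn⟩ := sumComm_conj_altSqHom_ne hα
    refine ⟨.sr 0, n, ?_⟩
    rwa [hs0, map_one, one_mul]
  · apply le_antisymm
    · refine sup_le (altSqHom_range_le_doubleGroup h) ?_
      rintro _ ⟨k, rfl⟩
      obtain ⟨p, hpm, ⟨hp, -⟩ | hp⟩ := hform k <;> rw [hp]
      · exact hpm
      · exact mul_mem hpm (sumComm_mem_doubleGroup a b)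
    · refine doubleGroup_le ?_ (Subgroup.mem_sup_right ⟨.sr 0, by rw [hs0, map_one, one_mul]⟩)
      have e : W (a, b) = W (a * t, b) * W (t, 1) := by
        rw [← map_mul, Prod.mk_mul_mk, mul_assoc, htt, mul_one, mul_one]
      rw [← hW, e]
      exact mul_mem (Subgroup.mem_sup_left (sumCongrHom_mem_altSqHom_range.2
          ⟨mem_alternatingGroup_mul_of_sign_eq_neg_one ha ht, Perm.mem_alternatingGroup.2 hb⟩))
        (Subgroup.mem_sup_right ⟨.sr 3, hs3⟩)

end Double

/-- The monodromy group does not depend on the labelling of the edges. -/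
noncomputable def PlaneTree.monodromyGroupEquiv {n : ℕ} {β : Type*} (T : PlaneTree n)
  (e : Fin n ≃ β) :
    T.monodromyGroup ≃*
      Subgroup.closure ({e.permCongr T.σ₀, e.permCongr T.σ₁} : Set (Perm β)) :=
  (T.monodromyGroup.equivMapOfInjective e.permCongrHom.toMonoidHom e.permCongrHom.injective).trans
    (MulEquiv.subgroupCongr (by
      rw [PlaneTree.monodromyGroup, MonoidHom.map_closure, Set.image_pair]; rfl))

theorem PlaneTree.nonempty_mulEquiv_doubleGroup {n : ℕ} {α : Type*} (T : PlaneTree n)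
    (e : Fin n ≃ α ⊕ α) (a b : Perm α) (h₀ : e.permCongr T.σ₀ = Perm.sumCongrHom α α (a, b))
    (h₁ : e.permCongr T.σ₁ = Equiv.sumComm α α) :
    Nonempty (T.monodromyGroup ≃* doubleGroup a b) :=
  ⟨(T.monodromyGroupEquiv e).trans (MulEquiv.subgroupCongr (by rw [h₀, h₁]; rfl))⟩

/-! ### Words isolating a 3-cycle in one of the two copies -/

section

open List

theorem isSemidirect_double_five_sq :
    IsSemidirect (doubleGroup (formPerm [0, 3, 4] * formPerm [1, 2] : Perm (Fin 5))
      (formPerm [0, 2])) (AltSq 5) (Cyc 2 × Cyc 2) := by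
  refine isSemidirect_double_odd_odd (t := swap 0 1) (by simp)
    (by decide +kernel) (by decide +kernel)
    (by decide +kernel) (by decide +kernel)
    fun x hx y hy => altSq_le_doublePairs (by decide +kernel) 0 1 rfl ?_ hx hy
  set a : Perm (Fin 5) := formPerm [0, 3, 4] * formPerm [1, 2]
  set b : Perm (Fin 5) := formPerm [0, 2]
  have hw : ∀ X ∈ doublePairs a b, ∀ Y ∈ doublePairs a b,
      ((X * Y) ^ 2 * (X ^ 2)⁻¹ * ((X * Y) ^ 2)⁻¹) ∈ doublePairs a b := by
    intro X hX Y hY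
    apply_rules [mul_mem, pow_mem, inv_mem]
  -- Since `b` is a transposition and `a` has type 3, 2, the square of `(a, b)` is a 3-cycle paired
  -- with 1. Conjugation by the square of the rotation brings its inverse onto the letters 0, 1, 2.
  have : (swap (0 : Fin 4).castSucc (0 : Fin 4).succ *
      swap (1 : Fin 4).castSucc (1 : Fin 4).succ, 1) =
      (((a, b) * (b, a)) ^ 2 * ((a, b) ^ 2)⁻¹ * (((a, b) * (b, a)) ^ 2)⁻¹) := by decide +kernel
  rw [this]
  exact hw _ (mem_doublePairs a b) _ (mem_doublePairs' a b)

theorem isSemidirect_double_five :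
    IsSemidirect (doubleGroup (formPerm [0, 2, 4] : Perm (Fin 5))
      (formPerm [0, 1] * formPerm [2, 3])) (AltSq 5) (Cyc 2) := by
  refine isSemidirect_double_even (by simp) (Perm.mem_alternatingGroup.2 (by decide +kernel))
    (Perm.mem_alternatingGroup.2 (by decide +kernel))
    fun x hx y hy => altSq_le_doublePairs (by decide +kernel) 1 2 rfl ?_ hx hy
  set a : Perm (Fin 5) := formPerm [0, 2, 4]
  set b : Perm (Fin 5) := formPerm [0, 1] * formPerm [2, 3]
  have hw : ∀ X ∈ doublePairs a b, ∀ Y ∈ doublePairs a b,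
      (X⁻¹ * Y * X * Y⁻¹ * X) ^ 2 ∈ doublePairs a b := by
    intro X hX Y hY
    apply_rules [mul_mem, pow_mem, inv_mem]
  -- In the second coordinate the word being squared is a conjugate of the involution `b`, so
  -- squaring kills it; in the first coordinate a 3-cycle survives.
  have : (swap (1 : Fin 4).castSucc (1 : Fin 4).succ *
      swap (2 : Fin 4).castSucc (2 : Fin 4).succ, 1) =
      ((a, b)⁻¹ * (b, a) * (a, b) * (b, a)⁻¹ * (a, b)) ^ 2 := by decide +kernel
  rw [this]
  exact hw _ (mem_doublePairs a b) _ (mem_doublePairs' a b)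

theorem isSemidirect_double_ten :
    IsSemidirect (doubleGroup (formPerm [0, 4, 8, 9] : Perm (Fin 10))
      (formPerm [0, 1, 2, 3] * formPerm [4, 5, 6, 7])) (AltSq 10) (DihedralGroup 4) := by
  refine isSemidirect_double_odd_even (t := swap 0 1) (by simp)
    (by decide +kernel) (by decide +kernel)
    (by decide +kernel) (by decide +kernel)
    fun x hx y hy => altSq_le_doublePairs (by decide +kernel) 6 7 rfl ?_ hx hy
  set a : Perm (Fin 10) := formPerm [0, 4, 8, 9]
  set b : Perm (Fin 10) := formPerm [0, 1, 2, 3] * formPerm [4, 5, 6, 7]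
  have hw : ∀ X ∈ doublePairs a b, ∀ Y ∈ doublePairs a b,
      ((X * Y * Y * X⁻¹ * Y⁻¹ * X⁻¹ * Y * X * Y⁻¹) ^ 8)⁻¹ ∈ doublePairs a b := by
    intro X hX Y hY
    apply_rules [mul_mem, pow_mem, inv_mem]
  -- The word has order dividing 8 in the second coordinate and divisible by 3 in the first, so its
  -- eighth power isolates a 3-cycle. The exponents 5 and 2 for thirteen letters serve the same
  -- purpose.
  have : (swap (6 : Fin 9).castSucc (6 : Fin 9).succ *
      swap (7 : Fin 9).castSucc (7 : Fin 9).succ, 1) =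
      (((a, b) * (b, a) * (b, a) * (a, b)⁻¹ * (b, a)⁻¹ * (a, b)⁻¹ * (b, a) * (a, b) * (b, a)⁻¹) ^ 8)⁻¹ := by decide +kernel
  rw [this]
  exact hw _ (mem_doublePairs a b) _ (mem_doublePairs' a b)

theorem isSemidirect_double_thirteen :
    IsSemidirect (doubleGroup (formPerm [0, 5, 10, 11, 12] : Perm (Fin 13))
      (formPerm [0, 1, 2, 3, 4] * formPerm [5, 6, 7, 8, 9])) (AltSq 13) (Cyc 2) := by
  refine isSemidirect_double_even (by simp) (Perm.mem_alternatingGroup.2 (by decide +kernel))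
    (Perm.mem_alternatingGroup.2 (by decide +kernel))
    fun x hx y hy => altSq_le_doublePairs (by decide +kernel) 8 9 rfl ?_ hx hy
  set a : Perm (Fin 13) := formPerm [0, 5, 10, 11, 12]
  set b : Perm (Fin 13) := formPerm [0, 1, 2, 3, 4] * formPerm [5, 6, 7, 8, 9]
  have hw : ∀ X ∈ doublePairs a b, ∀ Y ∈ doublePairs a b,
      ((X * Y * X⁻¹ * Y * X * Y * X⁻¹ * Y⁻¹ * Y⁻¹) ^ 5)⁻¹ ∈ doublePairs a b := by
    intro X hX Y hY
    apply_rules [mul_mem, pow_mem, inv_mem]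
  have : (swap (8 : Fin 12).castSucc (8 : Fin 12).succ *
      swap (9 : Fin 12).castSucc (9 : Fin 12).succ, 1) =
      (((a, b) * (b, a) * (a, b)⁻¹ * (b, a) * (a, b) * (b, a) * (a, b)⁻¹ * (b, a)⁻¹ * (b, a)⁻¹) ^ 5)⁻¹ := by decide +kernel
  rw [this]
  exact hw _ (mem_doublePairs a b) _ (mem_doublePairs' a b)

theorem isSemidirect_double_thirteen' :
    IsSemidirect (doubleGroup (formPerm [0, 5, 6, 11, 12] : Perm (Fin 13))
      (formPerm [0, 1, 2, 3, 4] * formPerm [6, 7, 8, 9, 10])) (AltSq 13) (Cyc 2) := by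
  refine isSemidirect_double_even (by simp) (Perm.mem_alternatingGroup.2 (by decide +kernel))
    (Perm.mem_alternatingGroup.2 (by decide +kernel))
    fun x hx y hy => altSq_le_doublePairs (by decide +kernel) 5 6 rfl ?_ hx hy
  set a : Perm (Fin 13) := formPerm [0, 5, 6, 11, 12]
  set b : Perm (Fin 13) := formPerm [0, 1, 2, 3, 4] * formPerm [6, 7, 8, 9, 10]
  have hw : ∀ X ∈ doublePairs a b, ∀ Y ∈ doublePairs a b,
      ((X * Y * X * Y⁻¹ * X⁻¹ * Y * X⁻¹ * Y⁻¹) ^ 2)⁻¹ ∈ doublePairs a b := by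
    intro X hX Y hY
    apply_rules [mul_mem, pow_mem, inv_mem]
  have : (swap (5 : Fin 12).castSucc (5 : Fin 12).succ *
      swap (6 : Fin 12).castSucc (6 : Fin 12).succ, 1) =
      (((a, b) * (b, a) * (a, b) * (b, a)⁻¹ * (a, b)⁻¹ * (b, a) * (a, b)⁻¹ * (b, a)⁻¹) ^ 2)⁻¹ :=
        by decide +kernel
  rw [this]
  exact hw _ (mem_doublePairs a b) _ (mem_doublePairs' a b)

end

/-! ### The tree with twenty edges and a half turn -/

/-- Five pairs of letters. -/
abbrev FivePairs : Type := Fin 5 × ZMod 2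

namespace FivePairs

/-- Permuting the pairs. -/
def pairHom : Perm (Fin 5) →* Perm FivePairs where
  toFun π := Equiv.prodCongr π (Equiv.refl _)
  map_one' := rfl
  map_mul' _ _ := rfl

/-- Exchanging the letters inside the pairs selected by a vector. -/
def flipHom : Multiplicative (Fin 5 → ZMod 2) →* Perm FivePairs where
  toFun u :=
    { toFun := fun x => (x.1, x.2 + u.toAdd x.1)
      invFun := fun x => (x.1, x.2 - u.toAdd x.1)
      left_inv := fun x => by simp
      right_inv := fun x => by simp }
  map_one' := by ext x <;> simp
  map_mul' u v := by
    refine Equiv.ext fun x => Prod.ext rfl ?_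
    change x.2 + (u.toAdd x.1 + v.toAdd x.1) = x.2 + v.toAdd x.1 + u.toAdd x.1
    ring

/-- The vectors of even weight, in coordinates. -/
def evenHom : (Fin 4 → Cyc 2) →* Multiplicative (Fin 5 → ZMod 2) where
  toFun v := Multiplicative.ofAdd ![(v 0).toAdd, (v 0).toAdd + (v 1).toAdd,
    (v 1).toAdd + (v 2).toAdd, (v 2).toAdd + (v 3).toAdd, (v 3).toAdd]
  map_one' := by decide
  map_mul' u v := by
    apply Multiplicative.toAdd.injective
    funext i
    fin_cases i <;> simp [add_add_add_comm]

theorem evenHom_injective : Function.Injective evenHom := by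
  rw [injective_iff_map_eq_one]; decide

theorem mem_evenHom_range (u : Multiplicative (Fin 5 → ZMod 2)) :
    u ∈ evenHom.range ↔ ∑ i, u.toAdd i = 0 := by
  constructor
  · rintro ⟨v, rfl⟩
    revert v; decide
  · intro h
    -- Partial sums invert `evenHom`; the fifth entry comes out right because the total is zero.
    refine ⟨![.ofAdd (u.toAdd 0), .ofAdd (u.toAdd 0 + u.toAdd 1),
      .ofAdd (u.toAdd 0 + u.toAdd 1 + u.toAdd 2),
      .ofAdd (u.toAdd 0 + u.toAdd 1 + u.toAdd 2 + u.toAdd 3)], ?_⟩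
    revert h u
    decide +kernel

theorem pairHom_mul_flipHom (π : Perm (Fin 5)) (u : Multiplicative (Fin 5 → ZMod 2)) :
    pairHom π * flipHom u * (pairHom π)⁻¹ =
      flipHom (Multiplicative.ofAdd (u.toAdd ∘ (π⁻¹ : Perm (Fin 5)))) := by
  refine Equiv.ext fun x => Prod.ext ?_ rfl
  exact π.apply_symm_apply x.1

/-- Normal form in the wreath product: the action on pairs determines the permutation, and what
remains determines the flips. -/
theorem flipHom_mul_pairHom_inj {u v : Multiplicative (Fin 5 → ZMod 2)} {π ρ : Perm (Fin 5)}
    (h : flipHom u * pairHom π = flipHom v * pairHom ρ) : u = v ∧ π = ρ := by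
  have h1 : ∀ i, π i = ρ i := fun i => congrArg (fun f : Perm FivePairs => (f (i, 0)).1) h
  refine ⟨Multiplicative.toAdd.injective (funext fun i => ?_), Equiv.ext h1⟩
  have h2 : (0 : ZMod 2) + u.toAdd (π (π⁻¹ i)) = 0 + v.toAdd (ρ (π⁻¹ i)) :=
    congrArg (fun f : Perm FivePairs => (f (π⁻¹ i, 0)).2) h
  rw [← h1] at h2
  simpa using h2

theorem flipHom_injective : Function.Injective flipHom := fun u v h =>
  (flipHom_mul_pairHom_inj (π := 1) (ρ := 1) (by rw [h])).1

theorem pairHom_injective : Function.Injective pairHom := fun u v h =>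
  (flipHom_mul_pairHom_inj (u := 1) (v := 1) (by rw [h])).2

/-- Even flips of two copies of the five pairs. -/
def flipsHom : (Fin 8 → Cyc 2) →* Perm (FivePairs ⊕ FivePairs) :=
  (Perm.sumCongrHom FivePairs FivePairs).comp
    { toFun := fun v => (flipHom (evenHom fun k => v (Fin.castAdd 4 k)),
        flipHom (evenHom fun k => v (Fin.natAdd 4 k)))
      map_one' := Prod.ext (map_one (flipHom.comp evenHom)) (map_one (flipHom.comp evenHom))
      map_mul' := fun _ _ => Prod.ext (map_mul (flipHom.comp evenHom) _ _)
        (map_mul (flipHom.comp evenHom) _ _) }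

theorem flipsHom_injective : Function.Injective flipsHom := by
  refine Perm.sumCongrHom_injective.comp fun u v h => ?_
  obtain ⟨h1, h2⟩ := Prod.ext_iff.1 h
  have h1 := evenHom_injective (flipHom_injective h1)
  have h2 := evenHom_injective (flipHom_injective h2)
  funext k
  refine Fin.addCases (m := 4) (n := 4) (fun i => congrFun h1 i) (fun i => congrFun h2 i) k

theorem sumCongrHom_mem_flipsHom_range {p : Perm FivePairs × Perm FivePairs} :
    Perm.sumCongrHom _ _ p ∈ flipsHom.range ↔
      p.1 ∈ (flipHom.comp evenHom).range ∧ p.2 ∈ (flipHom.comp evenHom).range := by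
  constructor
  · rintro ⟨v, hv⟩
    rw [← Perm.sumCongrHom_injective hv]
    exact ⟨⟨_, rfl⟩, ⟨_, rfl⟩⟩
  · rintro ⟨⟨u, hu⟩, ⟨v, hv⟩⟩
    refine ⟨Fin.append u v, congrArg (Perm.sumCongrHom FivePairs FivePairs) (a₂ := p)
      (Prod.ext ?_ ?_)⟩
    · rw [← hu]
      exact congrArg (flipHom.comp evenHom) (funext fun k => Fin.append_left u v k)
    · rw [← hv]
      exact congrArg (flipHom.comp evenHom) (funext fun k => Fin.append_right u v k)

theorem flipsHom_range_le : flipsHom.range ≤ (Perm.sumCongrHom FivePairs FivePairs).range := by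
  rintro _ ⟨v, rfl⟩
  exact ⟨_, rfl⟩

theorem pairHom_conj_mem {π : Perm (Fin 5)} {x : Perm FivePairs}
    (hx : x ∈ (flipHom.comp evenHom).range) :
    pairHom π * x * (pairHom π)⁻¹ ∈ (flipHom.comp evenHom).range := by
  obtain ⟨v, rfl⟩ := hx
  rw [MonoidHom.comp_apply, pairHom_mul_flipHom]
  obtain ⟨w, hw⟩ : Multiplicative.ofAdd ((evenHom v).toAdd ∘ (π⁻¹ : Perm (Fin 5))) ∈
      evenHom.range := by
    rw [mem_evenHom_range, toAdd_ofAdd, ← (mem_evenHom_range _).1 ⟨v, rfl⟩]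
    exact Equiv.sum_comp π⁻¹ (evenHom v).toAdd
  exact ⟨w, congrArg flipHom hw⟩

theorem flipHom_conj_mem {u : Multiplicative (Fin 5 → ZMod 2)} {x : Perm FivePairs}
    (hx : x ∈ (flipHom.comp evenHom).range) :
    flipHom u * x * (flipHom u)⁻¹ ∈ (flipHom.comp evenHom).range := by
  obtain ⟨v, rfl⟩ := hx
  rw [MonoidHom.comp_apply, ← map_inv, ← map_mul, ← map_mul, mul_comm u, mul_inv_cancel_right]
  exact ⟨v, rfl⟩

theorem sumCongrHom_conj_mem (u v : Multiplicative (Fin 5 → ZMod 2)) (π ρ : Perm (Fin 5)) (n) :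
    ∃ m, flipsHom m = Perm.sumCongrHom _ _ (flipHom u * pairHom π, flipHom v * pairHom ρ) *
      flipsHom n * (Perm.sumCongrHom _ _ (flipHom u * pairHom π, flipHom v * pairHom ρ))⁻¹ := by
  obtain ⟨p, hp⟩ := flipsHom_range_le ⟨n, rfl⟩
  have hp' := sumCongrHom_mem_flipsHom_range.1 ⟨n, hp.symm⟩
  rw [← hp, ← map_inv, ← map_mul, ← map_mul]
  refine sumCongrHom_mem_flipsHom_range.2 ⟨?_, ?_⟩
  · have := flipHom_conj_mem (u := u) (pairHom_conj_mem (π := π) hp'.1)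
    simpa only [Prod.fst_mul, Prod.fst_inv, mul_inv_rev, mul_assoc] using this
  · have := flipHom_conj_mem (u := v) (pairHom_conj_mem (π := ρ) hp'.2)
    simpa only [Prod.snd_mul, Prod.snd_inv, mul_inv_rev, mul_assoc] using this

theorem sumComm_conj_mem (n) :
    ∃ m, flipsHom m = (Equiv.sumComm FivePairs FivePairs : Perm _) * flipsHom n *
      (Equiv.sumComm FivePairs FivePairs : Perm _)⁻¹ := by
  obtain ⟨p, hp⟩ := flipsHom_range_le ⟨n, rfl⟩
  have hp' := sumCongrHom_mem_flipsHom_range.1 ⟨n, hp.symm⟩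
  rw [← hp, sumComm_conj_sumCongrHom]
  exact sumCongrHom_mem_flipsHom_range.2 hp'.symm

/-- `A₅ × A₅` permuting the pairs in the two copies. -/
def altHom : AltSq 5 →* Perm (FivePairs ⊕ FivePairs) :=
  (Perm.sumCongrHom FivePairs FivePairs).comp
    (MonoidHom.prodMap (pairHom.comp (alternatingGroup (Fin 5)).subtype)
      (pairHom.comp (alternatingGroup (Fin 5)).subtype))

theorem altHom_apply (x : AltSq 5) :
    altHom x = Perm.sumCongrHom _ _ (pairHom x.1, pairHom x.2) := rfl

theorem altHom_injective : Function.Injective altHom :=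
  Perm.sumCongrHom_injective.comp (Function.Injective.prodMap
    (pairHom_injective.comp Subtype.val_injective) (pairHom_injective.comp Subtype.val_injective))

/-- The constant vector is invariant under permuting coordinates. Its weight is five, so it
represents the odd flips by an element that commutes with all permutations of the pairs. -/
theorem flipHom_commute_pairHom (π : Perm (Fin 5)) :
    Commute (flipHom (Multiplicative.ofAdd 1)) (pairHom π) :=
  Equiv.ext fun _ => rfl

/-- The tree of degree twenty whose monodromy group is not close to `A₁₀ × A₁₀`. -/
def blackPerm : Perm FivePairs :=
  flipHom (Multiplicative.ofAdd (Pi.single 0 1)) * pairHom (swap 0 4)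

/-- On letters this is two 4-cycles, the two outer black vertices, which the half turn interchanges.
-/
def whitePerm : Perm FivePairs := pairHom (List.formPerm [0, 1, 2, 3])

theorem flipHom_evenHom_mem (v : Fin 4 → Cyc 2) :
    (flipHom (evenHom v), 1) ∈ doublePairs blackPerm whitePerm := by
  have hw : ∀ X ∈ doublePairs blackPerm whitePerm, ∀ Y ∈ doublePairs blackPerm whitePerm, ∀ k : ℕ,
      (X * Y) ^ k * (X * X * Y * X * X * Y⁻¹) ^ 3 * ((X * Y) ^ k)⁻¹ ∈
        doublePairs blackPerm whitePerm := by
    intro X hX Y hY k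
    apply_rules [mul_mem, pow_mem, inv_mem]
  have hk : ∀ k : Fin 4, (flipHom (evenHom (Pi.mulSingle k (Multiplicative.ofAdd 1))), 1) ∈
      doublePairs blackPerm whitePerm := by
    intro k
    -- The square of `blackPerm` flips pairs 0 and 4, so the first coordinate of the cubed word is
    -- the flip of pairs 0 and 1. The second is a product of two double transpositions of pairs, of
    -- order three, which the cube kills. Conjugation by the rotation runs through the basis of even
    -- flips.
    have e : ∀ k : Fin 4, (flipHom (evenHom (Pi.mulSingle k (Multiplicative.ofAdd 1))), 1) =
      ((blackPerm, whitePerm) * (whitePerm, blackPerm)) ^ (k : ℕ) *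
        ((blackPerm, whitePerm) * (blackPerm, whitePerm) * (whitePerm, blackPerm) *
          (blackPerm, whitePerm) * (blackPerm, whitePerm) * (whitePerm, blackPerm)⁻¹) ^ 3 *
        (((blackPerm, whitePerm) * (whitePerm, blackPerm)) ^ (k : ℕ))⁻¹ := by
      decide +kernel
    rw [e]
    exact hw _ (mem_doublePairs _ _) _ (mem_doublePairs' _ _) _
  have := Subgroup.pi_mem_of_mulSingle_mem (H := (doublePairs blackPerm whitePerm).comap
    ((MonoidHom.inl (Perm FivePairs) (Perm FivePairs)).comp (flipHom.comp evenHom))) v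
  refine this fun k => ?_
  rcases cyc_two_cases (v k) with h | h <;> rw [h]
  · rw [Pi.mulSingle_one]; exact one_mem _
  · exact hk k

theorem pairHom_mem {π : Perm (Fin 5)} (hπ : π ∈ alternatingGroup (Fin 5)) :
    (pairHom π, 1) ∈ doublePairs blackPerm whitePerm := by
  have hw : ∀ X ∈ doublePairs blackPerm whitePerm, ∀ Y ∈ doublePairs blackPerm whitePerm, ∀ k : ℕ,
      (X * Y) ^ k * (X * Y * X * Y⁻¹) ^ 5 * ((X * Y) ^ k)⁻¹ ∈
        doublePairs blackPerm whitePerm := by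
    intro X hX Y hY k
    apply_rules [mul_mem, pow_mem, inv_mem]
  have key : alternatingGroup (Fin 5) ≤ (doublePairs blackPerm whitePerm).comap
      ((MonoidHom.inl (Perm FivePairs) (Perm FivePairs)).comp pairHom) := by
    refine alternatingGroup_le_of_swap_mul_swap (n := 3) _ fun i j hij => ?_
    -- The word is a 5-cycle of pairs in the second coordinate, killed by the fifth power, and a
    -- 3-cycle of pairs up to flips in the first. The even flips, already available, absorb the
    -- discrepancy `v`.
    have e : ∀ i j : Fin 4, (i : ℕ) + 1 = j → ∃ v,
        (pairHom (swap i.castSucc i.succ * swap j.castSucc j.succ), 1) =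
        (flipHom (evenHom v), 1) *
        (((blackPerm, whitePerm) * (whitePerm, blackPerm)) ^ (i + 1 : ℕ) *
        ((blackPerm, whitePerm) * (whitePerm, blackPerm) * (blackPerm, whitePerm) *
          (whitePerm, blackPerm)⁻¹) ^ 5 *
        (((blackPerm, whitePerm) * (whitePerm, blackPerm)) ^ (i + 1 : ℕ))⁻¹) := by
      decide +kernel
    obtain ⟨v, hv⟩ := e i j hij
    change (pairHom _, 1) ∈ doublePairs blackPerm whitePerm
    rw [hv]
    exact mul_mem (flipHom_evenHom_mem v)
      (hw _ (mem_doublePairs _ _) _ (mem_doublePairs' _ _) _)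
  exact key hπ

end FivePairs

namespace FivePairs

theorem altHom_range_le : altHom.range ≤ doubleGroup blackPerm whitePerm := by
  rintro _ ⟨x, rfl⟩
  have := mul_mem (pairHom_mem x.1.2) (swap_mem_doublePairs (pairHom_mem x.2.2))
  rw [Prod.swap_prod_mk, Prod.mk_mul_mk, mul_one, one_mul] at this
  exact this

theorem flipsHom_range_le_doubleGroup : flipsHom.range ≤ doubleGroup blackPerm whitePerm := by
  rintro _ ⟨x, rfl⟩
  have := mul_mem (flipHom_evenHom_mem fun k => x (Fin.castAdd 4 k))
    (swap_mem_doublePairs (flipHom_evenHom_mem fun k => x (Fin.natAdd 4 k)))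
  rw [Prod.swap_prod_mk, Prod.mk_mul_mk, mul_one, one_mul] at this
  exact this

/-- The dihedral group of order 8, generated by the exchange of the two copies and by a pair of
involutions. -/
theorem exists_dihedral_hom : ∃ j : DihedralGroup 4 →* Perm (FivePairs ⊕ FivePairs),
    j (.sr 0) = Equiv.sumComm _ _ ∧
    j (.sr 3) = Perm.sumCongrHom _ _
      (flipHom (Multiplicative.ofAdd 1) * pairHom (swap 0 1), pairHom (swap 0 1)) ∧
    ∀ d, ∃ u v π ρ, (flipHom u * pairHom π, flipHom v * pairHom ρ) ∈
        doublePairs blackPerm whitePerm ∧ (∀ x, Commute (pairHom x) (flipHom u)) ∧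
      (∀ x, Commute (pairHom x) (flipHom v)) ∧
      ((j d = Perm.sumCongrHom _ _ (flipHom u * pairHom π, flipHom v * pairHom ρ) ∧
          (d = 1 ∨ Perm.sign π = -1 ∨ u ∉ evenHom.range)) ∨
        j d = Perm.sumCongrHom _ _ (flipHom u * pairHom π, flipHom v * pairHom ρ) *
          Equiv.sumComm _ _) := by
  -- Modulo even flips and even permutations of pairs, the black rotation is `(z * t, t)`: both
  -- components permute the pairs oddly, but only the first has an odd flip. As `z` and `t` commute,
  -- the dihedral construction applies.
  obtain ⟨j, hr1, hr2, hr3, hs0, hs1, hs2, hs3⟩ := exists_dihedral_hom_double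
    (flipHom (Multiplicative.ofAdd 1) * pairHom (swap 0 1)) (flipHom 1 * pairHom (swap 0 1))
    (by decide +kernel) (by decide +kernel) (by decide +kernel)
  set t : Perm (Fin 5) := swap 0 1 with ht
  set z : Multiplicative (Fin 5 → ZMod 2) := Multiplicative.ofAdd 1 with hz
  have hst : Perm.sign t = -1 := by decide +kernel
  have hzodd : z ∉ evenHom.range := by rw [mem_evenHom_range]; decide +kernel
  have hzc : ∀ x, Commute (pairHom x) (flipHom z) := fun x => (flipHom_commute_pairHom x).symm
  have h1c : ∀ x, Commute (pairHom x) (flipHom 1) := fun x => by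
    rw [map_one]; exact Commute.one_right _
  have h1 : (flipHom z * pairHom t, flipHom 1 * pairHom t) ∈ doublePairs blackPerm whitePerm := by
    have e : ∃ v : Fin 4 → Cyc 2, (flipHom z * pairHom t, flipHom 1 * pairHom t) =
        (flipHom (evenHom v), 1) * (pairHom (t * swap 0 4), 1) *
        (1, pairHom (t * (List.formPerm [0, 1, 2, 3])⁻¹)) * (blackPerm, whitePerm) := by
      decide +kernel
    obtain ⟨v, hv⟩ := e
    rw [hv]
    exact mul_mem (mul_mem (mul_mem (flipHom_evenHom_mem v)
      (pairHom_mem (Perm.mem_alternatingGroup.2 (by decide +kernel))))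
      (swap_mem_doublePairs (pairHom_mem (Perm.mem_alternatingGroup.2 (by decide +kernel)))))
      (mem_doublePairs _ _)
  have h2 := swap_mem_doublePairs h1
  rw [Prod.swap_prod_mk] at h2
  have h3 : (flipHom z * pairHom 1, flipHom z * pairHom 1) ∈ doublePairs blackPerm whitePerm := by
    have e : (flipHom z * pairHom 1, flipHom z * pairHom 1) =
        (flipHom z * pairHom t, flipHom 1 * pairHom t) *
        (flipHom 1 * pairHom t, flipHom z * pairHom t) := by decide +kernel
    rw [e]
    exact mul_mem h1 h2
  have hpq : flipHom z * pairHom t * (flipHom 1 * pairHom t) = flipHom z * pairHom 1 :=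
    by decide +kernel
  rw [hpq] at hr2 hs2
  refine ⟨j, by rw [hs0, map_one, one_mul], by rw [hs3, map_one flipHom, one_mul], ?_⟩
  apply dihedral_four_cases
  · refine ⟨1, 1, 1, 1, ?_, h1c, h1c, Or.inl ⟨?_, Or.inl rfl⟩⟩
    · simp only [map_one, mul_one]; exact one_mem _
    · simp only [map_one, mul_one]; exact (map_one _).symm
  · exact ⟨_, _, _, _, h1, hzc, h1c, Or.inr hr1⟩
  · exact ⟨_, _, _, _, h3, hzc, hzc, Or.inl ⟨hr2, Or.inr (Or.inr hzodd)⟩⟩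
  · exact ⟨_, _, _, _, h2, h1c, hzc, Or.inr hr3⟩
  · refine ⟨1, 1, 1, 1, ?_, h1c, h1c, Or.inr ?_⟩
    · simp only [map_one, mul_one]; exact one_mem _
    · simp only [map_one, mul_one]; exact hs0
  · exact ⟨_, _, _, _, h2, h1c, hzc, Or.inl ⟨hs1, Or.inr (Or.inl hst)⟩⟩
  · exact ⟨_, _, _, _, h3, hzc, hzc, Or.inr hs2⟩
  · exact ⟨_, _, _, _, h1, hzc, h1c, Or.inl ⟨hs3, Or.inr (Or.inl hst)⟩⟩

theorem flipHom_mul_pairHom_conj {u : Multiplicative (Fin 5 → ZMod 2)} {π x : Perm (Fin 5)}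
    (hu : ∀ x, Commute (pairHom x) (flipHom u)) :
    flipHom u * pairHom π * pairHom x * (flipHom u * pairHom π)⁻¹ = pairHom (π * x * π⁻¹) := by
  have := (hu (π * x * π⁻¹)).eq
  rw [map_mul, map_mul, map_inv] at this ⊢
  rw [← mul_inv_eq_iff_eq_mul.2 this.symm]
  simp only [mul_assoc, mul_inv_rev]

/-- Two nested internal semidirect products: the dihedral group acts on `A₅ × A₅`, and the group so
obtained acts on the even flips. The normal form `flipHom u * pairHom π` detects trivial
intersections: an element is excluded by the parity of `u`, by the sign of `π`, or by exchanging the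
copies. -/
theorem isSemidirect_doubleGroup : ∃ ψ : DihedralGroup 4 →* MulAut (AltSq 5), ψ ≠ 1 ∧
    IsSemidirect (doubleGroup blackPerm whitePerm) (Fin 8 → Cyc 2)
      (AltSq 5 ⋊[ψ] DihedralGroup 4) := by
  obtain ⟨j, hs0, hs3, hj⟩ := exists_dihedral_hom
  have hsumComm : ∀ p : Perm FivePairs × Perm FivePairs, ∀ q,
      Perm.sumCongrHom _ _ p ≠ Perm.sumCongrHom _ _ q * (Equiv.sumComm _ _ : Perm _) :=
    fun p q h => sumCongrHom_mul_sumComm_notMem q ⟨p, h⟩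
  obtain ⟨ψ, hψ, L, hL, hr, hLx⟩ := exists_semidirectProduct_embedding altHom j altHom_injective
    (by
      intro d n
      obtain ⟨u, v, π, ρ, -, hu, hv, ⟨h, -⟩ | h⟩ := hj d <;> rw [h]
      · refine ⟨(MulAut.conjNormal π n.1, MulAut.conjNormal ρ n.2), ?_⟩
        rw [altHom_apply, altHom_apply, ← map_inv, ← map_mul, ← map_mul]
        exact congrArg _ (Prod.ext (flipHom_mul_pairHom_conj hu).symm
          (flipHom_mul_pairHom_conj hv).symm)
      · refine ⟨(MulAut.conjNormal π n.2, MulAut.conjNormal ρ n.1), ?_⟩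
        have := sumComm_conj_sumCongrHom (pairHom n.1, pairHom n.2)
        rw [mul_inv_rev, ← mul_assoc, mul_assoc _ _ (altHom n), mul_assoc _ (_ * _) _, altHom_apply,
          altHom_apply, this, ← map_inv, ← map_mul, ← map_mul]
        exact congrArg _ (Prod.ext (flipHom_mul_pairHom_conj hu).symm
          (flipHom_mul_pairHom_conj hv).symm))
    (by
      intro n d hd
      obtain ⟨u, v, π, ρ, -, -, -, ⟨h, h' | h' | h'⟩ | h⟩ := hj d
      · exact h'
      all_goals rw [h, altHom_apply] at hd
      all_goals have hfst : flipHom 1 * pairHom (n.1 : Perm (Fin 5)) = pairHom n.1 := by simp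
      · have := (flipHom_mul_pairHom_inj (u := 1)
          (hfst.trans (Prod.ext_iff.1 (Perm.sumCongrHom_injective hd)).1)).2
        rw [← this, Perm.mem_alternatingGroup.1 n.1.2] at h'
        exact absurd h' (by decide)
      · have := (flipHom_mul_pairHom_inj (u := 1)
          (hfst.trans (Prod.ext_iff.1 (Perm.sumCongrHom_injective hd)).1)).1
        exact absurd (this ▸ one_mem _) h'
      · exact absurd hd (hsumComm _ _))
    (by
      have : ∃ x : alternatingGroup (Fin 5), x ≠ 1 := exists_ne 1
      obtain ⟨x, hx⟩ := this
      refine ⟨.sr 0, (x, 1), fun h => hx ?_⟩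
      rw [hs0, altHom_apply, sumComm_conj_sumCongrHom] at h
      have := (Prod.ext_iff.1 (Perm.sumCongrHom_injective h)).1
      exact Subtype.ext (pairHom_injective (this.symm.trans (by simp))))
  refine ⟨ψ, hψ, isSemidirect_of_embeddings flipsHom L flipsHom_injective ?_ ?_ ?_ _ ?_⟩
  · intro k n
    rw [hLx]
    have hA : ∀ m, ∃ m', flipsHom m' = altHom k.left * flipsHom m * (altHom k.left)⁻¹ := by
      simpa [altHom_apply] using sumCongrHom_conj_mem 1 1 k.left.1 k.left.2
    have hD : ∃ m, flipsHom m = j k.right * flipsHom n * (j k.right)⁻¹ := by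
      obtain ⟨u, v, π, ρ, -, -, -, ⟨h, -⟩ | h⟩ := hj k.right <;> rw [h]
      · exact sumCongrHom_conj_mem u v π ρ n
      · obtain ⟨m, hm⟩ := sumComm_conj_mem n
        obtain ⟨m', hm'⟩ := sumCongrHom_conj_mem u v π ρ m
        exact ⟨m', by rw [hm', hm, mul_inv_rev]; simp only [mul_assoc]⟩
    obtain ⟨m, hm⟩ := hD
    obtain ⟨m', hm'⟩ := hA m
    exact ⟨m', by rw [hm', hm, mul_inv_rev]; simp only [mul_assoc]⟩
  · intro n k hk
    rw [hLx] at hk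
    obtain ⟨p, hp⟩ := flipsHom_range_le ⟨n, rfl⟩
    have hp' := sumCongrHom_mem_flipsHom_range.1 ⟨n, hp.symm⟩
    rw [← hp] at hk
    obtain ⟨u, v, π, ρ, -, hu, -, ⟨h, h'⟩ | h⟩ := hj k.right <;> rw [h, altHom_apply] at hk
    · rw [← map_mul] at hk
      obtain ⟨hk1, hk2⟩ := Prod.ext_iff.1 (Perm.sumCongrHom_injective hk)
      obtain ⟨w, hw⟩ := hp'.1
      -- The flip `u` commutes with permutations of pairs, so it can be moved to the left to reach
      -- the normal form.
      have e : flipHom u * pairHom (k.left.1 * π) = flipHom (evenHom w) * pairHom 1 := by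
        rw [map_one, mul_one, map_mul, ← mul_assoc, ← (hu k.left.1).eq, mul_assoc]
        exact hk1.symm.trans hw.symm
      obtain ⟨e1, e2⟩ := flipHom_mul_pairHom_inj e
      have hd : k.right = 1 := by
        rcases h' with h' | h' | h'
        · exact h'
        · have := congrArg Perm.sign e2
          rw [map_mul, Perm.mem_alternatingGroup.1 k.left.1.2, h'] at this
          exact absurd this (by decide)
        · exact absurd ⟨w, e1.symm⟩ h'
      have hl : k.left = 1 := by
        rw [hd, map_one] at h
        have h0 : Perm.sumCongrHom FivePairs FivePairs p = altHom k.left := by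
          rw [hk, map_mul, ← h, mul_one]; rfl
        obtain ⟨h1, h2⟩ := Prod.ext_iff.1 (Perm.sumCongrHom_injective h0)
        obtain ⟨w', hw'⟩ := hp'.2
        have f1 : flipHom 1 * pairHom k.left.1 = flipHom (evenHom w) * pairHom 1 := by
          rw [map_one, map_one, one_mul, mul_one]; exact h1.symm.trans hw.symm
        have f2 : flipHom 1 * pairHom k.left.2 = flipHom (evenHom w') * pairHom 1 := by
          rw [map_one, map_one, one_mul, mul_one]; exact h2.symm.trans hw'.symm
        exact Prod.ext (Subtype.ext (flipHom_mul_pairHom_inj f1).2)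
          (Subtype.ext (flipHom_mul_pairHom_inj f2).2)
      exact SemidirectProduct.ext hl hd
    · rw [← mul_assoc, ← map_mul] at hk
      exact absurd hk (hsumComm _ _)
  · refine ⟨SemidirectProduct.inr (.sr 0), Pi.mulSingle 0 (Multiplicative.ofAdd 1), ?_⟩
    rw [hLx, SemidirectProduct.left_inr, SemidirectProduct.right_inr, map_one, one_mul, hs0]
    decide +kernel
  · rw [hr]
    apply le_antisymm
    · refine sup_le flipsHom_range_le_doubleGroup (sup_le altHom_range_le ?_)
      rintro _ ⟨d, rfl⟩
      obtain ⟨u, v, π, ρ, hm, -, -, ⟨h, -⟩ | h⟩ := hj d <;> rw [h]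
      · exact hm
      · exact mul_mem hm (sumComm_mem_doubleGroup _ _)
    · refine doubleGroup_le ?_ (Subgroup.mem_sup_right (Subgroup.mem_sup_right ⟨.sr 0, hs0⟩))
      have e : ∃ v : Fin 4 → Cyc 2, (blackPerm, whitePerm) = (flipHom (evenHom v), 1) *
          (pairHom (swap 0 4 * swap 0 1), pairHom (List.formPerm [0, 1, 2, 3] * swap 0 1)) *
          (flipHom (Multiplicative.ofAdd 1) * pairHom (swap 0 1), pairHom (swap 0 1)) := by
        decide +kernel
      obtain ⟨v, hv⟩ := e
      rw [hv, map_mul, map_mul]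
      refine mul_mem (mul_mem (Subgroup.mem_sup_left ?_)
        (Subgroup.mem_sup_right (Subgroup.mem_sup_left ?_)))
        (Subgroup.mem_sup_right (Subgroup.mem_sup_right ⟨.sr 3, hs3⟩))
      · exact sumCongrHom_mem_flipsHom_range.2 ⟨⟨v, rfl⟩, one_mem _⟩
      · exact ⟨(⟨_, Perm.mem_alternatingGroup.2 (by decide +kernel)⟩,
          ⟨_, Perm.mem_alternatingGroup.2 (by decide +kernel)⟩), rfl⟩

end FivePairs

/-! ### Identifying monodromy groups; cycle types of explicit permutations -/

/-- Two isomorphic trees have compatible edge labels. -/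
theorem PlaneTree.Iso.exists_equivariant {n : ℕ} {T T' : PlaneTree n} (h : T.Iso T') :
    ∃ f : Fin n → Fin n, (∀ x, f (T.σ₀ x) = T'.σ₀ (f x)) ∧ ∀ x, f (T.σ₁ x) = T'.σ₁ (f x) := by
  obtain ⟨τ, h₀, h₁⟩ := h
  exact ⟨τ, fun x => by simp [← h₀], fun x => by simp [← h₁]⟩

/-- The monodromy group is the whole of a group in which it is realised. -/
theorem PlaneTree.nonempty_monodromyGroup_mulEquiv {n : ℕ} {M P : Type*} [Group M] [Group P]
    (T : PlaneTree n) (f : M →* P) (hf : Function.Injective f) (i : Perm (Fin n) →* P)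
    (hi : Function.Injective i) (A B : M) (hA : f A = i T.σ₀) (hB : f B = i T.σ₁)
    (h : Subgroup.closure {A, B} = ⊤) : Nonempty (T.monodromyGroup ≃* M) := by
  have e : T.monodromyGroup.map i = f.range := by
    rw [PlaneTree.monodromyGroup, MonoidHom.map_closure, Set.image_pair, ← hA, ← hB,
      ← Set.image_pair, ← MonoidHom.map_closure, h, MonoidHom.range_eq_map]
  exact ⟨(T.monodromyGroup.equivMapOfInjective i hi).trans ((MulEquiv.subgroupCongr e).trans
    (MonoidHom.ofInjective hf).symm)⟩

/-- The rotation belongs to the group, hence normalises it, and one 3-cycle of consecutive letters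
gives the lower bound; the parity of the generators gives the upper one. -/
theorem PlaneTree.nonempty_mulEquiv_alternatingGroup {n : ℕ} (T : PlaneTree (n + 2))
    (h₀ : Perm.sign T.σ₀ = 1) (h₁ : Perm.sign T.σ₁ = 1)
    (hrot : T.σ₀ * T.σ₁ = finRotate (n + 2)) (i j : Fin (n + 1)) (hij : (i : ℕ) + 1 = j)
    (h : swap i.castSucc i.succ * swap j.castSucc j.succ ∈ T.monodromyGroup) :
    Nonempty (T.monodromyGroup ≃* alternatingGroup (Fin (n + 2))) := by
  have hg : finRotate (n + 2) ∈ T.monodromyGroup := hrot ▸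
    mul_mem (Subgroup.subset_closure (by simp)) (Subgroup.subset_closure (by simp))
  refine ⟨MulEquiv.subgroupCongr (le_antisymm ?_
    (alternatingGroup_le_of_finRotate _ (fun σ => ?_) i j hij h))⟩
  · rw [PlaneTree.monodromyGroup, Subgroup.closure_le]
    rintro _ (rfl | rfl)
    exacts [Perm.mem_alternatingGroup.2 h₀, Perm.mem_alternatingGroup.2 h₁]
  · rw [Subgroup.mul_mem_cancel_right _ (inv_mem hg), Subgroup.mul_mem_cancel_left _ hg]

-- Central matrices are scalars `r` with `r ^ n = 1`, so the hypothesis makes the centre trivial.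
open Matrix in
theorem nonempty_projectiveSpecialLinearGroup_mulEquiv {n : ℕ} {R : Type*} [CommRing R]
    (h : ∀ r : R, r ^ n = 1 → r = 1) :
    Nonempty (ProjectiveSpecialLinearGroup (Fin n) R ≃* SpecialLinearGroup (Fin n) R) := by
  have hc : Subgroup.center (SpecialLinearGroup (Fin n) R) = ⊥ := by
    rw [eq_bot_iff]
    intro A hA
    obtain ⟨r, hr, hrA⟩ := Matrix.SpecialLinearGroup.mem_center_iff.1 hA
    rw [Fintype.card_fin] at hr
    rw [Subgroup.mem_bot]
    apply Subtype.ext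
    rw [← hrA, h r hr, map_one]; rfl
  exact ⟨(QuotientGroup.quotientMulEquivOfEq hc).trans QuotientGroup.quotientBot⟩

open Matrix in
/-- The permutation of all vectors given by a matrix. -/
def specialLinearPerm (n : ℕ) (R : Type*) [CommRing R] :
    SpecialLinearGroup (Fin n) R →* Perm (Fin n → R) where
  toFun A := (SpecialLinearGroup.toLin' A).toEquiv
  map_one' := by rw [map_one]; rfl
  map_mul' A B := by rw [map_mul]; rfl

open Matrix in
theorem specialLinearPerm_injective (n : ℕ) (R : Type*) [CommRing R] :
    Function.Injective (specialLinearPerm n R) := fun A B h => by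
  apply SpecialLinearGroup.toLin'_injective
  exact LinearEquiv.toEquiv_injective h

-- The only nonzero scalar is 1: diagonal factors disappear and transvections need no coefficient.
open Matrix in
theorem specialLinearGroup_zmod_two_eq_top {n : ℕ}
    {H : Subgroup (SpecialLinearGroup (Fin (n + 2)) (ZMod 2))}
    (h : ∀ i j : Fin (n + 2), ∀ hij : i ≠ j, SpecialLinearGroup.transvection hij 1 ∈ H) :
    H = ⊤ := by
  rw [eq_top_iff]
  intro A _
  refine SpecialLinearGroup.diagonal_transvection_induction' (· ∈ H) A ?_ ?_
    (fun _ _ => mul_mem)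
  · intro i j hij c hc
    have hc1 : c = 1 := by revert c; decide
    convert one_mem H
    apply Subtype.ext
    rw [SpecialLinearGroup.diag2n_coe, hc1]
    simp
  · intro i j hij c
    have hc : c = 0 ∨ c = 1 := by revert c; decide
    rcases hc with rfl | rfl
    · simp [one_mem]
    · exact h i j hij

/-- The letters other than `0`, with a fixed extra letter. -/
def optionPermHom (α : Type*) : Perm α →* Perm (Option α) where
  toFun := Equiv.optionCongr
  map_one' := Equiv.optionCongr_refl
  map_mul' σ τ := by ext x; cases x <;> rfl

theorem optionPermHom_injective (α : Type*) : Function.Injective (optionPermHom α) :=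
  Equiv.optionCongr_injective

/-- The permutation with the given disjoint cycles. -/
def cyclesPerm {α : Type*} [DecidableEq α] (L : List (List α)) : Perm α :=
  (L.map List.formPerm).prod

theorem cycleType_cyclesPerm {α : Type*} [DecidableEq α] [Fintype α] (L : List (List α))
    (hL : L.flatten.Nodup) (h2 : ∀ l ∈ L, 2 ≤ l.length) :
    (cyclesPerm L).cycleType = (L.map List.length : Multiset ℕ) := by
  -- The second clause is needed in the induction, to see that the new cycle is disjoint from the
  -- others.
  have key : (cyclesPerm L).cycleType = (L.map List.length : Multiset ℕ) ∧
      ∀ x, x ∉ L.flatten → cyclesPerm L x = x := by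
    induction L with
    | nil => exact ⟨Perm.cycleType_one, fun x _ => rfl⟩
    | cons l L ih =>
      rw [List.flatten_cons, List.nodup_append] at hL
      obtain ⟨hl, hL, hlL⟩ := hL
      obtain ⟨ih1, ih2⟩ := ih hL fun l' hl' => h2 l' (List.mem_cons_of_mem _ hl')
      have hmul : cyclesPerm (l :: L) = l.formPerm * cyclesPerm L := rfl
      have hl2 := h2 l List.mem_cons_self
      have hl1 : ∀ x, l ≠ [x] := fun x h => by simp [h] at hl2
      refine ⟨?_, fun x hx => ?_⟩
      · rw [hmul, Perm.Disjoint.cycleType_mul, ih1, (List.isCycle_formPerm hl hl2).cycleType,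
          List.support_formPerm_of_nodup l hl hl1, List.toFinset_card_of_nodup hl]
        · rfl
        · intro x
          by_cases hx : x ∈ l
          · exact Or.inr (ih2 x fun h => hlL x hx x h rfl)
          · exact Or.inl (List.formPerm_apply_of_notMem hx)
      · rw [List.flatten_cons, List.mem_append, not_or] at hx
        rw [hmul, Perm.mul_apply, ih2 x hx.2, List.formPerm_apply_of_notMem hx.1]
  exact key.1

/-- `cycleType` omits fixed points; they return here as parts equal to 1, the leaves. -/
theorem partition_parts_of_cycleType {n : ℕ} {σ : Perm (Fin n)} {c : Multiset ℕ}
    (h : σ.cycleType = c) : σ.partition.parts = c + Multiset.replicate (n - c.sum) 1 := by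
  rw [Perm.parts_partition, ← Perm.sum_cycleType, h, Fintype.card_fin]

theorem cycleType_of_involutive {n : ℕ} {σ : Perm (Fin (2 * n))} (h : ∀ x, σ (σ x) = x)
    (h' : ∀ x, σ x ≠ x) : σ.cycleType = Multiset.replicate n 2 := by
  have : Fact (Nat.Prime 2) := ⟨Nat.prime_two⟩
  have h2 : σ ^ 2 = 1 := by rw [pow_two]; exact Equiv.ext h
  have hc := Perm.cycleType_of_pow_prime_eq_one h2
  have hs := Perm.sum_cycleType σ
  have hu : σ.support = Finset.univ := Finset.eq_univ_iff_forall.2 fun x =>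
    Perm.mem_support.2 (h' x)
  rw [hc, hu, Multiset.sum_replicate, Finset.card_univ, Fintype.card_fin, smul_eq_mul] at hs
  rw [hc]
  congr 1
  omega

/-- A tree given by two permutations whose product is a cycle through all the edges. -/
def PlaneTree.ofPerms {n : ℕ} (σ₀ σ₁ : Perm (Fin (n + 1))) {α β : Multiset ℕ}
    (h₀ : σ₀.partition.parts = α) (h₁ : σ₁.partition.parts = β)
    (hcard : α.card + β.card = n + 2)
    (hcyc : ∀ x, ∃ k : Fin (n + 1), ((σ₀ * σ₁) ^ (k : ℕ)) 0 = x) : PlaneTree (n + 1) where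
  σ₀ := σ₀
  σ₁ := σ₁
  connected := by
    have hmem : σ₀ * σ₁ ∈ Subgroup.closure {σ₀, σ₁} :=
      mul_mem (Subgroup.subset_closure (by simp)) (Subgroup.subset_closure (by simp))
    refine MulAction.isPretransitive_iff_base (0 : Fin (n + 1)) |>.2 fun x => ?_
    obtain ⟨k, hk⟩ := hcyc x
    exact ⟨⟨_, pow_mem hmem k⟩, hk⟩
  card_vertices := by rw [h₀, h₁, hcard]

/-! ### The twelve trees -/

namespace PlaneTree

theorem seven₁_parts :
    (cyclesPerm [[0, 2, 6], [3, 4, 5]] : Perm (Fin 7)).partition.parts = {3, 3, 1} :=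
  (partition_parts_of_cycleType (cycleType_cyclesPerm _ (by decide) (by decide))).trans
    (by decide)

theorem seven₁_parts' :
    (cyclesPerm [[0, 1], [2, 5]] : Perm (Fin 7)).partition.parts = {2, 2, 1, 1, 1} :=
  (partition_parts_of_cycleType (cycleType_cyclesPerm _ (by decide) (by decide))).trans
    (by decide)

def seven₁ : PlaneTree 7 :=
  ofPerms (cyclesPerm [[0, 2, 6], [3, 4, 5]])
    (cyclesPerm [[0, 1], [2, 5]]) seven₁_parts seven₁_parts'
    (by decide) (by decide +kernel)

theorem seven₂_parts :
    (cyclesPerm [[0, 2, 3], [4, 5, 6]] : Perm (Fin 7)).partition.parts = {3, 3, 1} :=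
  (partition_parts_of_cycleType (cycleType_cyclesPerm _ (by decide) (by decide))).trans
    (by decide)

theorem seven₂_parts' :
    (cyclesPerm [[0, 1], [3, 6]] : Perm (Fin 7)).partition.parts = {2, 2, 1, 1, 1} :=
  (partition_parts_of_cycleType (cycleType_cyclesPerm _ (by decide) (by decide))).trans
    (by decide)

def seven₂ : PlaneTree 7 :=
  ofPerms (cyclesPerm [[0, 2, 3], [4, 5, 6]])
    (cyclesPerm [[0, 1], [3, 6]]) seven₂_parts seven₂_parts'
    (by decide) (by decide +kernel)

theorem seven₃_parts :
    (cyclesPerm [[0, 3, 6], [1, 2], [4, 5]] : Perm (Fin 7)).partition.parts = {3, 2, 2} :=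
  (partition_parts_of_cycleType (cycleType_cyclesPerm _ (by decide) (by decide))).trans
    (by decide)

theorem seven₃_parts' :
    (cyclesPerm [[0, 2], [3, 5]] : Perm (Fin 7)).partition.parts = {2, 2, 1, 1, 1} :=
  (partition_parts_of_cycleType (cycleType_cyclesPerm _ (by decide) (by decide))).trans
    (by decide)

def seven₃ : PlaneTree 7 :=
  ofPerms (cyclesPerm [[0, 3, 6], [1, 2], [4, 5]])
    (cyclesPerm [[0, 2], [3, 5]]) seven₃_parts seven₃_parts'
    (by decide) (by decide +kernel)

theorem seven₄_parts :
    (cyclesPerm [[0, 3], [1, 2], [4, 5, 6]] : Perm (Fin 7)).partition.parts = {3, 2, 2} :=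
  (partition_parts_of_cycleType (cycleType_cyclesPerm _ (by decide) (by decide))).trans
    (by decide)

theorem seven₄_parts' :
    (cyclesPerm [[0, 2], [3, 6]] : Perm (Fin 7)).partition.parts = {2, 2, 1, 1, 1} :=
  (partition_parts_of_cycleType (cycleType_cyclesPerm _ (by decide) (by decide))).trans
    (by decide)

def seven₄ : PlaneTree 7 :=
  ofPerms (cyclesPerm [[0, 3], [1, 2], [4, 5, 6]])
    (cyclesPerm [[0, 2], [3, 6]]) seven₄_parts seven₄_parts'
    (by decide) (by decide +kernel)

theorem nine₁_parts :
    (cyclesPerm [[0, 2, 4], [5, 7, 8]] : Perm (Fin 9)).partition.parts = {3, 3, 1, 1, 1} :=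
  (partition_parts_of_cycleType (cycleType_cyclesPerm _ (by decide) (by decide))).trans
    (by decide)

theorem nine₁_parts' :
    (cyclesPerm [[0, 1], [2, 3], [4, 8], [5, 6]] : Perm (Fin 9)).partition.parts = {2, 2, 2, 2, 1} :=
  (partition_parts_of_cycleType (cycleType_cyclesPerm _ (by decide) (by decide))).trans
    (by decide)

def nine₁ : PlaneTree 9 :=
  ofPerms (cyclesPerm [[0, 2, 4], [5, 7, 8]])
    (cyclesPerm [[0, 1], [2, 3], [4, 8], [5, 6]]) nine₁_parts nine₁_parts'
    (by decide) (by decide +kernel)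

theorem nine₂_parts :
    (cyclesPerm [[0, 2, 4], [5, 6, 8]] : Perm (Fin 9)).partition.parts = {3, 3, 1, 1, 1} :=
  (partition_parts_of_cycleType (cycleType_cyclesPerm _ (by decide) (by decide))).trans
    (by decide)

theorem nine₂_parts' :
    (cyclesPerm [[0, 1], [2, 3], [4, 8], [6, 7]] : Perm (Fin 9)).partition.parts = {2, 2, 2, 2, 1} :=
  (partition_parts_of_cycleType (cycleType_cyclesPerm _ (by decide) (by decide))).trans
    (by decide)

def nine₂ : PlaneTree 9 :=
  ofPerms (cyclesPerm [[0, 2, 4], [5, 6, 8]])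
    (cyclesPerm [[0, 1], [2, 3], [4, 8], [6, 7]]) nine₂_parts nine₂_parts'
    (by decide) (by decide +kernel)

theorem ten₁_parts :
    (cyclesPerm [[0, 3, 4], [1, 2], [5, 7]] : Perm (Fin 10)).partition.parts =
      {3, 2, 2, 1, 1, 1} :=
  (partition_parts_of_cycleType (cycleType_cyclesPerm _ (by decide) (by decide))).trans
    (by decide)

theorem ten₁_parts' :
    (Equiv.addRight 5 : Perm (Fin 10)).partition.parts = {2, 2, 2, 2, 2} :=
  (partition_parts_of_cycleType (cycleType_of_involutive (n := 5) (by decide) (by decide))).trans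
    (by decide)

def ten₁ : PlaneTree 10 :=
  ofPerms (cyclesPerm [[0, 3, 4], [1, 2], [5, 7]]) (Equiv.addRight 5) ten₁_parts ten₁_parts'
    (by decide) (by decide +kernel)

theorem ten₂_parts :
    (cyclesPerm [[0, 2, 4], [5, 6], [7, 8]] : Perm (Fin 10)).partition.parts =
      {3, 2, 2, 1, 1, 1} :=
  (partition_parts_of_cycleType (cycleType_cyclesPerm _ (by decide) (by decide))).trans
    (by decide)

theorem ten₂_parts' :
    (Equiv.addRight 5 : Perm (Fin 10)).partition.parts = {2, 2, 2, 2, 2} :=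
  (partition_parts_of_cycleType (cycleType_of_involutive (n := 5) (by decide) (by decide))).trans
    (by decide)

def ten₂ : PlaneTree 10 :=
  ofPerms (cyclesPerm [[0, 2, 4], [5, 6], [7, 8]]) (Equiv.addRight 5) ten₂_parts ten₂_parts'
    (by decide) (by decide +kernel)

theorem twenty₁_parts :
    (cyclesPerm [[0, 4, 5, 9], [10, 11, 12, 13], [15, 16, 17, 18]]
      : Perm (Fin 20)).partition.parts =
      Multiset.replicate 3 4 + Multiset.replicate 8 1 :=
  (partition_parts_of_cycleType (cycleType_cyclesPerm _ (by decide) (by decide))).trans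
    (by decide)

theorem twenty₁_parts' :
    (Equiv.addRight 10 : Perm (Fin 20)).partition.parts = Multiset.replicate 10 2 :=
  (partition_parts_of_cycleType (cycleType_of_involutive (n := 10) (by decide) (by decide))).trans
    (by decide)

/-- The centre is `[0, 4, 5, 9]`, and the edges 0 and 5 leading to the other big vertices are
opposite, whence the half turn. -/
def twenty₁ : PlaneTree 20 :=
  ofPerms (cyclesPerm [[0, 4, 5, 9], [10, 11, 12, 13], [15, 16, 17, 18]])
    (Equiv.addRight 10) twenty₁_parts twenty₁_parts'
    (by decide) (by decide +kernel)

theorem twenty₂_parts :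
    (cyclesPerm [[0, 4, 8, 9], [10, 11, 12, 13], [14, 15, 16, 17]]
      : Perm (Fin 20)).partition.parts =
      Multiset.replicate 3 4 + Multiset.replicate 8 1 :=
  (partition_parts_of_cycleType (cycleType_cyclesPerm _ (by decide) (by decide))).trans
    (by decide)

theorem twenty₂_parts' :
    (Equiv.addRight 10 : Perm (Fin 20)).partition.parts = Multiset.replicate 10 2 :=
  (partition_parts_of_cycleType (cycleType_of_involutive (n := 10) (by decide) (by decide))).trans
    (by decide)

/-- Here the joining edges 0 and 4 are adjacent at the centre. -/
def twenty₂ : PlaneTree 20 :=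
  ofPerms (cyclesPerm [[0, 4, 8, 9], [10, 11, 12, 13], [14, 15, 16, 17]])
    (Equiv.addRight 10) twenty₂_parts twenty₂_parts'
    (by decide) (by decide +kernel)

theorem twentySix₁_parts :
    (cyclesPerm [[0, 5, 10, 11, 12], [13, 14, 15, 16, 17], [18, 19, 20, 21, 22]]
      : Perm (Fin 26)).partition.parts =
      Multiset.replicate 3 5 + Multiset.replicate 11 1 :=
  (partition_parts_of_cycleType (cycleType_cyclesPerm _ (by decide) (by decide))).trans
    (by decide)

theorem twentySix₁_parts' :
    (Equiv.addRight 13 : Perm (Fin 26)).partition.parts = Multiset.replicate 13 2 :=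
  (partition_parts_of_cycleType (cycleType_of_involutive (n := 13) (by decide) (by decide))).trans
    (by decide)

def twentySix₁ : PlaneTree 26 :=
  ofPerms (cyclesPerm [[0, 5, 10, 11, 12], [13, 14, 15, 16, 17], [18, 19, 20, 21, 22]])
    (Equiv.addRight 13) twentySix₁_parts twentySix₁_parts'
    (by decide) (by decide +kernel)

theorem twentySix₂_parts :
    (cyclesPerm [[0, 5, 6, 11, 12], [13, 14, 15, 16, 17], [19, 20, 21, 22, 23]]
      : Perm (Fin 26)).partition.parts =
      Multiset.replicate 3 5 + Multiset.replicate 11 1 :=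
  (partition_parts_of_cycleType (cycleType_cyclesPerm _ (by decide) (by decide))).trans
    (by decide)

theorem twentySix₂_parts' :
    (Equiv.addRight 13 : Perm (Fin 26)).partition.parts = Multiset.replicate 13 2 :=
  (partition_parts_of_cycleType (cycleType_of_involutive (n := 13) (by decide) (by decide))).trans
    (by decide)

def twentySix₂ : PlaneTree 26 :=
  ofPerms (cyclesPerm [[0, 5, 6, 11, 12], [13, 14, 15, 16, 17], [19, 20, 21, 22, 23]])
    (Equiv.addRight 13) twentySix₂_parts twentySix₂_parts'
    (by decide) (by decide +kernel)

end PlaneTree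

/-! ### Monodromy groups of the trees with 7, 10, 20 and 26 edges -/

theorem permCongr_eq_of_forall {α X : Type*} {p : α → X} (hp : Function.Bijective p) {σ : Perm α}
    {τ : Perm X} (h : ∀ x, τ (p x) = p (σ x)) : τ = (Equiv.ofBijective p hp).permCongr σ := by
  refine Equiv.ext fun x => ?_
  obtain ⟨y, rfl⟩ := hp.2 x
  rw [h, permCongr_apply]
  have : (Equiv.ofBijective p hp).symm (p y) = y := (Equiv.ofBijective p hp).symm_apply_apply y
  rw [this]; rfl

namespace PlaneTree

section

open Matrix

theorem seven₁_monodromyGroup : Nonempty (seven₁.monodromyGroup ≃*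
    ProjectiveSpecialLinearGroup (Fin 3) (ZMod 2)) := by
  obtain ⟨e⟩ := nonempty_projectiveSpecialLinearGroup_mulEquiv (n := 3) (R := ZMod 2) (by decide)
  let A : SpecialLinearGroup (Fin 3) (ZMod 2) := ⟨!![0, 0, 1; 0, 1, 0; 1, 0, 1], by decide⟩
  let B : SpecialLinearGroup (Fin 3) (ZMod 2) := ⟨!![0, 1, 0; 1, 0, 0; 1, 1, 1], by decide⟩
  -- The edges are the seven nonzero vectors, numbered so that both rotations are linear; the extra
  -- letter is the zero vector.
  let p : Option (Fin 7) → Fin 3 → ZMod 2 := fun o => o.elim 0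
    ![![1, 0, 1], ![0, 1, 0], ![1, 0, 0], ![1, 1, 1], ![1, 1, 0], ![0, 1, 1], ![0, 0, 1]]
  have hp : Function.Bijective p := (Fintype.bijective_iff_injective_and_card p).2
    ⟨by decide, by decide⟩
  obtain ⟨f⟩ := seven₁.nonempty_monodromyGroup_mulEquiv (specialLinearPerm 3 (ZMod 2))
    (specialLinearPerm_injective _ _)
    ((Equiv.ofBijective p hp).permCongrHom.toMonoidHom.comp (optionPermHom (Fin 7)))
    ((Equiv.ofBijective p hp).permCongrHom.injective.comp (optionPermHom_injective _)) A B
    (permCongr_eq_of_forall _ (by decide +kernel)) (permCongr_eq_of_forall _ (by decide +kernel))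
    (specialLinearGroup_zmod_two_eq_top fun i j hij => by
      have hA : A ∈ Subgroup.closure {A, B} := Subgroup.subset_closure (by simp)
      have hB : B ∈ Subgroup.closure {A, B} := Subgroup.subset_closure (by simp)
      have hw : ∀ w : List Bool, (w.map fun c => if c then A else B).prod ∈
          Subgroup.closure {A, B} := fun w => list_prod_mem fun x hx => by
        obtain ⟨c, -, rfl⟩ := List.mem_map.1 hx
        cases c
        exacts [hB, hA]
      -- One word in `A` and `B` for each of the six transvections.
      have : ∃ w ∈ [[false, true, false, true, false, true, true, false, true, true, false],
          [false, true, false, true, false, true, true, false, true, false, true, false],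
          [true, false, true, true, false, true, true, false, true, false, true, false, true, true],
          [false, true, true, false, true, true, false, true, false, true, false],
          [false, true, false, true, false, true, true, false, true, false, true, false, true],
          [true, false, true, false, true, true, false, true, false, true, false, true, false]],
            SpecialLinearGroup.transvection hij (1 : ZMod 2) =
          (w.map fun c => if c then A else B).prod := by
        revert i j
        decide +kernel
      obtain ⟨w, -, h⟩ := this
      exact h ▸ hw w)
  exact ⟨f.trans e.symm⟩

theorem seven₂_monodromyGroup : Nonempty (seven₂.monodromyGroup ≃*
    ProjectiveSpecialLinearGroup (Fin 3) (ZMod 2)) := by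
  obtain ⟨e⟩ := nonempty_projectiveSpecialLinearGroup_mulEquiv (n := 3) (R := ZMod 2) (by decide)
  let A : SpecialLinearGroup (Fin 3) (ZMod 2) := ⟨!![0, 0, 1; 0, 1, 0; 1, 0, 1], by decide⟩
  let B : SpecialLinearGroup (Fin 3) (ZMod 2) := ⟨!![0, 1, 0; 1, 0, 0; 0, 0, 1], by decide⟩
  let p : Option (Fin 7) → Fin 3 → ZMod 2 := fun o => o.elim 0
    ![![1, 0, 0], ![0, 1, 0], ![0, 0, 1], ![1, 0, 1], ![1, 1, 1], ![1, 1, 0], ![0, 1, 1]]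
  have hp : Function.Bijective p := (Fintype.bijective_iff_injective_and_card p).2
    ⟨by decide, by decide⟩
  obtain ⟨f⟩ := seven₂.nonempty_monodromyGroup_mulEquiv (specialLinearPerm 3 (ZMod 2))
    (specialLinearPerm_injective _ _)
    ((Equiv.ofBijective p hp).permCongrHom.toMonoidHom.comp (optionPermHom (Fin 7)))
    ((Equiv.ofBijective p hp).permCongrHom.injective.comp (optionPermHom_injective _)) A B
    (permCongr_eq_of_forall _ (by decide +kernel)) (permCongr_eq_of_forall _ (by decide +kernel))
    (specialLinearGroup_zmod_two_eq_top fun i j hij => by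
      have hA : A ∈ Subgroup.closure {A, B} := Subgroup.subset_closure (by simp)
      have hB : B ∈ Subgroup.closure {A, B} := Subgroup.subset_closure (by simp)
      have hw : ∀ w : List Bool, (w.map fun c => if c then A else B).prod ∈
          Subgroup.closure {A, B} := fun w => list_prod_mem fun x hx => by
        obtain ⟨c, -, rfl⟩ := List.mem_map.1 hx
        cases c
        exacts [hB, hA]
      have : ∃ w ∈ [[true, false, true, true, false, true, true, false, true, false, true, false, true, true],
          [false, true, false, true, false, true, true, false, true, false, true, false, true],
          [true, true, false, true, false, true, false, true, true, false, true, true, false, true],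
          [true, false, true, false, true, true, false, true, false, true, false, true, false],
          [true, false, true, false, true, false, true, true, false, true, false, true, false],
          [false, true, false, true, false, true, false, true, true, false, true, false, true]],
            SpecialLinearGroup.transvection hij (1 : ZMod 2) =
          (w.map fun c => if c then A else B).prod := by
        revert i j
        decide +kernel
      obtain ⟨w, -, h⟩ := this
      exact h ▸ hw w)
  exact ⟨f.trans e.symm⟩

end

theorem seven₃_monodromyGroup :
    Nonempty (seven₃.monodromyGroup ≃* alternatingGroup (Fin 7)) := by
  refine seven₃.nonempty_mulEquiv_alternatingGroup (n := 5) (by decide +kernel) (by decide +kernel)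
    (by decide +kernel) 4 5 rfl ?_
  have h₀ : seven₃.σ₀ ∈ seven₃.monodromyGroup := Subgroup.subset_closure (by simp)
  have h₁ : seven₃.σ₁ ∈ seven₃.monodromyGroup := Subgroup.subset_closure (by simp)
  have hw : ∀ H : Subgroup (Perm (Fin 7)), ∀ X ∈ H, ∀ Y ∈ H,
      ((Y * X * Y * X * X * Y) * X ^ 2 * (Y * X * Y * X * X * Y)⁻¹)⁻¹ ∈ H := by
    intro H X hX Y hY
    apply_rules [mul_mem, pow_mem, inv_mem]
  -- The black degrees are 3, 2, 2, so `σ₀ ^ 2` is a 3-cycle; the conjugation only moves it onto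
  -- consecutive letters.
  have e : swap (4 : Fin 6).castSucc (4 : Fin 6).succ *
      swap (5 : Fin 6).castSucc (5 : Fin 6).succ =
      (fun X Y : Perm (Fin 7) => ((Y * X * Y * X * X * Y) * X ^ 2 * (Y * X * Y * X * X * Y)⁻¹)⁻¹)
        seven₃.σ₀ seven₃.σ₁ := by
    decide +kernel
  rw [e]
  exact hw _ _ h₀ _ h₁

theorem seven₄_monodromyGroup :
    Nonempty (seven₄.monodromyGroup ≃* alternatingGroup (Fin 7)) := by
  refine seven₄.nonempty_mulEquiv_alternatingGroup (n := 5) (by decide +kernel) (by decide +kernel)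
    (by decide +kernel) 4 5 rfl ?_
  have h₀ : seven₄.σ₀ ∈ seven₄.monodromyGroup := Subgroup.subset_closure (by simp)
  have h₁ : seven₄.σ₁ ∈ seven₄.monodromyGroup := Subgroup.subset_closure (by simp)
  have hw : ∀ H : Subgroup (Perm (Fin 7)), ∀ X ∈ H, ∀ Y ∈ H,
      (X ^ 2)⁻¹ ∈ H := by
    intro H X hX Y hY
    apply_rules [mul_mem, pow_mem, inv_mem]
  have e : swap (4 : Fin 6).castSucc (4 : Fin 6).succ *
      swap (5 : Fin 6).castSucc (5 : Fin 6).succ =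
      (fun X Y : Perm (Fin 7) => (X ^ 2)⁻¹) seven₄.σ₀ seven₄.σ₁ := by
    decide +kernel
  rw [e]
  exact hw _ _ h₀ _ h₁

theorem ten₁_monodromyGroup :
    IsSemidirect ten₁.monodromyGroup (AltSq 5) (Cyc 2 × Cyc 2) := by
  obtain ⟨f⟩ := ten₁.nonempty_mulEquiv_doubleGroup (finSumFinEquiv (m := 5) (n := 5)).symm
    (List.formPerm [0, 3, 4] * List.formPerm [1, 2]) (List.formPerm [0, 2])
      (by decide +kernel) (by decide +kernel)
  exact IsSemidirect.of_mulEquiv f isSemidirect_double_five_sq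

theorem ten₂_monodromyGroup :
    IsSemidirect ten₂.monodromyGroup (AltSq 5) (Cyc 2) := by
  obtain ⟨f⟩ := ten₂.nonempty_mulEquiv_doubleGroup (finSumFinEquiv (m := 5) (n := 5)).symm
    (List.formPerm [0, 2, 4]) (List.formPerm [0, 1] * List.formPerm [2, 3])
      (by decide +kernel) (by decide +kernel)
  exact IsSemidirect.of_mulEquiv f isSemidirect_double_five

theorem twenty₂_monodromyGroup :
    IsSemidirect twenty₂.monodromyGroup (AltSq 10) (DihedralGroup 4) := by
  obtain ⟨f⟩ := twenty₂.nonempty_mulEquiv_doubleGroup (finSumFinEquiv (m := 10) (n := 10)).symm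
    (List.formPerm [0, 4, 8, 9])
    (List.formPerm [0, 1, 2, 3] * List.formPerm [4, 5, 6, 7])
      (by decide +kernel) (by decide +kernel)
  exact IsSemidirect.of_mulEquiv f isSemidirect_double_ten

theorem twentySix₁_monodromyGroup :
    IsSemidirect twentySix₁.monodromyGroup (AltSq 13) (Cyc 2) := by
  obtain ⟨f⟩ := twentySix₁.nonempty_mulEquiv_doubleGroup (finSumFinEquiv (m := 13) (n := 13)).symm
    (List.formPerm [0, 5, 10, 11, 12])
    (List.formPerm [0, 1, 2, 3, 4] * List.formPerm [5, 6, 7, 8, 9])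
      (by decide +kernel) (by decide +kernel)
  exact IsSemidirect.of_mulEquiv f isSemidirect_double_thirteen

theorem twentySix₂_monodromyGroup :
    IsSemidirect twentySix₂.monodromyGroup (AltSq 13) (Cyc 2) := by
  obtain ⟨f⟩ := twentySix₂.nonempty_mulEquiv_doubleGroup (finSumFinEquiv (m := 13) (n := 13)).symm
    (List.formPerm [0, 5, 6, 11, 12])
    (List.formPerm [0, 1, 2, 3, 4] * List.formPerm [6, 7, 8, 9, 10])
      (by decide +kernel) (by decide +kernel)
  exact IsSemidirect.of_mulEquiv f isSemidirect_double_thirteen'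

theorem twenty₁_monodromyGroup : ∃ ψ : DihedralGroup 4 →* MulAut (AltSq 5), ψ ≠ 1 ∧
    IsSemidirect twenty₁.monodromyGroup (Fin 8 → Cyc 2) (AltSq 5 ⋊[ψ] DihedralGroup 4) := by
  -- In each copy the half turn pairs labels that differ by 5, so the residue modulo 5 numbers the
  -- pair.
  let p : Fin 20 → FivePairs ⊕ FivePairs := fun i =>
    if i < 10 then .inl (Fin.ofNat 5 i, if i < 5 then 0 else 1)
    else .inr (Fin.ofNat 5 i, if i < 15 then 0 else 1)
  have hp : Function.Bijective p := (Fintype.bijective_iff_injective_and_card p).2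
    ⟨by decide +kernel, by decide⟩
  obtain ⟨f⟩ := twenty₁.nonempty_mulEquiv_doubleGroup (Equiv.ofBijective p hp)
    FivePairs.blackPerm FivePairs.whitePerm
    (permCongr_eq_of_forall hp (by decide +kernel)).symm
    (permCongr_eq_of_forall hp (by decide +kernel)).symm
  obtain ⟨ψ, hψ, h⟩ := FivePairs.isSemidirect_doubleGroup
  exact ⟨ψ, hψ, IsSemidirect.of_mulEquiv f h⟩

end PlaneTree

/-! ### `PSL(2, 8) ⋊ 3` on the projective line, and the trees with nine edges -/

/-- The field with eight elements: the polynomial `x₂ α² + x₁ α + x₀` over `ZMod 2`, where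
`α³ = α + 1`, is encoded by the number with binary digits `x₂ x₁ x₀`. -/
def F8 : Type := Fin 8

namespace F8

instance : DecidableEq F8 := inferInstanceAs (DecidableEq (Fin 8))
instance : Fintype F8 := inferInstanceAs (Fintype (Fin 8))

/-- The powers of `α`. -/
def exp (k : ℕ) : F8 := (![1, 2, 4, 3, 6, 7, 5] : Fin 7 → Fin 8) (Fin.ofNat 7 k)

/-- The discrete logarithm to the base `α`. -/
def log (x : F8) : ℕ := (![0, 0, 1, 3, 2, 6, 4, 5] : Fin 8 → ℕ) x

def ofFin (x : Fin 8) : F8 := x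

instance : Zero F8 := ⟨ofFin 0⟩
instance : One F8 := ⟨ofFin 1⟩
instance : Add F8 := ⟨fun x y => Fin.ofNat 8 (Nat.xor (Fin.val (n := 8) x) (Fin.val (n := 8) y))⟩
instance : Neg F8 := ⟨id⟩
instance : Mul F8 := ⟨fun x y => if x = 0 ∨ y = 0 then 0 else exp (log x + log y)⟩
instance : Inv F8 := ⟨fun x => if x = 0 then 0 else exp (7 - log x)⟩

instance : Field F8 where
  add_assoc := by decide +kernel
  zero_add := by decide +kernel
  add_zero := by decide +kernel
  add_comm := by decide +kernel
  neg_add_cancel := by decide +kernel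
  mul_assoc := by decide +kernel
  one_mul := by decide +kernel
  mul_one := by decide +kernel
  mul_comm := by decide +kernel
  left_distrib := by decide +kernel
  right_distrib := by decide +kernel
  zero_mul := by decide +kernel
  mul_zero := by decide +kernel
  exists_pair_ne := ⟨0, 1, by decide +kernel⟩
  mul_inv_cancel := by decide +kernel
  inv_zero := by decide +kernel
  nsmul := nsmulRec
  zsmul := zsmulRec
  nnqsmul := _
  nnqsmul_def := fun _ _ => rfl
  qsmul := _
  qsmul_def := fun _ _ => rfl

theorem nonempty_ringEquiv_galoisField : Nonempty (GaloisField 2 3 ≃+* F8) := by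
  have : Fintype (GaloisField 2 3) := Fintype.ofFinite _
  refine ⟨FiniteField.ringEquivOfCardEq ?_⟩
  rw [← Nat.card_eq_fintype_card, GaloisField.card 2 3 (by norm_num)]
  rfl

/-- The squaring automorphism. -/
def frobenius : F8 →+* F8 where
  toFun x := x * x
  map_zero' := by decide +kernel
  map_one' := by decide +kernel
  map_add' := by decide +kernel
  map_mul' := by decide +kernel

instance : DecidableEq (OnePoint F8) := inferInstanceAs (DecidableEq (Option F8))

def frobeniusPerm : Perm (OnePoint F8) where
  toFun := OnePoint.map frobenius
  invFun := OnePoint.map (frobenius ∘ frobenius)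
  left_inv := by
    unfold Function.LeftInverse
    decide +kernel
  right_inv := by
    unfold Function.RightInverse Function.LeftInverse
    decide +kernel

open Matrix OnePoint

/-- A matrix acting on the projective line by a Möbius transformation. -/
def moebius (a b c d : F8) : OnePoint F8 → OnePoint F8 := fun x =>
  OnePoint.elim x (if c = 0 then ∞ else OnePoint.some (a * c⁻¹)) fun k =>
    if c * k + d = 0 then ∞ else OnePoint.some ((a * k + b) * (c * k + d)⁻¹)

def moebiusHom : SpecialLinearGroup (Fin 2) F8 →* Perm (OnePoint F8) :=
  (MulAction.toPermHom (GL (Fin 2) F8) (OnePoint F8)).comp SpecialLinearGroup.toGL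

/-- Replaces the abstract action by a formula that can be evaluated on every point. -/
theorem moebiusHom_apply (A : SpecialLinearGroup (Fin 2) F8) (x : OnePoint F8) :
    moebiusHom A x = moebius (A 0 0) (A 0 1) (A 1 0) (A 1 1) x := by
  change SpecialLinearGroup.toGL A • x = _
  cases x with
  | infty => rw [OnePoint.smul_infty_eq_ite]; rfl
  | coe k => rw [OnePoint.smul_some_eq_ite]; rfl

/-- A Möbius transformation fixing three points is scalar; determinant one in characteristic two
leaves only the identity. -/
theorem moebius_fixed : ∀ a b c d : F8, a * d - b * c = 1 →
    moebius a b c d ∞ = ∞ → moebius a b c d (0 : F8) = (0 : F8) →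
    moebius a b c d (1 : F8) = (1 : F8) → a = 1 ∧ b = 0 ∧ c = 0 ∧ d = 1 := by
  decide +kernel

theorem eq_one_of_moebiusHom {A : SpecialLinearGroup (Fin 2) F8}
    (h0 : moebiusHom A ∞ = ∞) (h1 : moebiusHom A (0 : F8) = (0 : F8))
    (h2 : moebiusHom A (1 : F8) = (1 : F8)) : A = 1 := by
  rw [moebiusHom_apply] at h0 h1 h2
  obtain ⟨ha, hb, hc, hd⟩ := moebius_fixed _ _ _ _ (by rw [← det_fin_two]; exact A.2) h0 h1 h2
  ext i j
  fin_cases i <;> fin_cases j <;> assumption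

theorem moebiusHom_injective : Function.Injective moebiusHom := by
  rw [injective_iff_map_eq_one]
  exact fun A hA => eq_one_of_moebiusHom (by rw [hA]; rfl) (by rw [hA]; rfl) (by rw [hA]; rfl)

theorem frobeniusPerm_conj (A : SpecialLinearGroup (Fin 2) F8) :
    frobeniusPerm * moebiusHom A * frobeniusPerm⁻¹ =
      moebiusHom (SpecialLinearGroup.map frobenius A) := by
  rw [mul_inv_eq_iff_eq_mul]
  ext x : 1
  exact OnePoint.map_smul frobenius (SpecialLinearGroup.toGL A) x

theorem specialLinearGroup_eq_top {K : Type*} [Field K] {H : Subgroup (SpecialLinearGroup (Fin 2) K)}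
    (h : ∀ i j : Fin 2, ∀ hij : i ≠ j, ∀ c, SpecialLinearGroup.transvection hij c ∈ H) : H = ⊤ := by
  rw [eq_top_iff]
  intro A _
  have hU := fun c : K => h 0 1 zero_ne_one c
  have hL := fun c : K => h 1 0 one_ne_zero c
  have hdet : A 0 0 * A 1 1 - A 0 1 * A 1 0 = 1 := by rw [← det_fin_two]; exact A.2
  have key : ∀ B : SpecialLinearGroup (Fin 2) K, B 1 0 ≠ 0 → B ∈ H := by
    intro B hB
    have hdet : B 0 0 * B 1 1 - B 0 1 * B 1 0 = 1 := by rw [← det_fin_two]; exact B.2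
    -- The factorisation upper · lower · upper, available when the lower left entry is nonzero.
    -- Otherwise a lower transvection first makes it so.
    have e : B = SpecialLinearGroup.transvection zero_ne_one ((B 0 0 - 1) / B 1 0) *
        SpecialLinearGroup.transvection one_ne_zero (B 1 0) *
        SpecialLinearGroup.transvection zero_ne_one ((B 1 1 - 1) / B 1 0) := by
      ext i j
      fin_cases i <;> fin_cases j <;>
        simp [SpecialLinearGroup.transvection_coe, mul_apply, Fin.sum_univ_two, Matrix.add_apply,
          single_apply]
      all_goals field_simp
      all_goals first | linear_combination hdet | linear_combination -hdet | ring
    rw [e]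
    exact mul_mem (mul_mem (hU _) (hL _)) (hU _)
  by_cases hc : A 1 0 = 0
  · have ha : A 0 0 ≠ 0 := fun ha => by simp [ha, hc] at hdet
    have := key (SpecialLinearGroup.transvection one_ne_zero 1 * A) (by
      simp [SpecialLinearGroup.transvection_coe, mul_apply, Fin.sum_univ_two, Matrix.add_apply,
          single_apply, hc, ha])
    exact (Subgroup.mul_mem_cancel_left _ (hL 1)).1 this
  · exact key A hc

/-- The involution generating, together with the squaring automorphism, the whole group. -/
def involution : SpecialLinearGroup (Fin 2) F8 :=
  ⟨!![ofFin 2, 1; ofFin 5, ofFin 2], by rw [det_fin_two]; decide +kernel⟩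

theorem closure_frobenius_orbit {H : Subgroup (SpecialLinearGroup (Fin 2) F8)}
    (h0 : involution ∈ H) (h : ∀ A ∈ H, SpecialLinearGroup.map frobenius A ∈ H) : H = ⊤ := by
  let B : Fin 3 → SpecialLinearGroup (Fin 2) F8 :=
    ![involution, SpecialLinearGroup.map frobenius involution,
      SpecialLinearGroup.map frobenius (SpecialLinearGroup.map frobenius involution)]
  have hB : ∀ k, B k ∈ H := by
    intro k
    fin_cases k
    exacts [h0, h _ h0, h _ (h _ h0)]
  refine specialLinearGroup_eq_top fun i j hij c => ?_
  have hw : ∀ w : List (Fin 3), (w.map B).prod ∈ H := fun w => list_prod_mem fun x hx => by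
    obtain ⟨k, -, rfl⟩ := List.mem_map.1 hx
    exact hB k
  -- The empty word serves `c = 0`; the others serve the fourteen nontrivial transvections.
  have : ∃ w ∈ ([[], [0, 2, 0, 1, 0, 1, 2, 1, 2], [0, 1, 0, 2, 1, 2, 0, 1, 0],
      [0, 2, 0, 2, 1, 2], [0, 2, 1, 0, 1, 0, 1, 2, 0],
      [1, 0, 1], [2, 0, 1, 0, 2],
      [0, 2, 0, 1, 0, 1], [0, 2, 0, 2, 0, 2, 0, 2, 0],
      [2, 1, 2], [0, 1, 2, 1, 0],
      [1, 0, 1, 2, 1, 2], [0, 1, 0, 1, 0, 1, 0, 1, 0],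
      [0, 2, 0], [1, 2, 0, 2, 1]] : List (List (Fin 3))),
      SpecialLinearGroup.transvection hij c = (w.map B).prod := by
    revert i j c
    decide +kernel
  obtain ⟨w, -, e⟩ := this
  exact e ▸ hw w

theorem frobeniusPerm_pow_three : frobeniusPerm ^ 3 = 1 := by decide +kernel

/-- The group generated by an involution of `PSL(2, 8)` and the squaring automorphism. -/
theorem isSemidirect_of_mem {H : Subgroup (Perm (OnePoint F8))} (hφ : frobeniusPerm ∈ H)
    (hB : moebiusHom involution ∈ H)
    (hH : H ≤ Subgroup.closure {frobeniusPerm, moebiusHom involution}) :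
    IsSemidirect H (ProjectiveSpecialLinearGroup (Fin 2) (GaloisField 2 3)) (Cyc 3) := by
  obtain ⟨r⟩ := nonempty_ringEquiv_galoisField
  obtain ⟨e⟩ := nonempty_projectiveSpecialLinearGroup_mulEquiv (n := 2) (R := GaloisField 2 3)
    fun x hx => r.injective (by
      have : ∀ y : F8, y ^ 2 = 1 → y = 1 := by decide +kernel
      rw [map_one]
      exact this _ (by rw [← map_pow, hx, map_one]))
  let m : SpecialLinearGroup (Fin 2) (GaloisField 2 3) →* SpecialLinearGroup (Fin 2) F8 :=
    SpecialLinearGroup.map r.toRingHom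
  have hm : Function.Bijective m := by
    refine ⟨fun A B h => ?_, fun A => ⟨SpecialLinearGroup.map r.symm.toRingHom A, ?_⟩⟩
    · ext i j
      exact r.injective (congrArg (fun C : SpecialLinearGroup (Fin 2) F8 => C i j) h)
    · ext i j
      exact r.apply_symm_apply _
  let i := moebiusHom.comp (m.comp e.toMonoidHom)
  have hi : Function.Injective i := moebiusHom_injective.comp (hm.1.comp e.injective)
  have hs : Function.Surjective (m.comp e.toMonoidHom) := hm.2.comp e.surjective
  have hri : i.range = moebiusHom.range := by
    rw [MonoidHom.range_comp, MonoidHom.range_eq_top_of_surjective _ hs, MonoidHom.range_eq_map]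
  have hie : ∀ A, ∃ x, i x = moebiusHom A := fun A => by
    have : moebiusHom A ∈ i.range := hri ▸ ⟨A, rfl⟩
    exact this
  obtain ⟨j, hj⟩ := exists_hom_cyc 3 frobeniusPerm frobeniusPerm_pow_three
  have hjk : ∀ k : Cyc 3, ∃ n : Fin 3, k = Multiplicative.ofAdd ((n : ℕ) : ZMod 3) := by decide
  have hconj : ∀ (n : ℕ) (A), ∃ B, frobeniusPerm ^ n * moebiusHom A * (frobeniusPerm ^ n)⁻¹ =
      moebiusHom B := by
    intro n
    induction n with
    | zero => exact fun A => ⟨A, by simp⟩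
    | succ n ih =>
      intro A
      obtain ⟨B, hB⟩ := ih (SpecialLinearGroup.map frobenius A)
      refine ⟨B, ?_⟩
      rw [← hB, ← frobeniusPerm_conj, pow_succ]
      simp only [_root_.mul_inv_rev, mul_assoc]
  refine isSemidirect_of_embeddings i j hi ?_ ?_ ?_ _ ?_
  · intro k x
    obtain ⟨n, rfl⟩ := hjk k
    obtain ⟨B, hB⟩ := hconj n (m (e x))
    obtain ⟨y, hy⟩ := hie B
    exact ⟨y, by rw [hj, hy, ← hB]; rfl⟩
  · intro x k hk
    obtain ⟨n, rfl⟩ := hjk k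
    rw [hj] at hk
    -- Powers of Frobenius fix the three points over the prime field, which only the identity of
    -- `SL(2, 8)` does.
    have hf : ∀ n : Fin 3, (frobeniusPerm ^ (n : ℕ)) ∞ = ∞ ∧
        (frobeniusPerm ^ (n : ℕ)) (0 : F8) = (0 : F8) ∧
        (frobeniusPerm ^ (n : ℕ)) (1 : F8) = (1 : F8) := by decide +kernel
    obtain ⟨f0, f1, f2⟩ := hf n
    rw [← hk] at f0 f1 f2
    have hA : m (e x) = 1 := eq_one_of_moebiusHom f0 f1 f2
    have h1 : frobeniusPerm ^ (n : ℕ) = 1 := by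
      rw [← hk]
      change moebiusHom (m (e x)) = 1
      rw [hA, map_one]
    have : ∀ n : Fin 3, frobeniusPerm ^ (n : ℕ) = 1 → n = 0 := by decide +kernel
    rw [this n h1]
    rfl
  · obtain ⟨x, hx⟩ := hie involution
    refine ⟨Multiplicative.ofAdd ((1 : ℕ) : ZMod 3), x, fun h => ?_⟩
    rw [hj, pow_one, hx, frobeniusPerm_conj] at h
    have h := moebiusHom_injective h
    have : SpecialLinearGroup.map frobenius involution ≠ involution := by decide +kernel
    exact this h
  · have hj1 : j (Multiplicative.ofAdd ((1 : ℕ) : ZMod 3)) = frobeniusPerm := by rw [hj, pow_one]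
    apply le_antisymm
    · refine sup_le ?_ ?_
      · rw [hri, MonoidHom.range_eq_map, Subgroup.map_le_iff_le_comap, top_le_iff]
        refine closure_frobenius_orbit hB fun A hA => ?_
        change moebiusHom _ ∈ H
        rw [← frobeniusPerm_conj]
        exact mul_mem (mul_mem hφ hA) (inv_mem hφ)
      · rintro _ ⟨k, rfl⟩
        obtain ⟨n, rfl⟩ := hjk k
        rw [hj]
        exact pow_mem hφ _
    · refine hH.trans ?_
      rw [Subgroup.closure_le]
      rintro _ (rfl | rfl)
      · exact Subgroup.mem_sup_right ⟨_, hj1⟩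
      · exact Subgroup.mem_sup_left (hri ▸ ⟨_, rfl⟩)

end F8

namespace PlaneTree

theorem nine₁_monodromyGroup : IsSemidirect nine₁.monodromyGroup
    (Matrix.ProjectiveSpecialLinearGroup (Fin 2) (GaloisField 2 3)) (Cyc 3) := by
  let p : Fin 9 → OnePoint F8 := fun k => if k = 6 then OnePoint.infty else
    OnePoint.some (F8.ofFin ((![5, 0, 7, 1, 3, 4, 0, 6, 2] : Fin 9 → Fin 8) k))
  have hp : Function.Bijective p := (Fintype.bijective_iff_injective_and_card p).2
    ⟨by decide +kernel, by decide +kernel⟩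
  have h₀ : F8.frobeniusPerm = (Equiv.ofBijective p hp).permCongr nine₁.σ₀ :=
    permCongr_eq_of_forall hp (by decide +kernel)
  have h₁ : F8.moebiusHom F8.involution = (Equiv.ofBijective p hp).permCongr nine₁.σ₁ :=
    permCongr_eq_of_forall hp (fun k => (F8.moebiusHom_apply _ _).trans (by revert k; decide +kernel))
  refine IsSemidirect.of_mulEquiv (nine₁.monodromyGroupEquiv (Equiv.ofBijective p hp))
    (F8.isSemidirect_of_mem ?_ ?_ ?_) <;> rw [← h₀, ← h₁]
  · exact Subgroup.subset_closure (by simp)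
  · exact Subgroup.subset_closure (by simp)

/-- The black rotation is now the square of Frobenius, with the same involution; it generates the
same group of order three. -/
theorem nine₂_monodromyGroup : IsSemidirect nine₂.monodromyGroup
    (Matrix.ProjectiveSpecialLinearGroup (Fin 2) (GaloisField 2 3)) (Cyc 3) := by
  let p : Fin 9 → OnePoint F8 := fun k => if k = 7 then OnePoint.infty else
    OnePoint.some (F8.ofFin ((![7, 1, 5, 0, 3, 6, 4, 0, 2] : Fin 9 → Fin 8) k))
  have hp : Function.Bijective p := (Fintype.bijective_iff_injective_and_card p).2
    ⟨by decide +kernel, by decide +kernel⟩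
  have h₀ : F8.frobeniusPerm ^ 2 = (Equiv.ofBijective p hp).permCongr nine₂.σ₀ :=
    permCongr_eq_of_forall hp (by decide +kernel)
  have h₁ : F8.moebiusHom F8.involution = (Equiv.ofBijective p hp).permCongr nine₂.σ₁ :=
    permCongr_eq_of_forall hp (fun k => (F8.moebiusHom_apply _ _).trans (by revert k; decide +kernel))
  refine IsSemidirect.of_mulEquiv (nine₂.monodromyGroupEquiv (Equiv.ofBijective p hp))
    (F8.isSemidirect_of_mem ?_ ?_ ?_) <;> rw [← h₀, ← h₁]
  · have : F8.frobeniusPerm = (F8.frobeniusPerm ^ 2) ^ 2 := by decide +kernel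
    have h2 : (F8.frobeniusPerm ^ 2) ^ 2 ∈
        Subgroup.closure {F8.frobeniusPerm ^ 2, F8.moebiusHom F8.involution} :=
      pow_mem (Subgroup.subset_closure (Set.mem_insert _ _)) 2
    rwa [← this] at h2
  · exact Subgroup.subset_closure (by simp)
  · rw [Subgroup.closure_le]
    rintro _ (rfl | rfl)
    · exact pow_mem (Subgroup.subset_closure (by simp)) 2
    · exact Subgroup.subset_closure (by simp)

end PlaneTree

/-! ### Isomorphisms from equivariant maps -/

namespace PlaneTree

/-- A family of edges closed under both rotations contains all the edges, if any. -/
theorem forall_of_closed {n : ℕ} (T : PlaneTree n) (p : Fin n → Prop)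
    (h₀ : ∀ x, p x → p (T.σ₀ x)) (h₁ : ∀ x, p x → p (T.σ₁ x)) (hp : ∃ x, p x) (x : Fin n) :
    p x := by
  have hinv : ∀ σ : Perm (Fin n), (∀ x, p x → p (σ x)) → ∀ x, p (σ x) ↔ p x := by
    intro σ hσ x
    refine ⟨fun h => ?_, hσ x⟩
    have hm : ∀ k : ℕ, ∀ y, p y → p ((σ ^ k) y) := by
      intro k
      induction k with
      | zero => exact fun y hy => hy
      | succ k ih => exact fun y hy => by rw [pow_succ, Perm.mul_apply]; exact ih _ (hσ _ hy)
    have ho := orderOf_pos σ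
    have := hm (orderOf σ - 1) _ h
    rwa [← Perm.mul_apply, ← pow_succ, Nat.sub_add_cancel ho, pow_orderOf_eq_one] at this
  obtain ⟨y, hy⟩ := hp
  have := T.connected
  obtain ⟨⟨g, hg⟩, rfl⟩ := MulAction.exists_smul_eq (Subgroup.closure {T.σ₀, T.σ₁}) y x
  have key : ∀ z, p (g z) ↔ p z := by
    induction hg using Subgroup.closure_induction with
    | mem σ hσ =>
      rcases hσ with rfl | rfl
      exacts [hinv _ h₀, hinv _ h₁]
    | one => exact fun z => Iff.rfl
    | mul σ τ _ _ hσ hτ => exact fun z => by rw [Perm.mul_apply, hσ, hτ]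
    | inv σ _ hσ => exact fun z => by rw [← hσ (σ⁻¹ z)]; simp
  exact (key y).2 hy

/-- The image of `f` is closed under both rotations of `T`, hence is everything; on a finite set a
surjection is a bijection. -/
theorem iso_of_equivariant {n : ℕ} {T T' : PlaneTree n} (f : Fin n → Fin n)
    (h₀ : ∀ x, f (T'.σ₀ x) = T.σ₀ (f x)) (h₁ : ∀ x, f (T'.σ₁ x) = T.σ₁ (f x)) (x : Fin n) :
    T.Iso T' := by
  have hs : Function.Surjective f := T.forall_of_closed (fun y => ∃ z, f z = y)
    (by rintro _ ⟨z, rfl⟩; exact ⟨_, h₀ z⟩) (by rintro _ ⟨z, rfl⟩; exact ⟨_, h₁ z⟩) ⟨f x, x, rfl⟩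
  let e : Perm (Fin n) := Equiv.ofBijective f ⟨Finite.injective_iff_surjective.2 hs, hs⟩
  have he : ∀ z, e z = f z := fun z => rfl
  refine ⟨e⁻¹, ?_, ?_⟩ <;> ext z : 1 <;>
    rw [inv_inv, Perm.mul_apply, Perm.mul_apply, Perm.inv_eq_iff_eq, he, he]
  · exact (h₀ z).symm
  · exact (h₁ z).symm

/-- A tree can be relabelled so that its black rotation becomes a given one. -/
theorem exists_standard_form {n : ℕ} {S T : PlaneTree n}
    (h₀ : T.σ₀.partition.parts = S.σ₀.partition.parts)
    (h₁ : T.σ₁.partition.parts = S.σ₁.partition.parts) :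
    ∃ ι : Perm (Fin n), IsConj S.σ₁ ι ∧
      (∀ p : Fin n → Prop, (∀ x, p x → p (S.σ₀ x)) → (∀ x, p x → p (ι x)) → (∃ x, p x) →
        ∀ x, p x) ∧
      ∀ (S' : PlaneTree n) (f : Fin n → Fin n), (∀ x, f (S'.σ₀ x) = S.σ₀ (f x)) →
        (∀ x, f (S'.σ₁ x) = ι (f x)) → Fin n → T.Iso S' := by
  obtain ⟨τ, hτ⟩ := isConj_iff.1 (Perm.partition_eq_of_isConj.2 (Nat.Partition.ext h₀.symm))
  have hτ' : ∀ x, T.σ₀ (τ x) = τ (S.σ₀ x) := fun x => by rw [← hτ]; simp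
  refine ⟨τ⁻¹ * T.σ₁ * τ, ?_, ?_, ?_⟩
  · refine (Perm.partition_eq_of_isConj.2 (Nat.Partition.ext h₁.symm)).trans ?_
    exact isConj_iff.2 ⟨τ⁻¹, by rw [inv_inv]⟩
  · intro p hp₀ hp₁ ⟨y, hy⟩ x
    have := T.forall_of_closed (fun z => p (τ⁻¹ z)) (fun z hz => ?_) (fun z hz => ?_)
      ⟨τ y, by simpa using hy⟩ (τ x)
    · simpa using this
    · have := hp₀ _ hz
      rwa [show S.σ₀ (τ⁻¹ z) = τ⁻¹ (T.σ₀ z) by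
        rw [Perm.eq_inv_iff_eq, ← hτ']; simp] at this
    · simpa using hp₁ _ hz
  · intro S' f hf₀ hf₁ x
    refine iso_of_equivariant (τ ∘ f) (fun z => ?_) (fun z => ?_) x
    · simp only [Function.comp_apply, hf₀, hτ']
    · simp [hf₁]

end PlaneTree

/-! ### Reconstructing a tree from its big black vertices -/

section Table

variable {n : ℕ}

/-- The edge reached from one of three base edges by turning around its black vertex. -/
def turn (s : Perm (Fin n)) (P : Fin 3 → Fin n) (q : Fin 3 × ℕ) : Fin n := (s ^ q.2) (P q.1)

/-- `tab` describes the tree `(s₀, s₁)` in terms of its big black vertices, of degrees `L`, whose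
edges are numbered from a base edge; `inner` lists the white vertices joining big black vertices.
The other white vertices have degree one or lead to a black vertex of degree one, according to
`leafless`. -/
def IsTable (s₀ s₁ : Perm (Fin n)) (L : Fin 3 → ℕ) (inner : List ((Fin 3 × ℕ) × (Fin 3 × ℕ)))
    (leafless : Bool) (tab : Fin n → Option (Fin 3 × ℕ)) : Prop :=
  ∀ z, match tab z with
    | none => s₀ z = z ∧ tab (s₁ z) ≠ none
    | some q => q.2 < L q.1 ∧ tab (s₀ z) = some (q.1, (q.2 + 1) % L q.1) ∧
        ((∃ r ∈ inner, r.1 = q ∧ tab (s₁ z) = some r.2) ∨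
          (q ∉ inner.map Prod.fst ∧ if leafless then s₁ z = z else tab (s₁ z) = none))

instance (s₀ s₁ : Perm (Fin n)) (L inner leafless tab) :
    Decidable (IsTable s₀ s₁ L inner leafless tab) :=
  @Fintype.decidableForallFintype _ _ (fun z => by
    cases tab z <;> exact inferInstance) _

theorem exists_equivariant_of_isTable {s ι s₀ s₁ : Perm (Fin n)} {P : Fin 3 → Fin n}
    {L : Fin 3 → ℕ} {inner leafless tab} (hι : ∀ z, ι (ι z) = z) (hs₁ : ∀ z, s₁ (s₁ z) = z)
    (htab : IsTable s₀ s₁ L inner leafless tab) (hL : ∀ c, (s ^ L c) (P c) = P c)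
    (hinner : ∀ r ∈ inner, ι (turn s P r.1) = turn s P r.2)
    (hleaf : ∀ q : Fin 3 × ℕ, q.2 < L q.1 → q ∉ inner.map Prod.fst →
      if leafless then ι (turn s P q) = turn s P q else s (ι (turn s P q)) = ι (turn s P q)) :
    ∃ f : Fin n → Fin n, (∀ x, f (s₀ x) = s (f x)) ∧ ∀ x, f (s₁ x) = ι (f x) := by
  rcases isEmpty_or_nonempty (Fin n) with h | ⟨⟨x₀⟩⟩
  · exact ⟨id, fun x => isEmptyElim x, fun x => isEmptyElim x⟩
  let g : Option (Fin 3 × ℕ) → Fin n := fun o => o.elim x₀ (turn s P)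
  -- An edge at a big vertex goes to the edge at the same position, counted from the base edge; an
  -- edge at a black leaf is reached across its white vertex.
  let f : Fin n → Fin n := fun z => if tab z = none then ι (g (tab (s₁ z))) else g (tab z)
  have hnone : ∀ z, tab z = none → s₀ z = z ∧ tab (s₁ z) ≠ none ∧ f z = ι (f (s₁ z)) := by
    intro z hz
    have := htab z
    rw [hz] at this
    refine ⟨this.1, this.2, ?_⟩
    simp only [f, if_pos hz, if_neg this.2]
  have hsome : ∀ z q, tab z = some q → f z = turn s P q := by
    intro z q hz
    simp only [f, hz, if_neg (Option.some_ne_none q)]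
    rfl
  have htabs : ∀ z q, tab z = some q → q.2 < L q.1 ∧
      tab (s₀ z) = some (q.1, (q.2 + 1) % L q.1) ∧
        ((∃ r ∈ inner, r.1 = q ∧ tab (s₁ z) = some r.2) ∨
          (q ∉ inner.map Prod.fst ∧ if leafless then s₁ z = z else tab (s₁ z) = none)) := by
    intro z q hz
    have := htab z
    rwa [hz] at this
  refine ⟨f, fun z => ?_, fun z => ?_⟩
  · rcases hz : tab z with _ | q
    · obtain ⟨h0, h1, h2⟩ := hnone z hz
      obtain ⟨q, hq⟩ := Option.ne_none_iff_exists'.1 h1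
      have h3 := (htabs _ q hq).2.2
      rw [hs₁] at h3
      rcases h3 with ⟨r, -, -, h⟩ | ⟨hq', h⟩
      · rw [hz] at h; exact absurd h (by simp)
      · have := hleaf q (htabs _ q hq).1 hq'
        cases leafless with
        | true => simp only [if_true] at h; rw [h, hq] at hz; exact absurd hz (by simp)
        | false =>
          simp only [Bool.false_eq_true, if_false] at this
          rw [h0, h2, hsome _ q hq, this]
    · obtain ⟨hlt, h, -⟩ := htabs z q hz
      rw [hsome z q hz, hsome _ _ h]
      change (s ^ ((q.2 + 1) % L q.1)) (P q.1) = s ((s ^ q.2) (P q.1))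
      rw [← Perm.mul_apply, ← pow_succ']
      rcases Nat.lt_or_ge (q.2 + 1) (L q.1) with h' | h'
      · rw [Nat.mod_eq_of_lt h']
      · have : q.2 + 1 = L q.1 := by omega
        rw [this, Nat.mod_self, hL]; rfl
  · rcases hz : tab z with _ | q
    · rw [(hnone z hz).2.2, hι]
    · obtain ⟨hlt, -, ⟨r, hr, rfl, h⟩ | ⟨hq, h⟩⟩ := htabs z q hz
      · rw [hsome z _ hz, hsome _ _ h, hinner r hr]
      · have := hleaf q hlt hq
        cases leafless with
        | true => simp only [if_true] at this h; rw [h, hsome z q hz, this]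
        | false =>
          simp only [Bool.false_eq_true, if_false] at h
          rw [(hnone _ h).2.2, hs₁]

end Table

/-! ### Three big black vertices: the centre and its angle -/

section Colours

variable {n : ℕ}

/-- The edges are coloured: colours `0, 1, 2` for the big black vertices, `3` for the edges fixed by
the black rotation. -/
structure IsColouring (s : Perm (Fin n)) (col : Fin n → Fin 4) : Prop where
  apply : ∀ x, col (s x) = col x
  fixed : ∀ x, col x = 3 → s x = x

instance (s : Perm (Fin n)) (col) : Decidable (IsColouring s col) :=
  decidable_of_iff ((∀ x, col (s x) = col x) ∧ ∀ x, col x = 3 → s x = x)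
    ⟨fun h => ⟨h.1, h.2⟩, fun h => ⟨h.1, h.2⟩⟩

variable {s ι : Perm (Fin n)} {col : Fin n → Fin 4}

/-- Every big black vertex is joined to another one. -/
theorem exists_leaving (hs : IsColouring s col) (hι : ∀ x, ι (ι x) = x)
    (ind : ∀ p : Fin n → Prop, (∀ x, p x → p (s x)) → (∀ x, p x → p (ι x)) → (∃ x, p x) →
      ∀ x, p x) {i j : Fin 4} (hij : i ≠ j) (hj : j ≠ 3) (hei : ∃ x, col x = i)
    (hej : ∃ x, col x = j) : ∃ x, col x = i ∧ col (ι x) ≠ i ∧ col (ι x) ≠ 3 := by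
  by_contra! hcon
  -- If vertex `i` were joined only to leaves and to itself, these edges would be closed under both
  -- rotations, leaving no room for vertex `j`.
  have hall : ∀ x, col x = i ∨ col (ι x) = i := by
    refine ind _ ?_ ?_ ?_
    · rintro x (hx | hx)
      · exact Or.inl ((hs.apply x).trans hx)
      · by_cases hxi : col x = i
        · exact Or.inl ((hs.apply x).trans hxi)
        · have := hcon (ι x) hx (by rwa [hι])
          rw [hι] at this
          rw [hs.fixed x this]
          exact Or.inr hx
    · rintro x (hx | hx)
      · exact Or.inr (by rwa [hι])
      · exact Or.inl hx
    · obtain ⟨x, hx⟩ := hei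
      exact ⟨x, Or.inl hx⟩
  obtain ⟨y, hy⟩ := hej
  rcases hall y with h | h
  · exact hij (h.symm.trans hy)
  · have := hcon (ι y) h (by rw [hι, hy]; exact hij.symm)
    rw [hι, hy] at this
    exact hj this

/-- Two edges of the same big black vertex lead to the two other ones. -/
structure IsCentre (ι : Perm (Fin n)) (col : Fin n → Fin 4) (x y : Fin n) : Prop where
  eq : col x = col y
  ne_left : col (ι x) ≠ col x
  ne_right : col (ι y) ≠ col x
  ne : col (ι x) ≠ col (ι y)
  big : col x ≠ 3
  big_left : col (ι x) ≠ 3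
  big_right : col (ι y) ≠ 3

/-- Follow an edge from vertex 0 to another big vertex; the third vertex is also joined to one of
these two, and that one is a centre. -/
theorem exists_isCentre (hs : IsColouring s col) (hι : ∀ x, ι (ι x) = x)
    (ind : ∀ p : Fin n → Prop, (∀ x, p x → p (s x)) → (∀ x, p x → p (ι x)) → (∃ x, p x) →
      ∀ x, p x) (h0 : ∃ x, col x = 0) (h1 : ∃ x, col x = 1) (h2 : ∃ x, col x = 2) :
    ∃ x y, IsCentre ι col x y := by
  obtain ⟨x, hx, hx', hx3⟩ := exists_leaving hs hι ind (i := 0) (j := 1) (by decide) (by decide) h0 h1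
  obtain ⟨y, hy, hy', hy3⟩ := exists_leaving hs hι ind (i := 1) (j := 0) (by decide) (by decide) h1 h0
  obtain ⟨z, hz, hz', hz3⟩ := exists_leaving hs hι ind (i := 2) (j := 0) (by decide) (by decide) h2 h0
  have hc : ∀ c : Fin 4, c = 0 ∨ c = 1 ∨ c = 2 ∨ c = 3 := by decide
  rcases hc (col (ι x)) with h | h | h | h
  · exact absurd h hx'
  · rcases hc (col (ι z)) with k | k | k | k
    · exact ⟨x, ι z, by constructor <;> simp [hι, hx, hz, h, k]⟩
    · exact ⟨ι x, ι z, by constructor <;> simp [hι, hx, hz, h, k]⟩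
    · exact absurd k hz'
    · exact absurd k hz3
  · rcases hc (col (ι y)) with k | k | k | k
    · exact ⟨x, ι y, by constructor <;> simp [hι, hx, hy, h, k]⟩
    · exact absurd k hy'
    · exact ⟨ι x, ι y, by constructor <;> simp [hι, hx, hy, h, k]⟩
    · exact absurd k hy3
  · exact absurd h hx3

/-- The four edges at the two joining white vertices are distinct and lie in `I`, so they exhaust
it. -/
theorem IsCentre.mem_of_card_le (hι : ∀ x, ι (ι x) = x) {x y : Fin n} (h : IsCentre ι col x y)
    {I : Finset (Fin n)} (hI : I.card ≤ 4)
    (hmem : ∀ z, col z ≠ 3 → col (ι z) ≠ 3 → col (ι z) ≠ col z → z ∈ I) (z : Fin n) (hz : z ∈ I) :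
    z = x ∨ z = y ∨ z = ι x ∨ z = ι y := by
  have hxy : x ≠ y := fun e => h.ne (by rw [e])
  have h1 : x ≠ ι x := fun e => h.ne_left (by rw [← e])
  have h2 : x ≠ ι y := fun e => h.ne_right (by rw [← e])
  have h3 : y ≠ ι x := fun e => h.ne_left (by rw [← e, h.eq])
  have h4 : y ≠ ι y := fun e => h.ne_right (by rw [← e, h.eq])
  have h5 : ι x ≠ ι y := fun e => h.ne (by rw [e])
  have hsub : ({x, y, ι x, ι y} : Finset (Fin n)) ⊆ I := by
    intro w hw
    simp only [Finset.mem_insert, Finset.mem_singleton] at hw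
    rcases hw with rfl | rfl | rfl | rfl
    · exact hmem _ h.big h.big_left h.ne_left
    · exact hmem _ (h.eq ▸ h.big) h.big_right (h.eq ▸ h.ne_right)
    · exact hmem _ h.big_left (by rw [hι]; exact h.big) (by rw [hι]; exact h.ne_left.symm)
    · exact hmem _ h.big_right (by rw [hι]; exact h.eq ▸ h.big)
        (by rw [hι]; exact h.eq ▸ h.ne_right.symm)
  have hcard : ({x, y, ι x, ι y} : Finset (Fin n)).card = 4 := by
    rw [Finset.card_insert_of_notMem (by simp [hxy, h1, h2]),
      Finset.card_insert_of_notMem (by simp [h3, h4]), Finset.card_pair h5]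
  have := Finset.eq_of_subset_of_card_le hsub (by omega)
  rw [← this] at hz
  simpa using hz

/-- The white vertices of a centre, in terms of the numbering from its base edges. -/
def centreInner (k : ℕ) : List ((Fin 3 × ℕ) × (Fin 3 × ℕ)) :=
  [((0, 0), (1, 0)), ((1, 0), (0, 0)), ((0, k), (2, 0)), ((2, 0), (0, k))]

/-- `ℓ` gives the lengths of the coloured cycles. -/
def IsLength (s : Perm (Fin n)) (col : Fin n → Fin 4) (ℓ : Fin 4 → ℕ) : Prop :=
  ∀ x, col x ≠ 3 → (s ^ ℓ (col x)) x = x ∧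
    (∀ e : Fin (ℓ (col x)), (s ^ (e : ℕ)) x = x → (e : ℕ) = 0) ∧
    ∀ y, col y = col x → ∃ e : Fin (ℓ (col x)), (s ^ (e : ℕ)) x = y

instance (s : Perm (Fin n)) (col) (ℓ : Fin 4 → ℕ) : Decidable (IsLength s col ℓ) :=
  inferInstanceAs (Decidable (∀ _, _))

theorem IsColouring.pow_apply (hs : IsColouring s col) (k : ℕ) (x : Fin n) :
    col ((s ^ k) x) = col x := by
  induction k with
  | zero => rfl
  | succ k ih => rw [pow_succ', Perm.mul_apply, hs.apply, ih]

theorem IsLength.eq_of_pow_eq {ℓ : Fin 4 → ℕ} (hℓ : IsLength s col ℓ) {x : Fin n} (hx : col x ≠ 3)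
    {e e' : ℕ} (he : e < ℓ (col x)) (he' : e' < ℓ (col x)) (h : (s ^ e) x = (s ^ e') x) : e = e' := by
  wlog hle : e ≤ e' generalizing e e'
  · exact (this he' he h.symm (le_of_not_ge hle)).symm
  obtain ⟨d, rfl⟩ := Nat.exists_eq_add_of_le hle
  rw [pow_add, Perm.mul_apply] at h
  have := (hℓ x hx).2.1 ⟨d, by omega⟩ ((s ^ e).injective h).symm
  simp only at this
  omega

theorem exists_equivariant_of_isCentre {ℓ : Fin 4 → ℕ} (hs : IsColouring s col)
    (hℓ : IsLength s col ℓ) (hι : ∀ x, ι (ι x) = x) {x y : Fin n} (h : IsCentre ι col x y)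
    (leafless : Bool)
    (hleaf : ∀ z, col z ≠ 3 → z = x ∨ z = y ∨ z = ι x ∨ z = ι y ∨
      if leafless then ι z = z else col (ι z) = 3) :
    ∃ k < ℓ (col x), k ≠ 0 ∧ ∀ (s₀ s₁ : Perm (Fin n)) (tab), (∀ z, s₁ (s₁ z) = z) →
      IsTable s₀ s₁ ![ℓ (col x), ℓ (col (ι x)), ℓ (col (ι y))] (centreInner k) leafless tab →
      ∃ f : Fin n → Fin n, (∀ x, f (s₀ x) = s (f x)) ∧ ∀ x, f (s₁ x) = ι (f x) := by
  -- The angle: the number of turns around the centre from `x` to `y`.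
  obtain ⟨k, hk⟩ := (hℓ x h.big).2.2 y h.eq.symm
  refine ⟨k, k.2, fun hk0 => ?_, fun s₀ s₁ tab hs₁ htab =>
    exists_equivariant_of_isTable (P := ![x, ι x, ι y]) hι hs₁ htab ?_ ?_ ?_⟩
  · rw [hk0, pow_zero, Perm.one_apply] at hk
    exact h.ne (by rw [hk])
  · intro c
    fin_cases c
    exacts [(hℓ x h.big).1, (hℓ _ h.big_left).1, (hℓ _ h.big_right).1]
  · intro r hr
    simp only [centreInner, List.mem_cons, List.not_mem_nil, or_false] at hr
    rcases hr with rfl | rfl | rfl | rfl <;> simp [turn, hι, hk]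
  · rintro ⟨c, e⟩ he hq
    have hval : turn s ![x, ι x, ι y] (c, e) = (s ^ e) (![x, ι x, ι y] c) := rfl
    have hcol : col (turn s ![x, ι x, ι y] (c, e)) = col (![x, ι x, ι y] c) :=
      hs.pow_apply e _
    have hbig : col (turn s ![x, ι x, ι y] (c, e)) ≠ 3 := by
      rw [hcol]
      fin_cases c
      exacts [h.big, h.big_left, h.big_right]
    -- Colours separate the three vertices, and uniqueness of the exponent separates positions at
    -- one vertex; so unlisted positions are not joining edges.
    have hne : ¬ (turn s ![x, ι x, ι y] (c, e) = x ∨ turn s ![x, ι x, ι y] (c, e) = y ∨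
        turn s ![x, ι x, ι y] (c, e) = ι x ∨ turn s ![x, ι x, ι y] (c, e) = ι y) := by
      have z1 : ∀ w, col w ≠ 3 → e < ℓ (col w) → (s ^ e) w = w → e = 0 := fun w hw he' hew =>
        hℓ.eq_of_pow_eq hw he' (by omega) (by simpa using hew)
      have hex := h.eq
      have n1 := h.ne_left
      have n2 := h.ne_right
      have n3 := h.ne
      simp only [centreInner, List.map_cons, List.map_nil, List.mem_cons, Prod.mk.injEq,
        List.not_mem_nil, or_false, not_or, not_and] at hq
      obtain ⟨q1, q2, q3, q4⟩ := hq
      rintro (e1 | e1 | e1 | e1) <;> rw [e1] at hcol <;> rw [hval] at e1 <;> fin_cases c <;>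
        simp only [Fin.zero_eta, Fin.mk_one, Fin.reduceFinMk, Matrix.cons_val_zero,
          Matrix.cons_val_one, Matrix.cons_val] at hcol e1 he q1 q2 q3 q4
      · exact q1 trivial (z1 _ h.big he e1)
      · exact n1 hcol.symm
      · exact n2 hcol.symm
      · rw [← hk] at e1
        exact q3 trivial (hℓ.eq_of_pow_eq h.big he k.2 e1)
      · exact n1 (hcol.symm.trans hex.symm)
      · exact n2 (hcol.symm.trans hex.symm)
      · exact n1 hcol
      · exact q2 trivial (z1 _ h.big_left he e1)
      · exact n3 hcol
      · exact n2 hcol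
      · exact n3 hcol.symm
      · exact q4 trivial (z1 _ h.big_right he e1)
    rcases hleaf _ hbig with h' | h' | h' | h' | h'
    · exact absurd (Or.inl h') hne
    · exact absurd (Or.inr (Or.inl h')) hne
    · exact absurd (Or.inr (Or.inr (Or.inl h'))) hne
    · exact absurd (Or.inr (Or.inr (Or.inr h'))) hne
    · cases leafless with
      | true => simpa using h'
      | false =>
        simp only [Bool.false_eq_true, if_false] at h' ⊢
        exact hs.fixed _ h'

/-- The number of edges of big black vertices that do not lead to a black vertex of degree one. -/
theorem card_inner (hs : IsColouring s col) (hι : ∀ x, ι (ι x) = x)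
    (ind : ∀ p : Fin n → Prop, (∀ x, p x → p (s x)) → (∀ x, p x → p (ι x)) → (∃ x, p x) →
      ∀ x, p x) (h0 : ∃ x, col x ≠ 3) :
    (Finset.univ.filter fun z => col z ≠ 3 ∧ col (ι z) ≠ 3).card +
      (Finset.univ.filter fun z => col z = 3).card =
        (Finset.univ.filter fun z => col z ≠ 3).card := by
  -- Two leaves joined to each other would be the whole tree.
  have hleaf : ∀ z, col z = 3 → col (ι z) ≠ 3 := by
    intro z hz hz'
    obtain ⟨x, hx⟩ := h0
    have := ind (fun w => w = z ∨ w = ι z)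
      (by rintro w (rfl | rfl); exacts [Or.inl (hs.fixed _ hz), Or.inr (hs.fixed _ hz')])
      (by rintro w (rfl | rfl); exacts [Or.inr rfl, Or.inl (hι _)]) ⟨z, Or.inl rfl⟩ x
    rcases this with rfl | rfl
    exacts [hx hz, hx hz']
  have himg : (Finset.univ.filter fun z => col z = 3).card =
      (Finset.univ.filter fun z => col z ≠ 3 ∧ col (ι z) = 3).card := by
    refine Finset.card_bij (fun z _ => ι z) ?_ (fun _ _ _ _ e => ι.injective e) ?_
    · intro z hz
      simp only [Finset.mem_filter, Finset.mem_univ, true_and] at hz ⊢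
      exact ⟨hleaf z hz, by rwa [hι]⟩
    · intro z hz
      simp only [Finset.mem_filter, Finset.mem_univ, true_and] at hz
      exact ⟨ι z, by simpa using hz.2, hι z⟩
  rw [himg, ← Finset.card_union_of_disjoint]
  · congr 1
    ext z
    simp only [Finset.mem_union, Finset.mem_filter, Finset.mem_univ, true_and]
    tauto
  · rw [Finset.disjoint_filter]
    rintro z - ⟨-, h⟩ ⟨-, h'⟩
    exact h h'

end Colours

/-! ### Classification for three big black vertices -/

namespace PlaneTree

theorem apply_apply_of_isConj {α : Type*} {σ ι : Perm α} (h : IsConj σ ι)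
    (hσ : ∀ x, σ (σ x) = x) (x : α) : ι (ι x) = x := by
  obtain ⟨c, rfl⟩ := isConj_iff.1 h
  simp [hσ]

/-- A tree whose black vertices of degree greater than one (or, if `leafless`, all of whose black
vertices) are three in number is determined by the degrees of these vertices and the angle at the
central one. -/
theorem exists_centre_form {n : ℕ} {S T : PlaneTree n}
    (h₀ : T.σ₀.partition.parts = S.σ₀.partition.parts)
    (h₁ : T.σ₁.partition.parts = S.σ₁.partition.parts) (hinv : ∀ z, S.σ₁ (S.σ₁ z) = z)
    {col : Fin n → Fin 4} {ℓ : Fin 4 → ℕ} (hs : IsColouring S.σ₀ col) (hℓ : IsLength S.σ₀ col ℓ)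
    (hsurj : ∀ c : Fin 4, c ≠ 3 → ∃ x, col x = c) (leafless : Bool)
    (hcard : if leafless then S.σ₁.support.card = 4 else
      (Finset.univ.filter fun z => col z ≠ 3).card =
        4 + (Finset.univ.filter fun z => col z = 3).card) :
    ∃ a b c : Fin 4, (a ≠ b ∧ a ≠ c ∧ b ≠ c ∧ a ≠ 3 ∧ b ≠ 3 ∧ c ≠ 3) ∧ ∃ k < ℓ a, k ≠ 0 ∧
      ∀ (S' : PlaneTree n) (tab), (∀ z, S'.σ₁ (S'.σ₁ z) = z) →
        IsTable S'.σ₀ S'.σ₁ ![ℓ a, ℓ b, ℓ c] (centreInner k) leafless tab → T.Iso S' := by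
  obtain ⟨ι, hconj, ind, hiso⟩ := exists_standard_form h₀ h₁
  have hι := apply_apply_of_isConj hconj hinv
  obtain ⟨x, y, h⟩ := exists_isCentre hs hι ind (hsurj 0 (by decide)) (hsurj 1 (by decide))
    (hsurj 2 (by decide))
  obtain ⟨k, hk, hk0, hf⟩ := exists_equivariant_of_isCentre hs hℓ hι h leafless (by
    intro z hz
    cases leafless with
    | true =>
      simp only [if_true] at hcard ⊢
      have hI : ι.support.card ≤ 4 := by
        obtain ⟨c, rfl⟩ := isConj_iff.1 hconj
        rw [Perm.card_support_conj, hcard]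
      have := h.mem_of_card_le hι hI (fun z _ _ hne => Perm.mem_support.2
        fun e => hne (by rw [e])) z
      rw [Perm.mem_support] at this
      tauto
    | false =>
      simp only [Bool.false_eq_true, if_false] at hcard ⊢
      have hc := card_inner hs hι ind ⟨x, h.big⟩
      have := h.mem_of_card_le hι (I := Finset.univ.filter fun z => col z ≠ 3 ∧ col (ι z) ≠ 3)
        (by omega) (fun z h1 h2 _ => by simp [h1, h2]) z
      simp only [Finset.mem_filter, Finset.mem_univ, true_and] at this
      tauto)
  refine ⟨col x, col (ι x), col (ι y), ⟨h.ne_left.symm, h.ne_right.symm, h.ne, h.big, h.big_left,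
    h.big_right⟩, k, hk, hk0, fun S' tab hS' htab => ?_⟩
  obtain ⟨f, hf₀, hf₁⟩ := hf _ _ tab hS' htab
  exact hiso S' f hf₀ hf₁ x

theorem seven₁_or_seven₂ (T : PlaneTree 7) (hT : T.HasPassport {3, 3, 1} {2, 2, 1, 1, 1}) :
    T.Iso seven₁ ∨ T.Iso seven₂ := by
  obtain ⟨a, b, c, habc, k, hk, hk0, h⟩ := exists_centre_form (S := seven₁) (T := T)
    (col := ![0, 2, 0, 1, 1, 1, 0]) (ℓ := ![3, 3, 1, 0])
    (hT.1.trans seven₁_parts.symm) (hT.2.trans seven₁_parts'.symm) (by decide +kernel)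
    (by decide +kernel) (by decide +kernel) (by decide +kernel) true (by decide +kernel)
  -- A centre of degree 1 admits no angle. In the other two cases `k` is 1 or 2, and reading the
  -- path backwards exchanges the cases and replaces `k` by `3 - k`: two trees remain.
  have hL : ∀ a b c : Fin 4, (a ≠ b ∧ a ≠ c ∧ b ≠ c ∧ a ≠ 3 ∧ b ≠ 3 ∧ c ≠ 3) →
      (![3, 3, 1, 0] a = 1 ∧ ![3, 3, 1, 0] b = 3 ∧ ![3, 3, 1, 0] c = 3) ∨
      (![3, 3, 1, 0] a = 3 ∧ ![3, 3, 1, 0] b = 1 ∧ ![3, 3, 1, 0] c = 3) ∨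
      (![3, 3, 1, 0] a = 3 ∧ ![3, 3, 1, 0] b = 3 ∧ ![3, 3, 1, 0] c = 1) := by decide
  rcases hL a b c habc with ⟨e₁, e₂, e₃⟩ | ⟨e₁, e₂, e₃⟩ | ⟨e₁, e₂, e₃⟩ <;>
    rw [e₁] at hk <;> rw [e₁, e₂, e₃] at h <;> interval_cases k <;> try exact absurd rfl hk0
  · exact Or.inl (h seven₁ ![some (0, 0), some (1, 0), some (0, 1), some (2, 1), some (2, 2),
      some (2, 0), some (0, 2)] (by decide +kernel) (by decide +kernel))
  · exact Or.inr (h seven₂ ![some (0, 0), some (1, 0), some (0, 1), some (0, 2), some (2, 1),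
      some (2, 2), some (2, 0)] (by decide +kernel) (by decide +kernel))
  · exact Or.inr (h seven₂ ![some (0, 1), some (2, 0), some (0, 2), some (0, 0), some (1, 1),
      some (1, 2), some (1, 0)] (by decide +kernel) (by decide +kernel))
  · exact Or.inl (h seven₁ ![some (0, 2), some (2, 0), some (0, 0), some (1, 1), some (1, 2),
      some (1, 0), some (0, 1)] (by decide +kernel) (by decide +kernel))

theorem seven₃_or_seven₄ (T : PlaneTree 7) (hT : T.HasPassport {3, 2, 2} {2, 2, 1, 1, 1}) :
    T.Iso seven₃ ∨ T.Iso seven₄ := by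
  obtain ⟨a, b, c, habc, k, hk, hk0, h⟩ := exists_centre_form (S := seven₃) (T := T)
    (col := ![0, 1, 1, 0, 2, 2, 0]) (ℓ := ![3, 2, 2, 0])
    (hT.1.trans seven₃_parts.symm) (hT.2.trans seven₃_parts'.symm) (by decide +kernel)
    (by decide +kernel) (by decide +kernel) (by decide +kernel) true (by decide +kernel)
  -- At a centre of degree 3 the outer degrees agree, so the angles 1 and 2 give the same tree; a
  -- centre of degree 2 has only the angle 1.
  have hL : ∀ a b c : Fin 4, (a ≠ b ∧ a ≠ c ∧ b ≠ c ∧ a ≠ 3 ∧ b ≠ 3 ∧ c ≠ 3) →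
      (![3, 2, 2, 0] a = 3 ∧ ![3, 2, 2, 0] b = 2 ∧ ![3, 2, 2, 0] c = 2) ∨
      (![3, 2, 2, 0] a = 2 ∧ ![3, 2, 2, 0] b = 2 ∧ ![3, 2, 2, 0] c = 3) ∨
      (![3, 2, 2, 0] a = 2 ∧ ![3, 2, 2, 0] b = 3 ∧ ![3, 2, 2, 0] c = 2) := by decide
  rcases hL a b c habc with ⟨e₁, e₂, e₃⟩ | ⟨e₁, e₂, e₃⟩ | ⟨e₁, e₂, e₃⟩ <;>
    rw [e₁] at hk <;> rw [e₁, e₂, e₃] at h <;> interval_cases k <;> try exact absurd rfl hk0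
  · exact Or.inl (h seven₃ ![some (0, 0), some (1, 1), some (1, 0), some (0, 1), some (2, 1),
      some (2, 0), some (0, 2)] (by decide +kernel) (by decide +kernel))
  · exact Or.inl (h seven₃ ![some (0, 2), some (2, 1), some (2, 0), some (0, 0), some (1, 1),
      some (1, 0), some (0, 1)] (by decide +kernel) (by decide +kernel))
  · exact Or.inr (h seven₄ ![some (0, 0), some (1, 1), some (1, 0), some (0, 1), some (2, 1),
      some (2, 2), some (2, 0)] (by decide +kernel) (by decide +kernel))
  · exact Or.inr (h seven₄ ![some (0, 1), some (2, 1), some (2, 0), some (0, 0), some (1, 1),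
      some (1, 2), some (1, 0)] (by decide +kernel) (by decide +kernel))

theorem ten₁_or_ten₂ (T : PlaneTree 10)
    (hT : T.HasPassport {3, 2, 2, 1, 1, 1} {2, 2, 2, 2, 2}) : T.Iso ten₁ ∨ T.Iso ten₂ := by
  obtain ⟨a, b, c, habc, k, hk, hk0, h⟩ := exists_centre_form (S := ten₁) (T := T)
    (col := ![0, 1, 1, 0, 0, 2, 3, 2, 3, 3]) (ℓ := ![3, 2, 2, 0])
    (hT.1.trans ten₁_parts.symm) (hT.2.trans ten₁_parts'.symm) (by decide +kernel)
    (by decide +kernel) (by decide +kernel) (by decide +kernel) false (by decide +kernel)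
  have hL : ∀ a b c : Fin 4, (a ≠ b ∧ a ≠ c ∧ b ≠ c ∧ a ≠ 3 ∧ b ≠ 3 ∧ c ≠ 3) →
      (![3, 2, 2, 0] a = 3 ∧ ![3, 2, 2, 0] b = 2 ∧ ![3, 2, 2, 0] c = 2) ∨
      (![3, 2, 2, 0] a = 2 ∧ ![3, 2, 2, 0] b = 2 ∧ ![3, 2, 2, 0] c = 3) ∨
      (![3, 2, 2, 0] a = 2 ∧ ![3, 2, 2, 0] b = 3 ∧ ![3, 2, 2, 0] c = 2) := by decide
  rcases hL a b c habc with ⟨e₁, e₂, e₃⟩ | ⟨e₁, e₂, e₃⟩ | ⟨e₁, e₂, e₃⟩ <;>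
    rw [e₁] at hk <;> rw [e₁, e₂, e₃] at h <;> interval_cases k <;> try exact absurd rfl hk0
  · exact Or.inr (h ten₂ ![some (0, 0), none, some (0, 1), none, some (0, 2), some (1, 0),
      some (1, 1), some (2, 0), some (2, 1), none] (by decide +kernel) (by decide +kernel))
  · exact Or.inr (h ten₂ ![some (0, 2), none, some (0, 0), none, some (0, 1), some (2, 0),
      some (2, 1), some (1, 0), some (1, 1), none] (by decide +kernel) (by decide +kernel))
  · exact Or.inl (h ten₁ ![some (2, 0), some (1, 1), some (1, 0), some (2, 1), some (2, 2),
      some (0, 1), none, some (0, 0), none, none] (by decide +kernel) (by decide +kernel))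
  · exact Or.inl (h ten₁ ![some (1, 0), some (2, 1), some (2, 0), some (1, 1), some (1, 2),
      some (0, 0), none, some (0, 1), none, none] (by decide +kernel) (by decide +kernel))

theorem twenty₁_or_twenty₂ (T : PlaneTree 20)
    (hT : T.HasPassport (Multiset.replicate 3 4 + Multiset.replicate 8 1)
      (Multiset.replicate 10 2)) : T.Iso twenty₁ ∨ T.Iso twenty₂ := by
  obtain ⟨a, b, c, habc, k, hk, hk0, h⟩ := exists_centre_form (S := twenty₁) (T := T)
    (col := ![0, 3, 3, 3, 0, 0, 3, 3, 3, 0, 1, 1, 1, 1, 3, 2, 2, 2, 2, 3]) (ℓ := fun _ => 4)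
    (hT.1.trans twenty₁_parts.symm) (hT.2.trans twenty₁_parts'.symm) (by decide +kernel)
    (by decide +kernel) (by decide +kernel) (by decide +kernel) false (by decide +kernel)
  -- The angles 1 and 3 differ by the direction in which the path is read; 2 is the symmetric tree.
  interval_cases k
  · exact absurd rfl hk0
  · exact Or.inr (h twenty₂ ![some (0, 0), none, none, none, some (0, 1), none, none, none,
      some (0, 2), some (0, 3), some (1, 0), some (1, 1), some (1, 2), some (1, 3), some (2, 0),
      some (2, 1), some (2, 2), some (2, 3), none, none] (by decide +kernel) (by decide +kernel))
  · exact Or.inl (h twenty₁ ![some (0, 0), none, none, none, some (0, 1), some (0, 2), none, none,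
      none, some (0, 3), some (1, 0), some (1, 1), some (1, 2), some (1, 3), none, some (2, 0),
      some (2, 1), some (2, 2), some (2, 3), none] (by decide +kernel) (by decide +kernel))
  · exact Or.inr (h twenty₂ ![some (0, 3), none, none, none, some (0, 0), none, none, none,
      some (0, 1), some (0, 2), some (2, 0), some (2, 1), some (2, 2), some (2, 3), some (1, 0),
      some (1, 1), some (1, 2), some (1, 3), none, none] (by decide +kernel) (by decide +kernel))

theorem twentySix₁_or_twentySix₂ (T : PlaneTree 26)
    (hT : T.HasPassport (Multiset.replicate 3 5 + Multiset.replicate 11 1)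
      (Multiset.replicate 13 2)) : T.Iso twentySix₁ ∨ T.Iso twentySix₂ := by
  obtain ⟨a, b, c, habc, k, hk, hk0, h⟩ := exists_centre_form (S := twentySix₁) (T := T)
    (col := ![0, 3, 3, 3, 3, 0, 3, 3, 3, 3, 0, 0, 0, 1, 1, 1, 1, 1, 2, 2, 2, 2, 2, 3, 3, 3])
    (ℓ := fun _ => 5)
    (hT.1.trans twentySix₁_parts.symm) (hT.2.trans twentySix₁_parts'.symm) (by decide +kernel)
    (by decide +kernel) (by decide +kernel) (by decide +kernel) false (by decide +kernel)
  interval_cases k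
  · exact absurd rfl hk0
  · exact Or.inl (h twentySix₁ ![some (0, 0), none, none, none, none, some (0, 1), none, none,
      none, none, some (0, 2), some (0, 3), some (0, 4), some (1, 0), some (1, 1), some (1, 2),
      some (1, 3), some (1, 4), some (2, 0), some (2, 1), some (2, 2), some (2, 3), some (2, 4),
      none, none, none] (by decide +kernel) (by decide +kernel))
  · exact Or.inr (h twentySix₂ ![some (0, 0), none, none, none, none, some (0, 1), some (0, 2),
      none, none, none, none, some (0, 3), some (0, 4), some (1, 0), some (1, 1), some (1, 2),
      some (1, 3), some (1, 4), none, some (2, 0), some (2, 1), some (2, 2), some (2, 3),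
      some (2, 4), none, none] (by decide +kernel) (by decide +kernel))
  · exact Or.inr (h twentySix₂ ![some (0, 3), none, none, none, none, some (0, 4), some (0, 0),
      none, none, none, none, some (0, 1), some (0, 2), some (2, 0), some (2, 1), some (2, 2),
      some (2, 3), some (2, 4), none, some (1, 0), some (1, 1), some (1, 2), some (1, 3),
      some (1, 4), none, none] (by decide +kernel) (by decide +kernel))
  · exact Or.inl (h twentySix₁ ![some (0, 4), none, none, none, none, some (0, 0), none, none,
      none, none, some (0, 1), some (0, 2), some (0, 3), some (2, 0), some (2, 1), some (2, 2),
      some (2, 3), some (2, 4), some (1, 0), some (1, 1), some (1, 2), some (1, 3), some (1, 4),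
      none, none, none] (by decide +kernel) (by decide +kernel))

end PlaneTree

/-! ### Classification for nine edges, and non-isomorphism -/

namespace PlaneTree

/-- With two big black vertices, there are two edges of one of them, one leading to the other big
vertex, the other to a white vertex of degree one. -/
theorem exists_fixed_edge {n : ℕ} {s ι : Perm (Fin n)} {col : Fin n → Fin 4}
    (hs : IsColouring s col) (hι : ∀ x, ι (ι x) = x)
    (ind : ∀ p : Fin n → Prop, (∀ x, p x → p (s x)) → (∀ x, p x → p (ι x)) → (∃ x, p x) →
      ∀ x, p x) (h0 : ∃ x, col x = 0) (h1 : ∃ x, col x = 1) (h2 : ∀ x, col x ≠ 2)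
    (hcard : (Finset.univ.filter fun z => col z ≠ 3).card =
        3 + (Finset.univ.filter fun z => col z = 3).card) :
    ∃ x q, col x ≠ 3 ∧ col (ι x) ≠ 3 ∧ col (ι x) ≠ col x ∧ ι q = q ∧ col q = col x ∧
      ∀ z, col z ≠ 3 → z = x ∨ z = ι x ∨ z = q ∨ col (ι z) = 3 := by
  obtain ⟨x, hx, hx', hx3⟩ := exists_leaving hs hι ind (i := 0) (j := 1) (by decide) (by decide) h0 h1
  have hx0 : col x ≠ 3 := by rw [hx]; decide
  have hxι : x ≠ ι x := fun e => hx' (by rw [← e, hx])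
  have hc := card_inner hs hι ind ⟨x, hx0⟩
  let I := Finset.univ.filter fun z => col z ≠ 3 ∧ col (ι z) ≠ 3
  have hI : I.card = 3 := by simp only [I]; omega
  have hsub : ({x, ι x} : Finset (Fin n)) ⊆ I := by
    intro w hw
    simp only [Finset.mem_insert, Finset.mem_singleton] at hw
    rcases hw with rfl | rfl <;> simp [I, hι, hx0, hx3]
  obtain ⟨q, hq⟩ := Finset.card_eq_one.1
    (show (I \ {x, ι x}).card = 1 by rw [Finset.card_sdiff_of_subset hsub, hI, Finset.card_pair hxι])
  have hmem : ∀ z, (col z ≠ 3 ∧ col (ι z) ≠ 3) ∧ z ≠ x ∧ z ≠ ι x ↔ z = q := by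
    intro z
    rw [← Finset.mem_singleton (a := q), ← hq]
    simp [I]
  have hq' := (hmem q).2 rfl
  -- The involution preserves the three-element set `I` and exchanges `x` with `ι x`, so it fixes
  -- the third element.
  have hιq : ι q = q := by
    refine (hmem _).1 ⟨⟨hq'.1.2, by rw [hι]; exact hq'.1.1⟩, fun e => hq'.2.2 ?_,
      fun e => hq'.2.1 (ι.injective e)⟩
    rw [← e, hι]
  have hbig : ∀ z, col z ≠ 3 → z = x ∨ z = ι x ∨ z = q ∨ col (ι z) = 3 := by
    intro z hz
    have := hmem z
    tauto
  have h2' : ∀ c : Fin 4, c ≠ 2 → c ≠ 3 → c = 0 ∨ c = 1 := by decide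
  rcases h2' _ (h2 q) hq'.1.1 with h | h
  · exact ⟨x, q, hx0, hx3, by rwa [hx], hιq, h.trans hx.symm, hbig⟩
  · refine ⟨ι x, q, hx3, by rwa [hι], by rw [hι, hx]; exact fun e => hx' e.symm, hιq, ?_,
      fun z hz => ?_⟩
    · rcases h2' _ (h2 (ι x)) hx3 with h' | h'
      exacts [absurd h' hx', h.trans h'.symm]
    · rw [hι]
      have := hbig z hz
      tauto

theorem nine₁_or_nine₂ (T : PlaneTree 9)
    (hT : T.HasPassport {3, 3, 1, 1, 1} {2, 2, 2, 2, 1}) : T.Iso nine₁ ∨ T.Iso nine₂ := by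
  obtain ⟨ι, hconj, ind, hiso⟩ := exists_standard_form (S := nine₁) (T := T)
    (hT.1.trans nine₁_parts.symm) (hT.2.trans nine₁_parts'.symm)
  have hι := apply_apply_of_isConj hconj (by decide +kernel)
  have hs : IsColouring nine₁.σ₀ ![0, 3, 0, 3, 0, 1, 3, 1, 1] := by decide +kernel
  have hℓ : IsLength nine₁.σ₀ ![0, 3, 0, 3, 0, 1, 3, 1, 1] fun _ => 3 := by decide +kernel
  obtain ⟨x, q, hx, hx', hne, hιq, hq, hbig⟩ := exists_fixed_edge hs hι ind (by decide)
    (by decide) (by decide) (by decide)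
  generalize (![0, 3, 0, 3, 0, 1, 3, 1, 1] : Fin 9 → Fin 4) = col at *
  obtain ⟨k, hk⟩ := (hℓ x hx).2.2 q hq
  have hk0 : (k : ℕ) ≠ 0 := by
    intro e
    rw [e, pow_zero, Perm.one_apply] at hk
    exact hne (by rw [hk, hιq])
  -- There is no third big vertex, so its length is 0 and its base edge arbitrary. The entry `((0,
  -- k), (0, k))` records the white leaf.
  have key : ∀ (S' : PlaneTree 9) (tab), (∀ z, S'.σ₁ (S'.σ₁ z) = z) →
      IsTable S'.σ₀ S'.σ₁ ![3, 3, 0] [((0, 0), (1, 0)), ((1, 0), (0, 0)), ((0, k), (0, k))] false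
        tab → T.Iso S' := by
    intro S' tab hS' htab
    obtain ⟨f, hf₀, hf₁⟩ := exists_equivariant_of_isTable (s := nine₁.σ₀) (ι := ι)
      (P := ![x, ι x, x]) hι hS' htab
      (by
        intro c
        fin_cases c
        exacts [(hℓ x hx).1, (hℓ _ hx').1, rfl])
      (by
        intro r hr
        simp only [List.mem_cons, List.not_mem_nil, or_false] at hr
        rcases hr with rfl | rfl | rfl <;> simp [turn, hι, hk, hιq])
      (by
        rintro ⟨c, e⟩ he hr
        simp only [Bool.false_eq_true, if_false]
        simp only [List.map_cons, List.map_nil, List.mem_cons, Prod.mk.injEq,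
          List.not_mem_nil, or_false, not_or, not_and] at hr
        obtain ⟨r1, r2, r3⟩ := hr
        refine hs.fixed _ ?_
        have hcol := hs.pow_apply e
        fin_cases c
        · change col (ι ((nine₁.σ₀ ^ e) x)) = 3
          rcases hbig ((nine₁.σ₀ ^ e) x) (by rwa [hcol]) with h | h | h | h
          · exact absurd (hℓ.eq_of_pow_eq hx (e' := 0) he (by norm_num) h) (r1 rfl)
          · exact absurd (by rw [← h, hcol]) hne
          · exact absurd (hℓ.eq_of_pow_eq hx he k.2 (h.trans hk.symm)) (r3 rfl)
          · exact h
        · change col (ι ((nine₁.σ₀ ^ e) (ι x))) = 3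
          rcases hbig ((nine₁.σ₀ ^ e) (ι x)) (by rwa [hcol]) with h | h | h | h
          · exact absurd (by rw [← hcol, h]) hne
          · exact absurd (hℓ.eq_of_pow_eq hx' (e' := 0) he (by norm_num) h) (r2 rfl)
          · exact absurd (by rw [← hq, ← h, hcol]) hne
          · exact h
        · exact absurd he (Nat.not_lt_zero _))
    exact hiso S' f hf₀ hf₁ x
  obtain ⟨k, hk3⟩ := k
  simp only at key hk0
  interval_cases k
  · exact absurd rfl hk0
  · exact Or.inr (key nine₂ ![some (1, 1), none, some (1, 2), none, some (1, 0), some (0, 1),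
      some (0, 2), none, some (0, 0)] (by decide +kernel) (by decide +kernel))
  · exact Or.inl (key nine₁ ![some (1, 1), none, some (1, 2), none, some (1, 0), some (0, 1), none,
      some (0, 2), some (0, 0)] (by decide +kernel) (by decide +kernel))

/-- Edge 0 of the first tree is fixed by two words at once, and an equivariant map would carry it to
such an edge of the second. -/
theorem not_iso_seven₁_seven₂ : ¬ seven₁.Iso seven₂ := by
  intro h
  obtain ⟨f, h₀, h₁⟩ := h.exists_equivariant
  have key : ∀ x, ¬ (seven₂.σ₁ (seven₂.σ₀ (seven₂.σ₁ x)) = x ∧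
      seven₂.σ₀ (seven₂.σ₁ (seven₂.σ₀ (seven₂.σ₀ x))) = x) := by decide +kernel
  refine key (f 0) ⟨?_, ?_⟩ <;> simp only [← h₀, ← h₁] <;> refine congrArg f ?_ <;>
    decide +kernel

theorem not_iso_seven₃_seven₄ : ¬ seven₃.Iso seven₄ := by
  intro h
  obtain ⟨f, h₀, h₁⟩ := h.exists_equivariant
  have key : ∀ x, ¬ (seven₄.σ₀ (seven₄.σ₀ (seven₄.σ₀ x)) = x ∧
      seven₄.σ₁ (seven₄.σ₀ (seven₄.σ₁ (seven₄.σ₀ (seven₄.σ₁ x)))) = x) := by decide +kernel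
  refine key (f 0) ⟨?_, ?_⟩ <;> simp only [← h₀, ← h₁] <;> refine congrArg f ?_ <;>
    decide +kernel

theorem not_iso_nine₁_nine₂ : ¬ nine₁.Iso nine₂ := by
  intro h
  obtain ⟨f, h₀, h₁⟩ := h.exists_equivariant
  have key : ∀ x, ¬ (nine₂.σ₁ (nine₂.σ₀ (nine₂.σ₁ x)) = x ∧
      nine₂.σ₀ (nine₂.σ₀ (nine₂.σ₁ (nine₂.σ₀ x))) = x) := by decide +kernel
  refine key (f 5) ⟨?_, ?_⟩ <;> simp only [← h₀, ← h₁] <;> refine congrArg f ?_ <;>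
    decide +kernel

theorem not_iso_ten₁_ten₂ : ¬ ten₁.Iso ten₂ := by
  intro h
  obtain ⟨f, h₀, h₁⟩ := h.exists_equivariant
  have key : ∀ x, ¬ (ten₂.σ₁ (ten₂.σ₀ (ten₂.σ₁ x)) = x ∧
      ten₂.σ₀ (ten₂.σ₁ (ten₂.σ₀ (ten₂.σ₀ (ten₂.σ₁ (ten₂.σ₀ x))))) = x) := by decide +kernel
  refine key (f 1) ⟨?_, ?_⟩ <;> simp only [← h₀, ← h₁] <;> refine congrArg f ?_ <;>
    decide +kernel

/-- Simultaneous conjugation preserves the relations between the rotations. -/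
theorem not_iso_twenty₁_twenty₂ : ¬ twenty₁.Iso twenty₂ := by
  rintro ⟨τ, h₀, h₁⟩
  have h : (twenty₁.σ₀ * twenty₁.σ₀ * twenty₁.σ₁) ^ 8 = 1 := by decide +kernel
  have h' : (twenty₂.σ₀ * twenty₂.σ₀ * twenty₂.σ₁) ^ 8 ≠ 1 := by decide +kernel
  refine h' ?_
  rw [← map_one (MulAut.conj τ), ← h]
  simp only [map_pow, map_mul, MulAut.conj_apply, h₀, h₁]

theorem not_iso_twentySix₁_twentySix₂ : ¬ twentySix₁.Iso twentySix₂ := by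
  rintro ⟨τ, h₀, h₁⟩
  have h : (twentySix₁.σ₀ * twentySix₁.σ₁ * twentySix₁.σ₀ * twentySix₁.σ₁ * twentySix₁.σ₀⁻¹ *
    twentySix₁.σ₁ * twentySix₁.σ₀⁻¹ * twentySix₁.σ₁) ^ 5 = 1 := by decide +kernel
  have h' : (twentySix₂.σ₀ * twentySix₂.σ₁ * twentySix₂.σ₀ * twentySix₂.σ₁ * twentySix₂.σ₀⁻¹ *
    twentySix₂.σ₁ * twentySix₂.σ₀⁻¹ * twentySix₂.σ₁) ^ 5 ≠ 1 := by decide +kernel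
  refine h' ?_
  rw [← map_one (MulAut.conj τ), ← h]
  simp only [map_pow, map_mul, map_inv, MulAut.conj_apply, h₀, h₁]

end PlaneTree

theorem mainTheorem8 :
    -- F₇ = [3², 1; 2², 1³; 7]
    (∃ T₁ T₂ : PlaneTree 7, PlaneTree.IsPair T₁ T₂ {3, 3, 1} {2, 2, 1, 1, 1} ∧
      Nonempty (T₁.monodromyGroup ≃* Matrix.ProjectiveSpecialLinearGroup (Fin 3) (ZMod 2)) ∧
      Nonempty (T₂.monodromyGroup ≃* Matrix.ProjectiveSpecialLinearGroup (Fin 3) (ZMod 2))) ∧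
    -- F₈ = [3, 2²; 2², 1³; 7]
    (∃ T₁ T₂ : PlaneTree 7, PlaneTree.IsPair T₁ T₂ {3, 2, 2} {2, 2, 1, 1, 1} ∧
      Nonempty (T₁.monodromyGroup ≃* alternatingGroup (Fin 7)) ∧
      Nonempty (T₂.monodromyGroup ≃* alternatingGroup (Fin 7))) ∧
    -- F₉ = [3², 1³; 2⁴, 1; 9]
    (∃ T₁ T₂ : PlaneTree 9, PlaneTree.IsPair T₁ T₂ {3, 3, 1, 1, 1} {2, 2, 2, 2, 1} ∧
      IsSemidirect T₁.monodromyGroup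
        (Matrix.ProjectiveSpecialLinearGroup (Fin 2) (GaloisField 2 3)) (Cyc 3) ∧
      IsSemidirect T₂.monodromyGroup
        (Matrix.ProjectiveSpecialLinearGroup (Fin 2) (GaloisField 2 3)) (Cyc 3)) ∧
    -- F₁₀ = [3, 2², 1³; 2⁵; 10]
    (∃ T₁ T₂ : PlaneTree 10, PlaneTree.IsPair T₁ T₂ {3, 2, 2, 1, 1, 1} {2, 2, 2, 2, 2} ∧
      IsSemidirect T₁.monodromyGroup (AltSq 5) (Cyc 2 × Cyc 2) ∧
      IsSemidirect T₂.monodromyGroup (AltSq 5) (Cyc 2)) ∧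
    -- F₁₁ = [4³, 1⁸; 2¹⁰; 20]; `DihedralGroup 4` is the dihedral group of order 8
    (∃ T₁ T₂ : PlaneTree 20, PlaneTree.IsPair T₁ T₂
        (Multiset.replicate 3 4 + Multiset.replicate 8 1) (Multiset.replicate 10 2) ∧
      (∃ ψ : DihedralGroup 4 →* MulAut (AltSq 5), ψ ≠ 1 ∧
        IsSemidirect T₁.monodromyGroup (Fin 8 → Cyc 2) (AltSq 5 ⋊[ψ] DihedralGroup 4)) ∧
      IsSemidirect T₂.monodromyGroup (AltSq 10) (DihedralGroup 4)) ∧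
    -- F₁₂ = [5³, 1¹¹; 2¹³; 26]
    (∃ T₁ T₂ : PlaneTree 26, PlaneTree.IsPair T₁ T₂
        (Multiset.replicate 3 5 + Multiset.replicate 11 1) (Multiset.replicate 13 2) ∧
      IsSemidirect T₁.monodromyGroup (AltSq 13) (Cyc 2) ∧
      IsSemidirect T₂.monodromyGroup (AltSq 13) (Cyc 2)) :=
  ⟨⟨PlaneTree.seven₁, PlaneTree.seven₂,
      ⟨⟨PlaneTree.seven₁_parts, PlaneTree.seven₁_parts'⟩,
       ⟨PlaneTree.seven₂_parts, PlaneTree.seven₂_parts'⟩,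
        PlaneTree.not_iso_seven₁_seven₂, PlaneTree.seven₁_or_seven₂⟩,
      PlaneTree.seven₁_monodromyGroup, PlaneTree.seven₂_monodromyGroup⟩,
    ⟨PlaneTree.seven₃, PlaneTree.seven₄,
      ⟨⟨PlaneTree.seven₃_parts, PlaneTree.seven₃_parts'⟩,
       ⟨PlaneTree.seven₄_parts, PlaneTree.seven₄_parts'⟩,
        PlaneTree.not_iso_seven₃_seven₄, PlaneTree.seven₃_or_seven₄⟩,
      PlaneTree.seven₃_monodromyGroup, PlaneTree.seven₄_monodromyGroup⟩,
    ⟨PlaneTree.nine₁, PlaneTree.nine₂,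
      ⟨⟨PlaneTree.nine₁_parts, PlaneTree.nine₁_parts'⟩,
       ⟨PlaneTree.nine₂_parts, PlaneTree.nine₂_parts'⟩,
        PlaneTree.not_iso_nine₁_nine₂, PlaneTree.nine₁_or_nine₂⟩,
      PlaneTree.nine₁_monodromyGroup, PlaneTree.nine₂_monodromyGroup⟩,
    ⟨PlaneTree.ten₁, PlaneTree.ten₂,
      ⟨⟨PlaneTree.ten₁_parts, PlaneTree.ten₁_parts'⟩, ⟨PlaneTree.ten₂_parts, PlaneTree.ten₂_parts'⟩,
        PlaneTree.not_iso_ten₁_ten₂, PlaneTree.ten₁_or_ten₂⟩,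
      PlaneTree.ten₁_monodromyGroup, PlaneTree.ten₂_monodromyGroup⟩,
    ⟨PlaneTree.twenty₁, PlaneTree.twenty₂,
      ⟨⟨PlaneTree.twenty₁_parts, PlaneTree.twenty₁_parts'⟩,
       ⟨PlaneTree.twenty₂_parts, PlaneTree.twenty₂_parts'⟩,
        PlaneTree.not_iso_twenty₁_twenty₂, PlaneTree.twenty₁_or_twenty₂⟩,
      PlaneTree.twenty₁_monodromyGroup, PlaneTree.twenty₂_monodromyGroup⟩,
    ⟨PlaneTree.twentySix₁, PlaneTree.twentySix₂,
      ⟨⟨PlaneTree.twentySix₁_parts, PlaneTree.twentySix₁_parts'⟩,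
       ⟨PlaneTree.twentySix₂_parts, PlaneTree.twentySix₂_parts'⟩,
        PlaneTree.not_iso_twentySix₁_twentySix₂, PlaneTree.twentySix₁_or_twentySix₂⟩,
      PlaneTree.twentySix₁_monodromyGroup, PlaneTree.twentySix₂_monodromyGroup⟩⟩
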